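/- Let $\Omega=\{X=(X_1,X_2)\in\mathbb R^2: X_2>0\}$, let $\varepsilon_2>0$, let $\sigma:\mathbb R\to\mathbb R$ be twice differentiable with $|\sigma|+|\sigma'|+|\sigma''|\le C$ on $\mathbb R$ for some constant $C>0$, and let $u_0\in W^{2,\infty}(\overline\Omega)$ (continuous up to $\partial\Omega$) be harmonic in $\Omega$. For $\varepsilon>0$ put $\Omega^\varepsilon=\varepsilon\mathbb Z\times\varepsilon(\mathbb N\setminus\{0\})$, $\partial\Omega^\varepsilon=\varepsilon\mathbb Z\times\{0\}$, $\overline\Omega^\varepsilon=\Omega^\varepsilon\cup\partial\Omega^\varepsilon$. Conditions on a potential $V:\mathbb R\to\mathbb R$: (i) $V\in C^3(\mathbb R)$; (ii) $V(a+1)=V(a)$ for all $a$; (iii) $V=0$ on $\mathbb Z$ and $V>0$ on $\mathbb R\setminus\mathbb Z$. Given $W^\varepsilon:\mathbb R\to\mathbb R$, the rescaled generalized Frenkel–Kontorova system is $$\begin{cases}0=\dfrac1{\varepsilon^2}\displaystyle\sum_{J\in\mathbb Z^2,\,|J|=1}\big(u^\varepsilon(X+\varepsilon J,t)-u^\varepsilon(X,t)\big),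 & (X,t)\in\Omega^\varepsilon\times(0,\infty),\\[2mm] u^\varepsilon_t(X,t)=2\varepsilon_2\sigma(\varepsilon_2X_1)-(W^\varepsilon)'(u^\varepsilon(X,t))+\dfrac1\varepsilon\displaystyle\sum_{J\in\mathbb Z^2,\,|J|=1,\,J_2\ge0}\big(u^\varepsilon(X+\varepsilon J,t)-u^\varepsilon(X,t)\big), & (X,t)\in\partial\Omega^\varepsilon\times(0,\infty),\\[2mm] u^\varepsilon(X,0)=u_0(X), & X\in\partial\Omega^\varepsilon.\end{cases}\tag{FK}$$ A viscosity subsolution of (FK) is a function $u$ on $\overline\Omega^\varepsilon\times[0,\infty)$, upper semicontinuous in $t$, with $u(\cdot,0)\le u_0$ on $\partial\Omega^\varepsilon$, satisfying the first line with $0\le$ in place of $0=$, and such that whenever $X\in\partial\Omega^\varepsilon$, $t>0$, $\varphi\in C^1(\mathbb R)$ and $u(X,\cdot)-\varphi$ has a local maximum at $t$, the second line holds at $(X,t)$ with $\varphi'(t)\le$ in place of $u^\varepsilon_t(X,t)=$. Supersolutions are defined symmetrically (lower semicontinuity, reversed inequalities, local minima). A viscosity solution is a function that is both a sub- and a supersolution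 and is bounded on $\overline\Omega^\varepsilon\times[0,T]$ for every $T>0$. The Peierls–Nabarro system for a potential $W$ is $$\begin{cases}0=\Delta u^0 & \text{on }\Omega\times(0,\infty),\\ u^0_t=2\varepsilon_2\sigma(\varepsilon_2X_1)-W'(u^0)+\dfrac{\partial u^0}{\partial X_2} & \text{on }\partial\Omega\times(0,\infty),\\ u^0(X,0)=u_0(X) & \text{for }X\in\partial\Omega.\end{cases}\tag{PN}$$ A viscosity subsolution of (PN) is an upper semicontinuous function $u$ on $\overline\Omega\times[0,\infty)$ with $u(\cdot,0)\le u_0$ on $\partial\Omega$ such that, whenever $\varphi\in C^2(\mathbb R^2\times\mathbb R)$ and $u-\varphi$ has a local maximum relative to $\overline\Omega\times(0,\infty)$ at $(X,t)$, one has at $(X,t)$: $-\Delta\varphi\le0$ if $X\in\Omega$, and $\min\big(-\Delta\varphi,\ \varphi_t-2\varepsilon_2\sigma(\varepsilon_2X_1)+W'(u)-\partial\varphi/\partial X_2\big)\le0$ if $X\in\partial\Omega$. Supersolutions are defined symmetrically (lower semicontinuity, local minima, $\max\ge0$ in place of $\min\le0$). A viscosity solution is a function that is both and is bounded on $\overline\Omega\times[0,T]$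 for every $T>0$. **Theorem.** (a) Let $\varepsilon>0$ and suppose that $\varepsilon W^\varepsilon$ satisfies (i), (ii), (iii) and, for some $\delta>0$, $\varepsilon W^\varepsilon(a)=\frac12a^2$ for all $|a|<\delta$. Then (FK) has a unique viscosity solution $u^\varepsilon$. (b) Suppose that the hypothesis of (a) holds for all sufficiently small $\varepsilon>0$ (with $\delta$ allowed to depend on $\varepsilon$), that $W$ satisfies (i), (ii), (iii) and $W''(0)>0$, and that $\|W^\varepsilon-W\|_{C^1(\mathbb R)}\to0$ as $\varepsilon\to0$. Then there is a viscosity solution $u^0$ of (PN) such that $u^\varepsilon\to u^0$ locally uniformly as $\varepsilon\to0$, i.e. for every $R>0$ $$\sup\big\{|u^\varepsilon(X,t)-u^0(X,t)|:\ X\in\overline\Omega^\varepsilon,\ |X|\le R,\ 0\le t\le R\big\}\to0 .$$ -/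

import Mathlib

open Set Filter Topology MeasureTheory
open scoped ContDiff

noncomputable section

namespace FKPN

/-- The Euclidean plane, with coordinates `X 0 = X₁` and `X 1 = X₂`. -/
abbrev Plane : Type := EuclideanSpace ℝ (Fin 2)

/-- The open upper half-plane `Ω`. -/
def Omega : Set Plane := {X | 0 < X 1}

/-- The closed upper half-plane. -/
def OmegaBar : Set Plane := {X | 0 ≤ X 1}

/-! ### Assumptions on the potentials and on the stress -/

/-- Regularity, `1`-periodicity, and minimum `0` attained exactly on `ℤ`. -/
structure PeriodicPotential (W : ℝ → ℝ) : Prop where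
  regular : ContDiff ℝ 3 W
  periodic : ∀ a, W (a + 1) = W a
  zero_int : ∀ n : ℤ, W n = 0
  pos : ∀ a, (∀ n : ℤ, a ≠ n) → 0 < W a

/-- A periodic potential that is exactly harmonic near `0`. -/
def LocallyHarmonicPotential (W : ℝ → ℝ) : Prop :=
  PeriodicPotential W ∧ ∃ δ > 0, ∀ a, |a| < δ → W a = a ^ 2 / 2

/-- A periodic potential whose minima are non-degenerate. -/
def NondegeneratePotential (W : ℝ → ℝ) : Prop :=
  PeriodicPotential W ∧ 0 < deriv (deriv W) 0

/-- The stress is twice differentiable and bounded together with its first two derivatives. -/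
def AdmissibleStress (σ : ℝ → ℝ) : Prop :=
  Differentiable ℝ σ ∧ Differentiable ℝ (deriv σ) ∧
    ∃ C > 0, ∀ x, |σ x| + |deriv σ x| + |deriv (deriv σ) x| ≤ C

/-- `‖W^ε - W‖_{C¹(ℝ)} → 0` as `ε → 0⁺`. -/
def TendstoC1 (Weps : ℝ → ℝ → ℝ) (W : ℝ → ℝ) : Prop :=
  TendstoUniformly Weps W (𝓝[>] 0) ∧
    TendstoUniformly (fun ε => deriv (Weps ε)) (deriv W) (𝓝[>] 0)

/-! ### The Sobolev space `W^{2,∞}` of the half-plane -/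

/-- `g` is the weak derivative of `f` on `Ω` in the `k`-th coordinate direction. -/
def IsWeakDeriv (k : Fin 2) (f g : Plane → ℝ) : Prop :=
  ∀ φ : Plane → ℝ, ContDiff ℝ ∞ φ → HasCompactSupport φ → tsupport φ ⊆ Omega →
    ∫ X in Omega, f X * lineDeriv ℝ φ X (EuclideanSpace.single k 1) = -∫ X in Omega, g X * φ X

/-- `f ∈ L^∞(Ω)`. -/
def MemLinf (f : Plane → ℝ) : Prop := MemLp f ⊤ (volume.restrict Omega)

/-- `f ∈ W^{1,∞}(Ω)`. -/
def MemW1inf (f : Plane → ℝ) : Prop :=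
  MemLinf f ∧ ∀ k, ∃ g, MemLinf g ∧ IsWeakDeriv k f g

/-- `f ∈ W^{2,∞}` on the closed half-plane: `f ∈ W^{2,∞}(Ω)`, and `f` is the representative that is
continuous up to the boundary. -/
def MemW2inf (f : Plane → ℝ) : Prop :=
  ContinuousOn f OmegaBar ∧ MemLinf f ∧ ∀ k, ∃ g, MemW1inf g ∧ IsWeakDeriv k f g

/-! ### The rescaled generalized Frenkel-Kontorova system

A function on the rescaled lattice `(ε ℤ) × (ε ℕ)` is written `u i j t`, for its value at the lattice
point `X = (ε i, ε j)` and at time `t`; the boundary of the lattice is `j = 0`. -/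

/-- The lattice point `(ε i, ε j)`. -/
def latticePoint (ε : ℝ) (i : ℤ) (j : ℕ) : Plane := !₂[ε * i, ε * j]

/-- The discrete Laplacian `ε⁻² ∑_{|J| = 1} (u(X + εJ, t) - u(X, t))` at the interior lattice point
`X = (ε i, ε (j + 1))`. -/
def discreteLaplacian (ε : ℝ) (u : ℤ → ℕ → ℝ → ℝ) (i : ℤ) (j : ℕ) (t : ℝ) : ℝ :=
  1 / ε ^ 2 *
    ((u (i + 1) (j + 1) t - u i (j + 1) t) + (u (i - 1) (j + 1) t - u i (j + 1) t) +
      (u i (j + 2) t - u i (j + 1) t) + (u i j t - u i (j + 1) t))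

/-- The operator `I^ε[u] = ε⁻¹ ∑_{|J| = 1, J₂ ≥ 0} (u(X + εJ, t) - u(X, t))` at the boundary lattice
point `X = (ε i, 0)`. -/
def boundaryOperator (ε : ℝ) (u : ℤ → ℕ → ℝ → ℝ) (i : ℤ) (t : ℝ) : ℝ :=
  1 / ε * ((u (i + 1) 0 t - u i 0 t) + (u (i - 1) 0 t - u i 0 t) + (u i 1 t - u i 0 t))

/-- The right-hand side of the evolution equation at the boundary lattice point `X = (ε i, 0)`. -/
def boundaryForce (ε ε₂ : ℝ) (σ Weps : ℝ → ℝ) (u : ℤ → ℕ → ℝ → ℝ) (i : ℤ) (t : ℝ) : ℝ :=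
  2 * ε₂ * σ (ε₂ * (ε * i)) - deriv Weps (u i 0 t) + boundaryOperator ε u i t

/-- Viscosity subsolution of the lattice system with initial data `u₀`. -/
structure IsLatticeSubsolution (ε ε₂ : ℝ) (σ Weps : ℝ → ℝ) (u₀ : Plane → ℝ)
    (u : ℤ → ℕ → ℝ → ℝ) : Prop where
  usc : ∀ i j, UpperSemicontinuousOn (u i j) (Ici 0)
  interior : ∀ i j, ∀ t > 0, 0 ≤ discreteLaplacian ε u i j t
  boundary : ∀ i, ∀ t > 0, ∀ φ : ℝ → ℝ, ContDiff ℝ 1 φ →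
    IsLocalMax (fun s => u i 0 s - φ s) t → deriv φ t ≤ boundaryForce ε ε₂ σ Weps u i t
  initial : ∀ i, u i 0 0 ≤ u₀ (latticePoint ε i 0)

/-- Viscosity supersolution of the lattice system with initial data `u₀`. -/
structure IsLatticeSupersolution (ε ε₂ : ℝ) (σ Weps : ℝ → ℝ) (u₀ : Plane → ℝ)
    (u : ℤ → ℕ → ℝ → ℝ) : Prop where
  lsc : ∀ i j, LowerSemicontinuousOn (u i j) (Ici 0)
  interior : ∀ i j, ∀ t > 0, discreteLaplacian ε u i j t ≤ 0
  boundary : ∀ i, ∀ t > 0, ∀ φ : ℝ → ℝ, ContDiff ℝ 1 φ →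
    IsLocalMin (fun s => u i 0 s - φ s) t → boundaryForce ε ε₂ σ Weps u i t ≤ deriv φ t
  initial : ∀ i, u₀ (latticePoint ε i 0) ≤ u i 0 0

/-- Viscosity solution of the lattice system, in the class of functions that are bounded on bounded
time intervals. -/
structure IsLatticeSolution (ε ε₂ : ℝ) (σ Weps : ℝ → ℝ) (u₀ : Plane → ℝ)
    (u : ℤ → ℕ → ℝ → ℝ) : Prop where
  sub : IsLatticeSubsolution ε ε₂ σ Weps u₀ u
  super : IsLatticeSupersolution ε ε₂ σ Weps u₀ u
  bounded : ∀ T : ℝ, ∃ C : ℝ, ∀ i j, ∀ t ∈ Icc 0 T, |u i j t| ≤ C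

/-! ### The Peierls-Nabarro system -/

/-- The Laplacian in the space variables of `φ(X, t)`. -/
def spaceLaplacian (φ : Plane → ℝ → ℝ) (X : Plane) (t : ℝ) : ℝ :=
  Laplacian.laplacian (fun Y => φ Y t) X

/-- `φ_t - 2 ε₂ σ(ε₂ X₁) + W'(r) - ∂φ/∂X₂` at the point `(X, t)`. -/
def boundaryResidual (ε₂ : ℝ) (σ W : ℝ → ℝ) (φ : Plane → ℝ → ℝ) (r : ℝ) (X : Plane) (t : ℝ) : ℝ :=
  deriv (fun s => φ X s) t - 2 * ε₂ * σ (ε₂ * X 0) + deriv W r -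
    lineDeriv ℝ (fun Y => φ Y t) X (EuclideanSpace.single 1 1)

/-- Viscosity subsolution of the Peierls-Nabarro system with initial data `u₀`. On the boundary one
of the two equations holds. -/
structure IsPNSubsolution (ε₂ : ℝ) (σ W : ℝ → ℝ) (u₀ : Plane → ℝ) (u : Plane → ℝ → ℝ) : Prop where
  usc : UpperSemicontinuousOn (fun p : Plane × ℝ => u p.1 p.2) (OmegaBar ×ˢ Ici 0)
  interior : ∀ X, 0 < X 1 → ∀ t > 0, ∀ φ : Plane → ℝ → ℝ,
    ContDiff ℝ 2 (fun p : Plane × ℝ => φ p.1 p.2) →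
    IsLocalMaxOn (fun p : Plane × ℝ => u p.1 p.2 - φ p.1 p.2) (OmegaBar ×ˢ Ioi 0) (X, t) →
    -spaceLaplacian φ X t ≤ 0
  boundary : ∀ X, X 1 = 0 → ∀ t > 0, ∀ φ : Plane → ℝ → ℝ,
    ContDiff ℝ 2 (fun p : Plane × ℝ => φ p.1 p.2) →
    IsLocalMaxOn (fun p : Plane × ℝ => u p.1 p.2 - φ p.1 p.2) (OmegaBar ×ˢ Ioi 0) (X, t) →
    min (-spaceLaplacian φ X t) (boundaryResidual ε₂ σ W φ (u X t) X t) ≤ 0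
  initial : ∀ X, X 1 = 0 → u X 0 ≤ u₀ X

/-- Viscosity supersolution of the Peierls-Nabarro system with initial data `u₀`. On the boundary
one of the two equations holds. -/
structure IsPNSupersolution (ε₂ : ℝ) (σ W : ℝ → ℝ) (u₀ : Plane → ℝ) (u : Plane → ℝ → ℝ) :
    Prop where
  lsc : LowerSemicontinuousOn (fun p : Plane × ℝ => u p.1 p.2) (OmegaBar ×ˢ Ici 0)
  interior : ∀ X, 0 < X 1 → ∀ t > 0, ∀ φ : Plane → ℝ → ℝ,
    ContDiff ℝ 2 (fun p : Plane × ℝ => φ p.1 p.2) →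
    IsLocalMinOn (fun p : Plane × ℝ => u p.1 p.2 - φ p.1 p.2) (OmegaBar ×ˢ Ioi 0) (X, t) →
    0 ≤ -spaceLaplacian φ X t
  boundary : ∀ X, X 1 = 0 → ∀ t > 0, ∀ φ : Plane → ℝ → ℝ,
    ContDiff ℝ 2 (fun p : Plane × ℝ => φ p.1 p.2) →
    IsLocalMinOn (fun p : Plane × ℝ => u p.1 p.2 - φ p.1 p.2) (OmegaBar ×ˢ Ioi 0) (X, t) →
    0 ≤ max (-spaceLaplacian φ X t) (boundaryResidual ε₂ σ W φ (u X t) X t)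
  initial : ∀ X, X 1 = 0 → u₀ X ≤ u X 0

/-- Viscosity solution of the Peierls-Nabarro system, in the class of functions that are bounded on
bounded time intervals. -/
structure IsPNSolution (ε₂ : ℝ) (σ W : ℝ → ℝ) (u₀ : Plane → ℝ) (u : Plane → ℝ → ℝ) : Prop where
  sub : IsPNSubsolution ε₂ σ W u₀ u
  super : IsPNSupersolution ε₂ σ W u₀ u
  bounded : ∀ T : ℝ, ∃ C : ℝ, ∀ X ∈ OmegaBar, ∀ t ∈ Icc 0 T, |u X t| ≤ C

/-- The lattice functions `u^ε` converge to `u`, uniformly on bounded subsets of the closed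
half-plane times `[0, ∞)`, as `ε → 0⁺`. -/
def LatticeTendstoLocallyUniformly (ueps : ℝ → ℤ → ℕ → ℝ → ℝ) (u : Plane → ℝ → ℝ) : Prop :=
  ∀ R : ℝ, ∀ η > 0, ∀ᶠ ε in 𝓝[>] (0 : ℝ), ∀ i j, ∀ t ∈ Icc 0 R,
    ‖latticePoint ε i j‖ ≤ R → |ueps ε i j t - u (latticePoint ε i j) t| ≤ η

end FKPN

end

/-! On the lattice everything rests on one barrier argument. In a strip of `n` layers an explicit
discrete superharmonic function, combined with the weight `exp (-(K + 1) * t)`, dominates any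
bounded approximate subsolution of the linearized system. The resulting bound has the form `M / Y +
2 * η * Y + 2 * η`, with `Y` the height of the strip and `η` the residual: the price of boundedness
at the top plus the price of the residuals.

For (a), a function that is both sub- and supersolution is continuous in time and its boundary
values are differentiable with derivative equal to the right-hand side, so the difference of two
solutions is a classical object to which the comparison applies (`lattice_comparison`,
`IsLatticeSolution.le`). For existence, the interior equation is solved at each time by the bounded
discrete harmonic extension, which is a contraction in the sup norm. What remains is a globally
Lipschitz ODE in the space of bounded sequences of boundary values (`exists_isLatticeSolution`).

For (b), the Dirichlet-to-Neumann evolution `v_t = ∂v/∂y` of bounded harmonic functions is transport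
in height: its solution at time `t` and height `y` is the Poisson integral of the initial data at
height `t + y`. Thus (PN) becomes the mild equation given by `duhamel`, solved by a fixed point
whose boundary values are Lipschitz in space (`exists_mild_solution`). The function obtained need
not be differentiable at the boundary. Raised by `δ > 0`, however, it has time and normal
derivatives there, it satisfies `v_t = ∂v/∂y + P_δ G`, where `P_δ` is the Poisson average at height
`δ`, and it differs from the original by a modulus of continuity in `δ`.

This shift is used twice. Letting `δ → 0` in the test-function inequalities shows that the mild
solution is a viscosity solution (`IsDuhamelData.boundary_test`). Inserting the shifted function
into the lattice scheme leaves residuals `O(ε² / δ⁴)` inside and `O(ε / δ²)` plus the modulus plus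
`‖W' - (W^ε)'‖` on the boundary, and the strip estimate turns them into an error bound
(`IsDuhamelData.abs_sub_le`). Choosing `Y` large, then `η`, `δ` and `ε` small, in this order, gives
convergence directly, without compactness and without comparison for (PN). -/

namespace FKPN

/-! ### Comparison on the lattice -/

/-- A function that has its maximum over `[0, t]` at the right endpoint has nonnegative derivative
there. -/
theorem deriv_nonneg_of_le_right {f : ℝ → ℝ} {d t : ℝ} (ht : 0 < t) (hf : HasDerivAt f d t)
    (hmax : ∀ s ∈ Icc 0 t, f s ≤ f t) : 0 ≤ d := by
  have h1 : IsLocalMaxOn f (Icc 0 t) t := by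
    filter_upwards [self_mem_nhdsWithin] with s hs using hmax s hs
  have h2 : (0 - t) ∈ posTangentConeAt (Icc 0 t) t := by
    apply sub_mem_posTangentConeAt_of_segment_subset
    rw [segment_symm, segment_eq_Icc ht.le]
  have h3 := h1.hasFDerivWithinAt_nonpos hf.hasFDerivAt.hasFDerivWithinAt h2
  simp at h3
  nlinarith

/-- The explicit discrete superharmonic function used as a barrier on the strip of `n` layers, whose
height is `Y`. -/
def stripBarrier (ε A c η δ Y : ℝ) (i : ℤ) (j : ℕ) : ℝ :=
  A + c * (ε * j) + η * ((ε * j) * (2 * Y - ε * j)) +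
    δ * ((ε * i) ^ 2 + Y ^ 2 + ε - (ε * j) ^ 2)

theorem le_stripBarrier {ε A c η δ Y : ℝ} {i : ℤ} {j : ℕ} (hε : 0 < ε) (hη : 0 ≤ η) (hδ : 0 ≤ δ)
    (hj : ε * j ≤ Y) : A + c * (ε * j) + δ * (ε * i) ^ 2 ≤ stripBarrier ε A c η δ Y i j := by
  have hj0 : 0 ≤ ε * j := by positivity
  have h1 : 0 ≤ η * ((ε * j) * (2 * Y - ε * j)) :=
    mul_nonneg hη (mul_nonneg hj0 (by linarith))
  have h2 : 0 ≤ δ * (Y ^ 2 + ε - (ε * j) ^ 2) := mul_nonneg hδ (by nlinarith)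
  unfold stripBarrier
  linarith

/-- Maximum principle for the weighted function minus the barrier. A positive maximum is impossible
in the interior because the barrier has discrete Laplacian `-2 * η`, at the top because it exceeds
`M` there, and on the boundary because the weight contributes a damping term that outweighs the flux
of the barrier. The boundary inequality is needed only where `e` is positive, so a Lipschitz
nonlinearity may be replaced by `K * e`. -/
theorem exp_mul_le_stripBarrier {ε T K η M : ℝ} (hε : 0 < ε) (hη : 0 < η) (hM : 0 ≤ M) (hK : 0 ≤ K)
    {e : ℤ → ℕ → ℝ → ℝ}
    (hcont : ∀ i j, ContinuousOn (e i j) (Icc 0 T))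
    (hbd : ∀ i j, ∀ t ∈ Icc 0 T, e i j t ≤ M)
    (hinner : ∀ i j, ∀ t ∈ Icc 0 T, -η ≤ discreteLaplacian ε e i j t)
    (hbdy : ∀ i, ∀ t ∈ Ioc 0 T, 0 < e i 0 t → ∃ d, HasDerivAt (e i 0) d t ∧
      d ≤ boundaryOperator ε e i t + K * e i 0 t + η)
    (hstart : ∀ i, e i 0 0 ≤ η) {n : ℕ} (hn : 0 < n) {δ : ℝ} (hδ : 0 < δ)
    {i : ℤ} {j : ℕ} {t : ℝ} (hj : j ≤ n) (ht : t ∈ Icc 0 T) :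
    Real.exp (-(K + 1) * t) * e i j t ≤
      stripBarrier ε (M / (ε * n) + 2 * η * (ε * n) + 2 * η) (M / (ε * n)) η δ (ε * n) i j := by
  have hnpos : (0 : ℝ) < n := by exact_mod_cast hn
  set Y : ℝ := ε * n with hY
  have hYpos : 0 < Y := by positivity
  -- This slope lifts the barrier above `M` on the top layer.
  set c : ℝ := M / Y with hc
  have hcY : c * Y = M := by rw [hc]; field_simp
  have hc0 : 0 ≤ c := by positivity
  -- The flux of the barrier at `j = 0` is about `c + 2 * η * Y`; of the two additional `η`, one
  -- absorbs the residual and one makes the inequality strict.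
  set A : ℝ := c + 2 * η * Y + 2 * η with hA
  have hA0 : 0 < A := by positivity
  set B : ℤ → ℕ → ℝ := stripBarrier ε A c η δ Y with hB
  have hBlow : ∀ i : ℤ, ∀ j : ℕ, j ≤ n → A + c * (ε * j) + δ * (ε * i) ^ 2 ≤ B i j := by
    intro i j hj
    exact le_stripBarrier hε hη.le hδ.le (mul_le_mul_of_nonneg_left (by exact_mod_cast hj) hε.le)
  set E : ℝ → ℝ := fun s => Real.exp (-(K + 1) * s) with hE
  have hE0 : ∀ s, 0 < E s := fun s => Real.exp_pos _
  have hE1 : ∀ s, 0 ≤ s → E s ≤ 1 := by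
    intro s hs
    apply Real.exp_le_one_iff.2
    nlinarith
  have hzM : ∀ i j, ∀ s ∈ Icc 0 T, E s * e i j s ≤ M := by
    intro i j s hs
    calc E s * e i j s ≤ E s * M := mul_le_mul_of_nonneg_left (hbd i j s hs) (hE0 s).le
      _ ≤ 1 * M := mul_le_mul_of_nonneg_right (hE1 s hs.1) hM
      _ = M := one_mul M
  by_contra! hneg
  -- For `|i| ≥ I` the quadratic term of the barrier exceeds `M`, so the search for a positive
  -- maximum is confined to a finite box.
  obtain ⟨I, hI⟩ : ∃ I : ℕ, |i| ≤ I ∧ M ≤ δ * (ε * I) ^ 2 := by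
    obtain ⟨m, hm⟩ := exists_nat_ge (M / (δ * ε ^ 2))
    have hm' : M ≤ m * (δ * ε ^ 2) := (div_le_iff₀ (by positivity)).1 hm
    refine ⟨max (m + 1) i.natAbs, ?_, ?_⟩
    · rw [Int.abs_eq_natAbs]
      exact_mod_cast le_max_right (m + 1) i.natAbs
    · have h1 : ((m : ℝ) + 1) ≤ (max (m + 1) i.natAbs : ℕ) := by
        exact_mod_cast le_max_left (m + 1) i.natAbs
      have h2 : (m : ℝ) ≤ ((max (m + 1) i.natAbs : ℕ) : ℝ) ^ 2 := by
        have : (0 : ℝ) ≤ m := by positivity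
        nlinarith
      calc M ≤ m * (δ * ε ^ 2) := hm'
        _ ≤ ((max (m + 1) i.natAbs : ℕ) : ℝ) ^ 2 * (δ * ε ^ 2) := by gcongr
        _ = _ := by ring
  obtain ⟨hiI, hI⟩ := hI
  set S : Set (ℤ × ℕ) := Icc (-(I : ℤ)) I ×ˢ Iic n with hS
  have hScompact : IsCompact S := ((finite_Icc _ _).prod (finite_Iic n)).isCompact
  have hfun : ContinuousOn (fun p : (ℤ × ℕ) × ℝ => E p.2 * e p.1.1 p.1.2 p.2 - B p.1.1 p.1.2)
      (S ×ˢ Icc 0 T) := by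
    rw [continuousOn_prod_of_discrete_left]
    intro a
    have hsub : {b : ℝ | (a, b) ∈ S ×ˢ Icc 0 T} ⊆ Icc 0 T := fun b hb => hb.2
    have h1 : ContinuousOn (fun b : ℝ => E b * e a.1 a.2 b - B a.1 a.2) (Icc 0 T) :=
      ((by fun_prop : Continuous E).continuousOn.mul (hcont a.1 a.2)).sub continuousOn_const
    exact h1.mono hsub
  have hmem : ((i, j), t) ∈ S ×ˢ Icc 0 T :=
    ⟨⟨⟨by have := neg_abs_le i; simp only; omega, (le_abs_self i).trans hiI⟩, hj⟩, ht⟩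
  obtain ⟨⟨⟨i₁, j₁⟩, t₁⟩, ⟨⟨hi₁, hj₁⟩, ht₁⟩, hmax⟩ :=
    (hScompact.prod isCompact_Icc).exists_isMaxOn ⟨_, hmem⟩ hfun
  simp only [mem_Iic] at hj₁ ht₁ hi₁
  set θ : ℝ := E t₁ * e i₁ j₁ t₁ - B i₁ j₁ with hθ
  have hθ0 : 0 < θ := by
    have := hmax hmem
    simp only [mem_ofPred_eq] at this
    have h' : B i j < E t * e i j t := hneg
    linarith
  -- The maximum over the box also dominates outside it; this is needed because neighbours of the
  -- maximizer may leave the box.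
  have hmaxt : ∀ i' : ℤ, ∀ j' : ℕ, j' ≤ n → E t₁ * e i' j' t₁ - B i' j' ≤ θ := by
    intro i' j' hj'
    by_cases hi' : i' ∈ Icc (-(I : ℤ)) I
    · exact hmax (show ((i', j'), t₁) ∈ S ×ˢ Icc 0 T from ⟨⟨hi', hj'⟩, ht₁⟩)
    · have h1 := hzM i' j' t₁ ht₁
      have h2 := hBlow i' j' hj'
      have h3 : (I : ℝ) ^ 2 ≤ (i' : ℝ) ^ 2 := by
        have : (I : ℤ) ^ 2 ≤ i' ^ 2 := by
          rw [mem_Icc, not_and_or] at hi'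
          have hI0 : (0 : ℤ) ≤ I := by positivity
          rcases hi' with h | h <;> nlinarith
        exact_mod_cast this
      have h4 : δ * (ε * I) ^ 2 ≤ δ * (ε * i') ^ 2 := by
        rw [mul_pow, mul_pow]; gcongr
      have h5 : 0 ≤ c * (ε * j') := by positivity
      linarith
  rcases Nat.eq_zero_or_pos j₁ with rfl | hj₁pos
  · rcases ht₁.1.eq_or_lt with h0 | htpos
    · have h1 := hBlow i₁ 0 (Nat.zero_le n)
      have h2 := hstart i₁
      have h3 : E t₁ = 1 := by simp [hE, ← h0]
      rw [h3, ← h0, one_mul] at hθ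
      have h4 : 0 ≤ δ * (ε * i₁) ^ 2 := by positivity
      have h5 : 0 ≤ 2 * η * Y := by positivity
      simp only [Nat.cast_zero, mul_zero, add_zero] at h1
      linarith
    · have hBpos : 0 < B i₁ 0 := by
        have h1 := hBlow i₁ 0 (Nat.zero_le n)
        have h4 : 0 ≤ δ * (ε * i₁) ^ 2 := by positivity
        simp only [Nat.cast_zero, mul_zero, add_zero] at h1
        linarith
      have hzpos : 0 < E t₁ * e i₁ 0 t₁ := by linarith
      have hepos : 0 < e i₁ 0 t₁ := pos_of_mul_pos_right hzpos (hE0 t₁).le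
      obtain ⟨d, hd, hdle⟩ := hbdy i₁ t₁ ⟨htpos, ht₁.2⟩ hepos
      have hEd : HasDerivAt E (E t₁ * -(K + 1)) t₁ := by
        have := ((hasDerivAt_id t₁).const_mul (-(K + 1))).exp
        simpa [hE] using this
      have hnn := deriv_nonneg_of_le_right htpos (hEd.mul hd) (by
        intro s hs
        have := hmax (show ((i₁, 0), s) ∈ S ×ˢ Icc 0 T from
          ⟨⟨hi₁, Nat.zero_le n⟩, ⟨hs.1, hs.2.trans ht₁.2⟩⟩)
        simp only [mem_ofPred_eq] at this
        simp only [Pi.mul_apply]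
        linarith)
      have hop : E t₁ * boundaryOperator ε e i₁ t₁ ≤ δ * ε + c + 2 * η * Y - η * ε := by
        have h1 := hmaxt (i₁ + 1) 0 (Nat.zero_le n)
        have h2 := hmaxt (i₁ - 1) 0 (Nat.zero_le n)
        have h3 := hmaxt i₁ 1 hn
        have h4 : E t₁ * boundaryOperator ε e i₁ t₁ = 1 / ε *
            ((E t₁ * e (i₁ + 1) 0 t₁ - E t₁ * e i₁ 0 t₁) +
              (E t₁ * e (i₁ - 1) 0 t₁ - E t₁ * e i₁ 0 t₁) +
              (E t₁ * e i₁ 1 t₁ - E t₁ * e i₁ 0 t₁)) := by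
          unfold boundaryOperator; ring
        have h5 : 1 / ε * ((B (i₁ + 1) 0 - B i₁ 0) + (B (i₁ - 1) 0 - B i₁ 0) + (B i₁ 1 - B i₁ 0))
            = δ * ε + c + 2 * η * Y - η * ε := by
          simp only [hB, stripBarrier]
          push_cast
          field_simp
          ring
        rw [h4, ← h5]
        gcongr 1 / ε * ?_
        linarith
      -- The damping term `-E * e` is below `-B`. The summand `ε` inside the barrier cancels `δ *
      -- ε`, and `A` cancels the rest of the flux and the residual up to `-η - η * ε`, so the time
      -- derivative is negative.
      have hBl := hBlow i₁ 0 (Nat.zero_le n)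
      have hBeq : B i₁ 0 = A + δ * ((ε * i₁) ^ 2 + Y ^ 2 + ε) := by
        simp only [hB, stripBarrier]; push_cast; ring
      have h6 : E t₁ * d ≤ E t₁ * boundaryOperator ε e i₁ t₁ + K * (E t₁ * e i₁ 0 t₁) + η := by
        calc E t₁ * d ≤ E t₁ * (boundaryOperator ε e i₁ t₁ + K * e i₁ 0 t₁ + η) :=
              mul_le_mul_of_nonneg_left hdle (hE0 t₁).le
          _ = E t₁ * boundaryOperator ε e i₁ t₁ + K * (E t₁ * e i₁ 0 t₁) + E t₁ * η := by ring
          _ ≤ _ := by nlinarith [hE1 t₁ ht₁.1]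
      have h7 : 0 ≤ δ * (ε * i₁) ^ 2 + δ * Y ^ 2 := by positivity
      have h8 : 0 < η * ε := by positivity
      nlinarith
  · rcases hj₁.eq_or_lt with rfl | hjlt
    · have h1 := hzM i₁ j₁ t₁ ht₁
      have h2 := hBlow i₁ j₁ le_rfl
      have h3 : 0 ≤ δ * (ε * i₁) ^ 2 := by positivity
      rw [← hY, hcY] at h2
      linarith
    · obtain ⟨k, rfl⟩ : ∃ k, j₁ = k + 1 := ⟨j₁ - 1, by omega⟩
      have h0 := hinner i₁ k t₁ ht₁
      have h1 := hmaxt (i₁ + 1) (k + 1) hj₁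
      have h2 := hmaxt (i₁ - 1) (k + 1) hj₁
      have h3 := hmaxt i₁ (k + 2) (by omega)
      have h4 := hmaxt i₁ k (by omega)
      have h5 : E t₁ * discreteLaplacian ε e i₁ k t₁ = 1 / ε ^ 2 *
          ((E t₁ * e (i₁ + 1) (k + 1) t₁ - E t₁ * e i₁ (k + 1) t₁) +
            (E t₁ * e (i₁ - 1) (k + 1) t₁ - E t₁ * e i₁ (k + 1) t₁) +
            (E t₁ * e i₁ (k + 2) t₁ - E t₁ * e i₁ (k + 1) t₁) +
            (E t₁ * e i₁ k t₁ - E t₁ * e i₁ (k + 1) t₁)) := by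
        unfold discreteLaplacian; ring
      -- The linear term and the `δ`-term are discrete harmonic; only the concave `η`-term
      -- contributes.
      have h6 : 1 / ε ^ 2 * ((B (i₁ + 1) (k + 1) - B i₁ (k + 1)) +
          (B (i₁ - 1) (k + 1) - B i₁ (k + 1)) + (B i₁ (k + 2) - B i₁ (k + 1)) +
          (B i₁ k - B i₁ (k + 1))) = -(2 * η) := by
        simp only [hB, stripBarrier]
        push_cast
        field_simp
        ring
      have h7 : E t₁ * discreteLaplacian ε e i₁ k t₁ ≤ -(2 * η) := by
        rw [h5, ← h6]
        gcongr 1 / ε ^ 2 * ?_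
        linarith
      have h8 : -η ≤ E t₁ * discreteLaplacian ε e i₁ k t₁ := by
        nlinarith [hE1 t₁ ht₁.1, hE0 t₁]
      linarith

/-- Quantitative comparison: an approximate subsolution of the linearized lattice system is small
where the residuals are small and the number `n` of layers is suitably chosen. -/
theorem lattice_comparison_quantitative {ε T K η M : ℝ} (hε : 0 < ε) (hη : 0 < η) (hM : 0 ≤ M)
    (hK : 0 ≤ K) {e : ℤ → ℕ → ℝ → ℝ}
    (hcont : ∀ i j, ContinuousOn (e i j) (Icc 0 T))
    (hbd : ∀ i j, ∀ t ∈ Icc 0 T, e i j t ≤ M)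
    (hinner : ∀ i j, ∀ t ∈ Icc 0 T, -η ≤ discreteLaplacian ε e i j t)
    (hbdy : ∀ i, ∀ t ∈ Ioc 0 T, 0 < e i 0 t → ∃ d, HasDerivAt (e i 0) d t ∧
      d ≤ boundaryOperator ε e i t + K * e i 0 t + η)
    (hstart : ∀ i, e i 0 0 ≤ η) {n : ℕ} (hn : 0 < n)
    {i : ℤ} {j : ℕ} {t : ℝ} (hj : j ≤ n) (ht : t ∈ Icc 0 T) :
    e i j t ≤ Real.exp ((K + 1) * t) *
      ((M / (ε * n) + 2 * η * (ε * n) + 2 * η) * (1 + ε * j)) := by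
  have hnpos : (0 : ℝ) < n := by exact_mod_cast hn
  set Y : ℝ := ε * n with hY
  have hYpos : 0 < Y := by positivity
  set A : ℝ := M / Y + 2 * η * Y + 2 * η with hA
  have h1 : ∀ δ > 0, Real.exp (-(K + 1) * t) * e i j t ≤
      stripBarrier ε A (M / Y) η δ Y i j := fun δ hδ =>
    exp_mul_le_stripBarrier hε hη hM hK hcont hbd hinner hbdy hstart hn hδ hj ht
  have h2 : Tendsto (fun δ => stripBarrier ε A (M / Y) η δ Y i j) (𝓝[>] 0)
      (𝓝 (stripBarrier ε A (M / Y) η 0 Y i j)) := by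
    apply Tendsto.mono_left _ nhdsWithin_le_nhds
    apply Continuous.tendsto
    unfold stripBarrier
    fun_prop
  have h3 : Real.exp (-(K + 1) * t) * e i j t ≤ stripBarrier ε A (M / Y) η 0 Y i j :=
    ge_of_tendsto h2 (by filter_upwards [self_mem_nhdsWithin] with δ hδ using h1 δ hδ)
  have h4 : stripBarrier ε A (M / Y) η 0 Y i j ≤ A * (1 + ε * j) := by
    have hj0 : 0 ≤ ε * j := by positivity
    have h5 : η * ((ε * j) * (2 * Y - ε * j)) ≤ 2 * η * Y * (ε * j) := by
      nlinarith [mul_nonneg hη.le (sq_nonneg (ε * j))]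
    have h6 : 0 ≤ 2 * η * (ε * j) := by positivity
    unfold stripBarrier
    rw [hA]
    nlinarith
  calc e i j t = Real.exp ((K + 1) * t) * (Real.exp (-(K + 1) * t) * e i j t) := by
        rw [← mul_assoc, ← Real.exp_add, show (K + 1) * t + -(K + 1) * t = 0 by ring, Real.exp_zero,
          one_mul]
    _ ≤ _ := mul_le_mul_of_nonneg_left (h3.trans h4) (Real.exp_pos _).le

/-- Comparison: a bounded subsolution of the linearized lattice system with nonpositive initial data
is nonpositive. -/
theorem lattice_comparison {ε T K M : ℝ} (hε : 0 < ε) (hK : 0 ≤ K) {e : ℤ → ℕ → ℝ → ℝ}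
    (hcont : ∀ i j, ContinuousOn (e i j) (Icc 0 T))
    (hbd : ∀ i j, ∀ t ∈ Icc 0 T, e i j t ≤ M)
    (hinner : ∀ i j, ∀ t ∈ Icc 0 T, 0 ≤ discreteLaplacian ε e i j t)
    (hbdy : ∀ i, ∀ t ∈ Ioc 0 T, 0 < e i 0 t → ∃ d, HasDerivAt (e i 0) d t ∧
      d ≤ boundaryOperator ε e i t + K * e i 0 t)
    (hstart : ∀ i, e i 0 0 ≤ 0) {i : ℤ} {j : ℕ} {t : ℝ} (ht : t ∈ Icc 0 T) : e i j t ≤ 0 := by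
  set M' := max M 0
  have key : ∀ n : ℕ, 0 < n → j ≤ n → ∀ η > 0, e i j t ≤ Real.exp ((K + 1) * t) *
      ((M' / (ε * n) + 2 * η * (ε * n) + 2 * η) * (1 + ε * j)) := by
    intro n hn hj η hη
    refine lattice_comparison_quantitative hε hη (le_max_right M 0) hK hcont
      (fun i j t ht => (hbd i j t ht).trans (le_max_left M 0)) (fun i j t ht => ?_)
      (fun i t ht hp => ?_) (fun i => (hstart i).trans hη.le) hn hj ht
    · linarith [hinner i j t ht]
    · obtain ⟨d, hd, hdle⟩ := hbdy i t ht hp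
      exact ⟨d, hd, by linarith⟩
  -- The limits do not commute: the term `2 * η * (ε * n)` forces `η → 0` for fixed `n`, and only
  -- then `n → ∞`.
  have key2 : ∀ n : ℕ, 0 < n → j ≤ n → e i j t ≤ Real.exp ((K + 1) * t) *
      ((M' / (ε * n) + 2 * 0 * (ε * n) + 2 * 0) * (1 + ε * j)) := by
    intro n hn hj
    have h2 : Tendsto (fun η : ℝ => Real.exp ((K + 1) * t) *
        ((M' / (ε * n) + 2 * η * (ε * n) + 2 * η) * (1 + ε * j))) (𝓝[>] 0)
        (𝓝 (Real.exp ((K + 1) * t) *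
        ((M' / (ε * n) + 2 * 0 * (ε * n) + 2 * 0) * (1 + ε * j)))) := by
      apply Tendsto.mono_left _ nhdsWithin_le_nhds
      apply Continuous.tendsto (f := fun η : ℝ => Real.exp ((K + 1) * t) *
        ((M' / (ε * n) + 2 * η * (ε * n) + 2 * η) * (1 + ε * j)))
      fun_prop
    refine ge_of_tendsto h2 ?_
    filter_upwards [self_mem_nhdsWithin] with δ hδ using key n hn hj δ hδ
  have h3 : Tendsto (fun n : ℕ => Real.exp ((K + 1) * t) *
      ((M' / (ε * n) + 2 * 0 * (ε * n) + 2 * 0) * (1 + ε * j))) atTop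
      (𝓝 (Real.exp ((K + 1) * t) * ((0 + 0 + 0) * (1 + ε * j)))) := by
    refine Tendsto.const_mul _ (Tendsto.mul_const _ (Tendsto.add (Tendsto.add ?_ ?_) ?_))
    · exact tendsto_const_nhds.div_atTop (tendsto_natCast_atTop_atTop.const_mul_atTop hε)
    · simp
    · simp
  have h4 := ge_of_tendsto h3 (by
    filter_upwards [eventually_gt_atTop 0, eventually_ge_atTop j] with n hn hj using key2 n hn hj)
  simpa using h4

/-- The maximum principle for bounded discrete subharmonic functions on the half-plane. -/
theorem discrete_maximum_principle {w : ℤ → ℕ → ℝ} {M m : ℝ} (hbd : ∀ i j, w i j ≤ M)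
    (hsub : ∀ i j, 4 * w i (j + 1) ≤
      w (i + 1) (j + 1) + w (i - 1) (j + 1) + w i (j + 2) + w i j)
    (hm : ∀ i, w i 0 ≤ m) (i : ℤ) (j : ℕ) : w i j ≤ m := by
  -- With `T = 0` the evolution on the boundary is void, since `Ioc 0 0` is empty, and the initial
  -- condition plays the role of the Dirichlet condition.
  have := lattice_comparison (ε := 1) (T := 0) (K := 0) (M := M - m) one_pos le_rfl
    (e := fun i j _ => w i j - m) (fun i j => continuousOn_const)
    (fun i j t _ => by linarith [hbd i j])
    (fun i j t _ => by unfold discreteLaplacian; linarith [hsub i j])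
    (fun i t ht => absurd (ht.1.trans_le ht.2) (lt_irrefl _))
    (fun i => by linarith [hm i]) (i := i) (j := j) (t := 0) ⟨le_rfl, le_rfl⟩
  linarith

/-! ### Viscosity solutions of scalar evolution equations are classical -/

/-- If `u - Φ` increased from `a` to `b`, subtracting a small strictly increasing function would
leave an interior maximum, where the viscosity inequality would bound a positive slope by zero. The
extra unit of time beyond `b` makes room for the maximum to be interior. -/
theorem sub_le_sub_of_viscosity_subsolution {u Φ : ℝ → ℝ} {a b : ℝ} (hab : a < b)
    (hu : ContinuousOn u (Icc a (b + 1))) (hΦ : ContDiff ℝ 1 Φ)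
    (hv : ∀ t ∈ Ioo a (b + 1), ∀ φ : ℝ → ℝ, ContDiff ℝ 1 φ →
      IsLocalMax (fun s => u s - φ s) t → deriv φ t ≤ deriv Φ t) :
    u b - Φ b ≤ u a - Φ a := by
  by_contra! hlt
  set w : ℝ → ℝ := fun s => u s - Φ s with hw
  set β : ℝ := (w b - w a) / 2 with hβ
  have hβ0 : 0 < β := by simp only [hβ, hw]; linarith
  -- The rate is chosen so that the penalty, which equals `β` at `b`, has grown by more than `w (b +
  -- 1) - w b` at `b + 1`. Half the supposed increase is left at `b`, which excludes the endpoint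
  -- `a`.
  obtain ⟨n, hn0, hn⟩ : ∃ n : ℝ, 0 < n ∧ w (b + 1) - w b < β * n := by
    refine ⟨max 0 ((w (b + 1) - w b) / β) + 1, by positivity, ?_⟩
    have h1 := le_max_right 0 ((w (b + 1) - w b) / β)
    have h2 : w (b + 1) - w b = β * ((w (b + 1) - w b) / β) := by field_simp
    calc w (b + 1) - w b = β * ((w (b + 1) - w b) / β) := h2
      _ < _ := mul_lt_mul_of_pos_left (by linarith) hβ0
  set ψ : ℝ → ℝ := fun t => β * Real.exp (n * (t - b)) with hψ
  have hψd : ∀ t, HasDerivAt ψ (β * (Real.exp (n * (t - b)) * n)) t := by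
    intro t
    have := ((((hasDerivAt_id t).sub_const b).const_mul n).exp).const_mul β
    simpa [hψ] using this
  have hψc : ContDiff ℝ 1 ψ := by simp only [hψ]; fun_prop
  have hcont : ContinuousOn (fun s => w s - ψ s) (Icc a (b + 1)) :=
    (hu.sub hΦ.continuous.continuousOn).sub hψc.continuous.continuousOn
  obtain ⟨t, ht, hmax⟩ := isCompact_Icc.exists_isMaxOn (nonempty_Icc.2 (by linarith)) hcont
  have hb := hmax (show b ∈ Icc a (b + 1) from ⟨hab.le, by linarith⟩)
  simp only [mem_ofPred_eq] at hb
  have hψb : ψ b = β := by simp [hψ]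
  have hta : t ≠ a := by
    rintro rfl
    have : 0 < ψ t := by positivity
    rw [hψb] at hb
    linarith
  have htb : t ≠ b + 1 := by
    rintro rfl
    have h1 : ψ (b + 1) = β * Real.exp n := by simp [hψ]
    have h2 := mul_le_mul_of_nonneg_left (Real.add_one_le_exp n) hβ0.le
    rw [hψb, h1] at hb
    linarith
  have htI : t ∈ Ioo a (b + 1) := ⟨lt_of_le_of_ne ht.1 hta.symm, lt_of_le_of_ne ht.2 htb⟩
  have hloc : IsLocalMax (fun s => u s - (Φ s + ψ s)) t := by
    filter_upwards [Icc_mem_nhds htI.1 htI.2] with s hs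
    have := hmax hs
    simp only [mem_ofPred_eq, hw] at this
    linarith
  have hder := hv t htI _ (hΦ.add hψc) hloc
  have hΦd : HasDerivAt Φ (deriv Φ t) t := (hΦ.differentiable one_ne_zero t).hasDerivAt
  have hs := (hΦd.add (hψd t)).deriv
  rw [show (Φ + ψ) = fun s => Φ s + ψ s from rfl] at hs
  rw [hs] at hder
  have : 0 < β * (Real.exp (n * (t - b)) * n) := by positivity
  linarith

/-- An antiderivative of the continuous right-hand side is itself `C¹`, so the monotonicity lemma,
applied to `u` and to `-u`, shows that `u` minus this antiderivative is constant. -/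
theorem hasDerivAt_of_viscosity_solution {u F : ℝ → ℝ} (hu : ContinuousOn u (Ioi 0))
    (hF : ContinuousOn F (Ioi 0))
    (hsub : ∀ t > 0, ∀ φ : ℝ → ℝ, ContDiff ℝ 1 φ → IsLocalMax (fun s => u s - φ s) t →
      deriv φ t ≤ F t)
    (hsup : ∀ t > 0, ∀ φ : ℝ → ℝ, ContDiff ℝ 1 φ → IsLocalMin (fun s => u s - φ s) t →
      F t ≤ deriv φ t) {t : ℝ} (ht : 0 < t) : HasDerivAt u (F t) t := by
  set a : ℝ := t / 2 with ha
  have ha0 : 0 < a := by positivity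
  -- `F` is controlled only for positive times; freezing it before `a` gives a continuous integrand
  -- on the whole line.
  set f : ℝ → ℝ := fun s => F (max s a) with hf
  have hfc : Continuous f := by
    refine hF.comp_continuous (by fun_prop) (fun s => ?_)
    exact lt_of_lt_of_le ha0 (le_max_right s a)
  set Φ : ℝ → ℝ := fun s => ∫ r in a..s, f r with hΦ
  have hΦd : ∀ s, HasDerivAt Φ (f s) s := fun s => hfc.integral_hasStrictDerivAt a s |>.hasDerivAt
  have hΦ' : deriv Φ = f := funext fun s => (hΦd s).deriv
  have hΦc : ContDiff ℝ 1 Φ := by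
    rw [contDiff_one_iff_deriv]
    exact ⟨fun s => (hΦd s).differentiableAt, hΦ' ▸ hfc⟩
  have hsubset : ∀ s, Icc a s ⊆ Ioi 0 := fun s r hr => lt_of_lt_of_le ha0 hr.1
  have hfF : ∀ s, a < s → f s = F s := fun s hs => by simp only [hf, max_eq_left hs.le]
  have hle : ∀ s, a < s → u s - Φ s = u a - Φ a := by
    intro s hs
    apply le_antisymm
    · refine sub_le_sub_of_viscosity_subsolution hs (hu.mono (hsubset _)) hΦc ?_
      intro r hr φ hφ hloc
      rw [hΦ', hfF r hr.1]
      exact hsub r (ha0.trans hr.1) φ hφ hloc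
    · have := sub_le_sub_of_viscosity_subsolution (u := fun s => -u s) (Φ := fun s => -Φ s) hs
        (hu.mono (hsubset _)).neg hΦc.neg (by
          intro r hr φ hφ hloc
          have h1 := hsup r (ha0.trans hr.1) (fun s => -φ s) hφ.neg (by
            filter_upwards [hloc] with x hx
            linarith)
          rw [deriv.fun_neg] at h1 ⊢
          rw [hΦ', hfF r hr.1]
          linarith)
      linarith
  have hat : a < t := by rw [ha]; linarith
  rw [← hfF t hat]
  refine ((hΦd t).add_const (u a - Φ a)).congr_of_eventuallyEq ?_
  filter_upwards [lt_mem_nhds hat] with s hs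
  linarith [hle s hs]

/-! ### The potentials -/

theorem PeriodicPotential.deriv_periodic {W : ℝ → ℝ} (hW : PeriodicPotential W) :
    Function.Periodic (deriv W) 1 := by
  intro x
  rw [← deriv_comp_add_const]
  congr 1
  exact funext hW.periodic

theorem PeriodicPotential.contDiff_deriv {W : ℝ → ℝ} (hW : PeriodicPotential W) :
    ContDiff ℝ 2 (deriv W) := by
  have h3 : ContDiff ℝ (2 + 1) W := hW.regular
  exact (contDiff_succ_iff_deriv.1 h3).2.2

theorem exists_bound_of_periodic {f : ℝ → ℝ} (hf : Continuous f) (hp : Function.Periodic f 1) :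
    ∃ C, 0 ≤ C ∧ ∀ a, |f a| ≤ C := by
  obtain ⟨C, hC⟩ := (hp.isBounded_of_continuous one_ne_zero hf).exists_norm_le
  exact ⟨C, (norm_nonneg _).trans (hC (f 0) ⟨0, rfl⟩), fun a => hC (f a) ⟨a, rfl⟩⟩

theorem PeriodicPotential.exists_bound {W : ℝ → ℝ} (hW : PeriodicPotential W) :
    ∃ C, 0 ≤ C ∧ ∀ a, |deriv W a| ≤ C :=
  exists_bound_of_periodic hW.contDiff_deriv.continuous hW.deriv_periodic

theorem PeriodicPotential.exists_lipschitz {W : ℝ → ℝ} (hW : PeriodicPotential W) :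
    ∃ K, 0 ≤ K ∧ ∀ a b, |deriv W a - deriv W b| ≤ K * |a - b| := by
  have h1 : ContDiff ℝ (1 + 1) (deriv W) := hW.contDiff_deriv
  have h2 := contDiff_succ_iff_deriv.1 h1
  have hp : Function.Periodic (deriv (deriv W)) 1 := by
    intro x
    rw [← deriv_comp_add_const]
    congr 1
    exact funext hW.deriv_periodic
  obtain ⟨K, hK, hKb⟩ := exists_bound_of_periodic h2.2.2.continuous hp
  refine ⟨K, hK, fun a b => ?_⟩
  exact Convex.norm_image_sub_le_of_norm_deriv_le (s := univ) (fun x _ => h2.1 x)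
    (fun x _ => hKb x) convex_univ (mem_univ b) (mem_univ a)

/-- The hypotheses of (a) concern `ε * W`, while `W` itself enters the equation; the bounds below
transfer at the cost of a factor `ε⁻¹`. -/
theorem deriv_eq_of_scaled {ε : ℝ} (hε : 0 < ε) (W : ℝ → ℝ) (a : ℝ) :
    deriv W a = ε⁻¹ * deriv (fun a => ε * W a) a := by
  rw [deriv_const_mul_field]
  field_simp

theorem continuous_deriv_of_scaled {ε : ℝ} (hε : 0 < ε) {W : ℝ → ℝ}
    (hW : PeriodicPotential fun a => ε * W a) : Continuous (deriv W) := by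
  rw [funext (deriv_eq_of_scaled hε W)]
  exact continuous_const.mul hW.contDiff_deriv.continuous

theorem exists_lipschitz_of_scaled {ε : ℝ} (hε : 0 < ε) {W : ℝ → ℝ}
    (hW : PeriodicPotential fun a => ε * W a) :
    ∃ K, 0 ≤ K ∧ ∀ a b, |deriv W a - deriv W b| ≤ K * |a - b| := by
  obtain ⟨K, hK, h⟩ := hW.exists_lipschitz
  refine ⟨ε⁻¹ * K, by positivity, fun a b => ?_⟩
  rw [deriv_eq_of_scaled hε W a, deriv_eq_of_scaled hε W b, ← mul_sub, abs_mul,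
    abs_of_pos (inv_pos.2 hε), mul_assoc]
  exact mul_le_mul_of_nonneg_left (h a b) (by positivity)

theorem exists_bound_of_scaled {ε : ℝ} (hε : 0 < ε) {W : ℝ → ℝ}
    (hW : PeriodicPotential fun a => ε * W a) : ∃ C, 0 ≤ C ∧ ∀ a, |deriv W a| ≤ C := by
  obtain ⟨C, hC, h⟩ := hW.exists_bound
  refine ⟨ε⁻¹ * C, by positivity, fun a => ?_⟩
  rw [deriv_eq_of_scaled hε W a, abs_mul, abs_of_pos (inv_pos.2 hε)]
  exact mul_le_mul_of_nonneg_left (h a) (by positivity)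

theorem AdmissibleStress.exists_bound {σ : ℝ → ℝ} (hσ : AdmissibleStress σ) :
    ∃ C, 0 ≤ C ∧ (∀ x, |σ x| ≤ C) ∧ ∀ x y, |σ x - σ y| ≤ C * |x - y| := by
  obtain ⟨h1, -, C, hC, h⟩ := hσ
  refine ⟨C, hC.le, fun x => ?_, fun x y => ?_⟩
  · linarith [h x, abs_nonneg (deriv σ x), abs_nonneg (deriv (deriv σ) x)]
  · refine Convex.norm_image_sub_le_of_norm_deriv_le (s := univ) (fun x _ => h1 x)
      (fun x _ => ?_) convex_univ (mem_univ y) (mem_univ x)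
    rw [Real.norm_eq_abs]
    linarith [h x, abs_nonneg (σ x), abs_nonneg (deriv (deriv σ) x)]

/-! ### Lattice solutions are classical -/

section LatticeSolution

variable {ε ε₂ : ℝ} {σ Weps : ℝ → ℝ} {u₀ : Plane → ℝ} {u : ℤ → ℕ → ℝ → ℝ}

theorem IsLatticeSolution.continuousOn (hu : IsLatticeSolution ε ε₂ σ Weps u₀ u) (i : ℤ) (j : ℕ) :
    ContinuousOn (u i j) (Ici 0) :=
  continuousOn_iff_lower_upperSemicontinuousOn.2 ⟨hu.super.lsc i j, hu.sub.usc i j⟩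

theorem IsLatticeSolution.initial_eq (hu : IsLatticeSolution ε ε₂ σ Weps u₀ u) (i : ℤ) :
    u i 0 0 = u₀ (latticePoint ε i 0) :=
  le_antisymm (hu.sub.initial i) (hu.super.initial i)

/-- The equation is imposed for positive times only and extends to `t = 0` by continuity; comparison
is run on the closed time interval. -/
theorem IsLatticeSolution.discreteLaplacian_eq_zero (hu : IsLatticeSolution ε ε₂ σ Weps u₀ u)
    (i : ℤ) (j : ℕ) {t : ℝ} (ht : 0 ≤ t) : discreteLaplacian ε u i j t = 0 := by
  have hpos : ∀ s > 0, discreteLaplacian ε u i j s = 0 := fun s hs =>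
    le_antisymm (hu.super.interior i j s hs) (hu.sub.interior i j s hs)
  rcases ht.eq_or_lt with rfl | ht
  · have hc : ContinuousOn (discreteLaplacian ε u i j) (Ici 0) := by
      have := hu.continuousOn
      unfold discreteLaplacian
      fun_prop
    have h1 : Tendsto (discreteLaplacian ε u i j) (𝓝[>] 0) (𝓝 (discreteLaplacian ε u i j 0)) :=
      (hc 0 self_mem_Ici).mono_left (nhdsWithin_mono _ Ioi_subset_Ici_self)
    refine tendsto_nhds_unique h1 (tendsto_const_nhds.congr' ?_)
    filter_upwards [self_mem_nhdsWithin] with s hs using (hpos s hs).symm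
  · exact hpos t ht

theorem IsLatticeSolution.hasDerivAt (hu : IsLatticeSolution ε ε₂ σ Weps u₀ u)
    (hW : Continuous (deriv Weps)) (i : ℤ) {t : ℝ} (ht : 0 < t) :
    HasDerivAt (u i 0) (boundaryForce ε ε₂ σ Weps u i t) t := by
  have hc : ∀ i j, ContinuousOn (u i j) (Ioi 0) := fun i j =>
    (hu.continuousOn i j).mono Ioi_subset_Ici_self
  refine hasDerivAt_of_viscosity_solution (F := boundaryForce ε ε₂ σ Weps u i) (hc i 0) ?_
    (fun s hs φ hφ => hu.sub.boundary i s hs φ hφ)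
    (fun s hs φ hφ => hu.super.boundary i s hs φ hφ) ht
  have h2 : ContinuousOn (fun s => deriv Weps (u i 0 s)) (Ioi 0) := hW.comp_continuousOn (hc i 0)
  unfold boundaryForce boundaryOperator
  fun_prop

end LatticeSolution

/-! ### Discrete harmonic extension -/

/-- Jacobi iterates, started from the constant `M` above the boundary, for the discrete Dirichlet
problem with boundary values `b`. -/
noncomputable def jacobiIterate (b : ℤ → ℝ) (M : ℝ) : ℕ → ℤ → ℕ → ℝ
  | _, i, 0 => b i
  | 0, _, _ + 1 => M
  | n + 1, i, j + 1 => (jacobiIterate b M n (i + 1) (j + 1) + jacobiIterate b M n (i - 1) (j + 1) +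
      jacobiIterate b M n i (j + 2) + jacobiIterate b M n i j) / 4

theorem jacobiIterate_boundary (b : ℤ → ℝ) (M : ℝ) (n : ℕ) (i : ℤ) :
    jacobiIterate b M n i 0 = b i := by
  cases n <;> simp [jacobiIterate]

theorem jacobiIterate_succ (b : ℤ → ℝ) (M : ℝ) (n : ℕ) (i : ℤ) (j : ℕ) :
    jacobiIterate b M (n + 1) i (j + 1) = (jacobiIterate b M n (i + 1) (j + 1) +
      jacobiIterate b M n (i - 1) (j + 1) + jacobiIterate b M n i (j + 2) +
      jacobiIterate b M n i j) / 4 := by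
  rw [jacobiIterate]

theorem abs_jacobiIterate_le {b : ℤ → ℝ} {M : ℝ} (hb : ∀ i, |b i| ≤ M) (n : ℕ) :
    ∀ i j, |jacobiIterate b M n i j| ≤ M := by
  have hM : 0 ≤ M := (abs_nonneg _).trans (hb 0)
  induction n with
  | zero =>
    intro i j
    cases j with
    | zero => rw [jacobiIterate_boundary]; exact hb i
    | succ j => simp [jacobiIterate, abs_of_nonneg hM]
  | succ n ih =>
    intro i j
    cases j with
    | zero => rw [jacobiIterate_boundary]; exact hb i
    | succ j =>
      have h1 := abs_le.1 (ih (i + 1) (j + 1))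
      have h2 := abs_le.1 (ih (i - 1) (j + 1))
      have h3 := abs_le.1 (ih i (j + 2))
      have h4 := abs_le.1 (ih i j)
      rw [jacobiIterate, abs_le]
      constructor <;> linarith

theorem jacobiIterate_succ_le {b : ℤ → ℝ} {M : ℝ} (hb : ∀ i, |b i| ≤ M) (n : ℕ) :
    ∀ i j, jacobiIterate b M (n + 1) i j ≤ jacobiIterate b M n i j := by
  induction n with
  | zero =>
    intro i j
    cases j with
    | zero => simp [jacobiIterate_boundary]
    | succ j =>
      simpa [jacobiIterate] using (abs_le.1 (abs_jacobiIterate_le hb 1 i (j + 1))).2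
  | succ n ih =>
    intro i j
    cases j with
    | zero => simp [jacobiIterate_boundary]
    | succ j =>
      linarith [jacobiIterate_succ b M (n + 1) i j, jacobiIterate_succ b M n i j,
        ih (i + 1) (j + 1), ih (i - 1) (j + 1), ih i (j + 2), ih i j]

/-- The Jacobi iterates start from a supersolution, hence decrease, and they stay above `-M`. The
mean-value relation passes to their pointwise limit. -/
theorem exists_discrete_harmonic_extension {b : ℤ → ℝ} {M : ℝ} (hb : ∀ i, |b i| ≤ M) :
    ∃ w : ℤ → ℕ → ℝ, (∀ i, w i 0 = b i) ∧ (∀ i j, |w i j| ≤ M) ∧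
      ∀ i j, w (i + 1) (j + 1) + w (i - 1) (j + 1) + w i (j + 2) + w i j = 4 * w i (j + 1) := by
  have hlim : ∀ i j, Tendsto (fun n => jacobiIterate b M n i j) atTop
      (𝓝 (⨅ n, jacobiIterate b M n i j)) := by
    intro i j
    refine tendsto_atTop_ciInf (antitone_nat_of_succ_le fun n => jacobiIterate_succ_le hb n i j) ?_
    refine ⟨-M, ?_⟩
    rintro _ ⟨n, rfl⟩
    exact (abs_le.1 (abs_jacobiIterate_le hb n i j)).1
  refine ⟨fun i j => ⨅ n, jacobiIterate b M n i j, fun i => ?_, fun i j => ?_, fun i j => ?_⟩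
  · simp [jacobiIterate_boundary]
  · exact le_of_tendsto' (hlim i j).abs fun n => abs_jacobiIterate_le hb n i j
  · have h1 := ((((hlim (i + 1) (j + 1)).add (hlim (i - 1) (j + 1))).add (hlim i (j + 2))).add
      (hlim i j)).div_const 4
    have h2 := (hlim i (j + 1)).comp (tendsto_add_atTop_nat 1)
    have := tendsto_nhds_unique h1 (h2.congr fun n => by simp [jacobiIterate])
    linarith

/-! ### Globally Lipschitz evolution equations -/

/-- The estimate behind every fixed point below: in the norm weighted by `exp (-(l * t))`, time
integration gains a factor `1 / l`, so a large rate makes Picard's map a contraction globally in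
time. -/
theorem exp_neg_mul_integral_le {E : Type*} [NormedAddCommGroup E] [NormedSpace ℝ E] {f : ℝ → E}
    {A B l t : ℝ} (hA : 0 ≤ A) (hB : 0 ≤ B) (hl : 1 ≤ l) (ht : 0 ≤ t)
    (hf : ∀ s ∈ Icc 0 t, ‖f s‖ ≤ A + B * Real.exp (l * s)) :
    Real.exp (-(l * t)) * ‖∫ s in (0 : ℝ)..t, f s‖ ≤ A + B / l := by
  have hl0 : 0 < l := by linarith
  have hd : ∀ s : ℝ, HasDerivAt (fun s => A * s + B / l * Real.exp (l * s))
      (A + B * Real.exp (l * s)) s := by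
    intro s
    have h1 := ((hasDerivAt_id s).const_mul A).add
      ((((hasDerivAt_id s).const_mul l).exp).const_mul (B / l))
    have h2 : A + B * Real.exp (l * s) = A * 1 + B / l * (Real.exp (l * s) * (l * 1)) := by
      field_simp
    rw [h2]
    exact h1
  have hc : Continuous fun s => A + B * Real.exp (l * s) := by fun_prop
  have h1 : ‖∫ s in (0 : ℝ)..t, f s‖ ≤ ∫ s in (0 : ℝ)..t, (A + B * Real.exp (l * s)) := by
    refine intervalIntegral.norm_integral_le_of_norm_le ht ?_ (hc.intervalIntegrable _ _)
    exact Eventually.of_forall fun s hs => hf s ⟨hs.1.le, hs.2⟩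
  rw [intervalIntegral.integral_eq_sub_of_hasDerivAt (fun s _ => hd s)
    (hc.intervalIntegrable _ _)] at h1
  have he : 0 < Real.exp (-(l * t)) := Real.exp_pos _
  have h2 : Real.exp (-(l * t)) * Real.exp (l * t) = 1 := by rw [← Real.exp_add]; simp
  have h3 : Real.exp (-(l * t)) * t ≤ 1 := by
    have h4 : t ≤ Real.exp (l * t) := by
      have := Real.add_one_le_exp (l * t)
      nlinarith
    calc Real.exp (-(l * t)) * t ≤ Real.exp (-(l * t)) * Real.exp (l * t) :=
          mul_le_mul_of_nonneg_left h4 he.le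
      _ = 1 := h2
  have hBl : 0 ≤ B / l := by positivity
  calc Real.exp (-(l * t)) * ‖∫ s in (0 : ℝ)..t, f s‖
      ≤ Real.exp (-(l * t)) * (A * t + B / l * Real.exp (l * t) -
          (A * 0 + B / l * Real.exp (l * 0))) := mul_le_mul_of_nonneg_left h1 he.le
    _ = A * (Real.exp (-(l * t)) * t) + B / l * (Real.exp (-(l * t)) * Real.exp (l * t)) -
          B / l * Real.exp (-(l * t)) := by simp; ring
    _ ≤ A * 1 + B / l * 1 - 0 := by
        rw [h2]
        gcongr
        positivity
    _ = _ := by ring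

/-- The fixed point is sought for `c t = exp (-(l * t)) • y t`, which is bounded because the
solution grows at most exponentially. With `l = 2 * K + 1` the contraction constant is at most `1 /
2`. -/
theorem exists_global_solution_of_lipschitz {E : Type*} [NormedAddCommGroup E] [NormedSpace ℝ E]
    [CompleteSpace E] {F : E → E} {K : ℝ} (hK : 0 ≤ K) (hF : ∀ x y, ‖F x - F y‖ ≤ K * ‖x - y‖)
    (y₀ : E) : ∃ y : ℝ → E, Continuous y ∧ y 0 = y₀ ∧ ∀ t > 0, HasDerivAt y (F (y t)) t := by
  have hFc : Continuous F := by
    refine (LipschitzWith.of_dist_le_mul (K := K.toNNReal) fun x y => ?_).continuous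
    rw [dist_eq_norm, dist_eq_norm, Real.coe_toNNReal K hK]
    exact hF x y
  set l : ℝ := 2 * K + 1 with hl
  have hl1 : 1 ≤ l := by linarith
  have hKl : K / l ≤ 1 / 2 := by
    rw [div_le_div_iff₀ (by linarith) two_pos]; linarith
  have hexp : ∀ s : ℝ, ‖Real.exp (l * s)‖ = Real.exp (l * s) := fun s => Real.norm_of_nonneg
    (Real.exp_pos _).le
  set f : BoundedContinuousFunction ℝ E → ℝ → E := fun c s => F (Real.exp (l * s) • c s) with hf
  have hfc : ∀ c, Continuous (f c) := fun c => hFc.comp (by fun_prop)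
  -- Replacing `t` by `max t 0` keeps the map inside bounded continuous functions on the whole line.
  set Φ : BoundedContinuousFunction ℝ E → ℝ → E := fun c t =>
    Real.exp (-(l * max t 0)) • (y₀ + ∫ s in (0 : ℝ)..(max t 0), f c s) with hΦ
  have hΦc : ∀ c, Continuous (Φ c) := by
    intro c
    have h1 : Continuous fun t => ∫ s in (0 : ℝ)..t, f c s :=
      intervalIntegral.continuous_primitive (fun a b => (hfc c).intervalIntegrable a b) 0
    have h2 : Continuous fun t : ℝ => ∫ s in (0 : ℝ)..(max t 0), f c s :=
      h1.comp (continuous_id.max continuous_const)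
    simp only [hΦ]
    fun_prop
  have hΦb : ∀ c t, ‖Φ c t‖ ≤ ‖y₀‖ + (‖F 0‖ + K * ‖c‖ / l) := by
    intro c t
    have ht : 0 ≤ max t 0 := le_max_right t 0
    have h1 := exp_neg_mul_integral_le (f := f c) (A := ‖F 0‖) (B := K * ‖c‖) (norm_nonneg _)
      (by positivity) hl1 ht (by
        intro s _
        calc ‖f c s‖ ≤ ‖F 0‖ + ‖F (Real.exp (l * s) • c s) - F 0‖ := norm_le_norm_add_norm_sub' _ _
          _ ≤ ‖F 0‖ + K * ‖Real.exp (l * s) • c s - 0‖ := by gcongr; exact hF _ _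
          _ = ‖F 0‖ + K * (Real.exp (l * s) * ‖c s‖) := by rw [sub_zero, norm_smul, hexp]
          _ ≤ ‖F 0‖ + K * (Real.exp (l * s) * ‖c‖) := by gcongr; exact c.norm_coe_le_norm s
          _ = _ := by ring)
    have he : Real.exp (-(l * max t 0)) ≤ 1 := Real.exp_le_one_iff.2 (by nlinarith)
    calc ‖Φ c t‖ = Real.exp (-(l * max t 0)) * ‖y₀ + ∫ s in (0 : ℝ)..(max t 0), f c s‖ := by
          simp only [hΦ]; rw [norm_smul, Real.norm_of_nonneg (Real.exp_pos _).le]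
      _ ≤ Real.exp (-(l * max t 0)) * (‖y₀‖ + ‖∫ s in (0 : ℝ)..(max t 0), f c s‖) := by
          gcongr; exact norm_add_le _ _
      _ ≤ 1 * ‖y₀‖ + (‖F 0‖ + K * ‖c‖ / l) := by
          rw [mul_add]; gcongr
      _ = _ := by ring
  set Ψ : BoundedContinuousFunction ℝ E → BoundedContinuousFunction ℝ E := fun c =>
    BoundedContinuousFunction.ofNormedAddCommGroup (Φ c) (hΦc c) _ (hΦb c) with hΨ
  have hcontr : ContractingWith (1 / 2) Ψ := by
    refine ⟨by norm_num, LipschitzWith.of_dist_le_mul fun c c' => ?_⟩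
    refine (BoundedContinuousFunction.dist_le (by positivity)).2 fun t => ?_
    have ht : 0 ≤ max t 0 := le_max_right t 0
    have h1 := exp_neg_mul_integral_le (f := fun s => f c s - f c' s) (A := 0)
      (B := K * dist c c') le_rfl (by positivity) hl1 ht (by
        intro s _
        calc ‖f c s - f c' s‖ ≤ K * ‖Real.exp (l * s) • c s - Real.exp (l * s) • c' s‖ := hF _ _
          _ = K * (Real.exp (l * s) * dist (c s) (c' s)) := by
              rw [← smul_sub, norm_smul, hexp, dist_eq_norm]
          _ ≤ K * (Real.exp (l * s) * dist c c') := by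
              gcongr; exact BoundedContinuousFunction.dist_coe_le_dist s
          _ = _ := by ring)
    calc dist (Ψ c t) (Ψ c' t) = ‖Φ c t - Φ c' t‖ := dist_eq_norm _ _
      _ = Real.exp (-(l * max t 0)) * ‖∫ s in (0 : ℝ)..(max t 0), (f c s - f c' s)‖ := by
          rw [intervalIntegral.integral_sub ((hfc c).intervalIntegrable _ _)
            ((hfc c').intervalIntegrable _ _)]
          simp only [hΦ]
          rw [← smul_sub, norm_smul, Real.norm_of_nonneg (Real.exp_pos _).le,
            add_sub_add_left_eq_sub]
      _ ≤ 0 + K * dist c c' / l := h1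
      _ = K / l * dist c c' := by ring
      _ ≤ 1 / 2 * dist c c' := by gcongr
      _ = _ := by simp
  obtain ⟨c, hc⟩ : ∃ c, Ψ c = c := ⟨hcontr.fixedPoint, hcontr.fixedPoint_isFixedPt⟩
  have hct : ∀ t, c t = Φ c t := fun t => by
    conv_lhs => rw [← hc]
    rfl
  set y : ℝ → E := fun t => Real.exp (l * t) • c t with hy
  have hmild : ∀ t, 0 ≤ t → y t = y₀ + ∫ s in (0 : ℝ)..t, F (y s) := by
    intro t ht
    simp only [hy]
    rw [hct t]
    simp only [hΦ, max_eq_left ht]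
    rw [smul_smul, ← Real.exp_add, add_neg_cancel, Real.exp_zero, one_smul]
  have hyc : Continuous y := by simp only [hy]; fun_prop
  refine ⟨y, hyc, by simpa using hmild 0 le_rfl, fun t ht => ?_⟩
  have h1 : HasDerivAt (fun t => y₀ + ∫ s in (0 : ℝ)..t, F (y s)) (F (y t)) t :=
    (((hFc.comp hyc).integral_hasStrictDerivAt 0 t).hasDerivAt).const_add y₀
  refine h1.congr_of_eventuallyEq ?_
  filter_upwards [lt_mem_nhds ht] with s hs using hmild s hs.le

/-! ### Well-posedness of the lattice system -/

/-- Solutions are classical, so their difference is discrete harmonic inside and, where it is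
positive, satisfies the linearized boundary inequality with the Lipschitz constant of the
potential's derivative. -/
theorem IsLatticeSolution.le {ε ε₂ : ℝ} (hε : 0 < ε) {σ Weps : ℝ → ℝ} {u₀ : Plane → ℝ}
    (hW : PeriodicPotential fun a => ε * Weps a) {u v : ℤ → ℕ → ℝ → ℝ}
    (hu : IsLatticeSolution ε ε₂ σ Weps u₀ u) (hv : IsLatticeSolution ε ε₂ σ Weps u₀ v)
    (i : ℤ) (j : ℕ) {t : ℝ} (ht : 0 ≤ t) : u i j t ≤ v i j t := by
  obtain ⟨K, hK, hKl⟩ := exists_lipschitz_of_scaled hε hW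
  have hWc := continuous_deriv_of_scaled hε hW
  obtain ⟨C, hC⟩ := hu.bounded t
  obtain ⟨C', hC'⟩ := hv.bounded t
  have hsub : Icc 0 t ⊆ Ici 0 := fun s hs => hs.1
  have := lattice_comparison (ε := ε) (T := t) (K := K) (M := C + C') hε hK
    (e := fun i j s => u i j s - v i j s)
    (fun i j => ((hu.continuousOn i j).sub (hv.continuousOn i j)).mono hsub)
    (fun i j s hs => by
      linarith [(abs_le.1 (hC i j s hs)).2, (abs_le.1 (hC' i j s hs)).1])
    (fun i j s hs => by
      have h1 := hu.discreteLaplacian_eq_zero i j hs.1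
      have h2 := hv.discreteLaplacian_eq_zero i j hs.1
      have h3 : discreteLaplacian ε (fun i j s => u i j s - v i j s) i j s =
          discreteLaplacian ε u i j s - discreteLaplacian ε v i j s := by
        unfold discreteLaplacian; ring
      rw [h3, h1, h2, sub_zero])
    (fun i s hs hpos => by
      refine ⟨_, (hu.hasDerivAt hWc i hs.1).sub (hv.hasDerivAt hWc i hs.1), ?_⟩
      have h1 := hKl (u i 0 s) (v i 0 s)
      rw [abs_of_pos hpos] at h1
      have h2 := (abs_le.1 h1).1
      have h3 : boundaryForce ε ε₂ σ Weps u i s - boundaryForce ε ε₂ σ Weps v i s =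
          boundaryOperator ε (fun i j s => u i j s - v i j s) i s -
            (deriv Weps (u i 0 s) - deriv Weps (v i 0 s)) := by
        unfold boundaryForce boundaryOperator; ring
      rw [h3]
      linarith)
    (fun i => by simp [hu.initial_eq, hv.initial_eq])
    (i := i) (j := j) (t := t) ⟨ht, le_rfl⟩
  linarith

theorem exists_isLatticeSolution {ε ε₂ : ℝ} (hε : 0 < ε) {σ Weps : ℝ → ℝ} {u₀ : Plane → ℝ}
    (hσ : ∃ C, ∀ x, |σ x| ≤ C) (hW : PeriodicPotential fun a => ε * Weps a)
    (hu₀ : ∃ C, ∀ i, |u₀ (latticePoint ε i 0)| ≤ C) :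
    ∃ u, IsLatticeSolution ε ε₂ σ Weps u₀ u := by
  obtain ⟨Cσ, hCσ⟩ := hσ
  obtain ⟨C₀, hC₀⟩ := hu₀
  obtain ⟨K, hK, hKl⟩ := exists_lipschitz_of_scaled hε hW
  obtain ⟨CW, hCW, hCWb⟩ := exists_bound_of_scaled hε hW
  have hext : ∀ b : BoundedContinuousFunction ℤ ℝ, ∃ w : ℤ → ℕ → ℝ, (∀ i, w i 0 = b i) ∧
      (∀ i j, |w i j| ≤ ‖b‖) ∧ ∀ i j,
        w (i + 1) (j + 1) + w (i - 1) (j + 1) + w i (j + 2) + w i j = 4 * w i (j + 1) :=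
    fun b => exists_discrete_harmonic_extension fun i => b.norm_coe_le_norm i
  choose H hH0 hHb hH using hext
  -- The extensions were merely chosen, but boundedness and the maximum principle make them depend
  -- on the boundary values in a nonexpansive way.
  have hHle : ∀ b b' i j, H b i j - H b' i j ≤ ‖b - b'‖ := by
    intro b b' i j
    refine discrete_maximum_principle (w := fun i j => H b i j - H b' i j) (M := ‖b‖ + ‖b'‖)
      (fun i j => ?_) (fun i j => ?_) (fun i => ?_) i j
    · linarith [(abs_le.1 (hHb b i j)).2, (abs_le.1 (hHb b' i j)).1]
    · linarith [hH b i j, hH b' i j]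
    · rw [hH0, hH0]
      exact (le_abs_self _).trans ((b - b').norm_coe_le_norm i)
  have hHabs : ∀ b b' i j, |H b i j - H b' i j| ≤ ‖b - b'‖ := by
    intro b b' i j
    rw [abs_le]
    have h1 := hHle b b' i j
    have h2 := hHle b' b i j
    rw [norm_sub_rev] at h2
    constructor <;> linarith
  -- The boundary equation with the interior unknowns eliminated. It defines a Lipschitz vector
  -- field on bounded sequences; the `6` in its bounds is three differences of at most twice the
  -- norm each.
  set g : BoundedContinuousFunction ℤ ℝ → ℤ → ℝ := fun b i =>
    2 * ε₂ * σ (ε₂ * (ε * i)) - deriv Weps (b i) +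
      1 / ε * ((b (i + 1) - b i) + (b (i - 1) - b i) + (H b i 1 - b i)) with hg
  have habs : ∀ (x y : ℝ), |x| ≤ y → x ≤ y ∧ -y ≤ x := fun x y h =>
    ⟨(abs_le.1 h).2, (abs_le.1 h).1⟩
  have hgb : ∀ b i, ‖g b i‖ ≤ |2 * ε₂| * Cσ + CW + 1 / ε * (6 * ‖b‖) := by
    intro b i
    have h1 : |2 * ε₂ * σ (ε₂ * (ε * i))| ≤ |2 * ε₂| * Cσ := by
      rw [abs_mul]; gcongr; exact hCσ _
    have h2 := habs _ _ (hHb b i 1)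
    have h3 := habs _ _ (b.norm_coe_le_norm i)
    have h4 := habs _ _ (b.norm_coe_le_norm (i + 1))
    have h5 := habs _ _ (b.norm_coe_le_norm (i - 1))
    have h6 : |1 / ε * ((b (i + 1) - b i) + (b (i - 1) - b i) + (H b i 1 - b i))| ≤
        1 / ε * (6 * ‖b‖) := by
      rw [abs_mul, abs_of_pos (by positivity : 0 < 1 / ε)]
      gcongr
      rw [abs_le]
      constructor <;> linarith
    calc ‖g b i‖ ≤ |2 * ε₂ * σ (ε₂ * (ε * i)) - deriv Weps (b i)| + _ := abs_add_le _ _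
      _ ≤ |2 * ε₂ * σ (ε₂ * (ε * i))| + |deriv Weps (b i)| + _ := by gcongr; exact abs_sub _ _
      _ ≤ _ := by gcongr; exact hCWb _
  set F : BoundedContinuousFunction ℤ ℝ → BoundedContinuousFunction ℤ ℝ := fun b =>
    BoundedContinuousFunction.ofNormedAddCommGroup (g b) continuous_of_discreteTopology _ (hgb b)
    with hFdef
  have hF : ∀ b b', ‖F b - F b'‖ ≤ (K + 6 / ε) * ‖b - b'‖ := by
    intro b b'
    refine (BoundedContinuousFunction.norm_le (by positivity)).2 fun i => ?_
    have h1 := hKl (b i) (b' i)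
    have h2 := habs _ _ (hHabs b b' i 1)
    have h3 := habs _ _ ((b - b').norm_coe_le_norm i)
    have h4 := habs _ _ ((b - b').norm_coe_le_norm (i + 1))
    have h5 := habs _ _ ((b - b').norm_coe_le_norm (i - 1))
    have h1' : |deriv Weps (b i) - deriv Weps (b' i)| ≤ K * ‖b - b'‖ :=
      h1.trans (mul_le_mul_of_nonneg_left ((b - b').norm_coe_le_norm i) hK)
    simp only [BoundedContinuousFunction.coe_sub, Pi.sub_apply] at h3 h4 h5
    have h6 : |1 / ε * ((b (i + 1) - b' (i + 1) - (b i - b' i)) +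
        (b (i - 1) - b' (i - 1) - (b i - b' i)) + (H b i 1 - H b' i 1 - (b i - b' i)))| ≤
        1 / ε * (6 * ‖b - b'‖) := by
      rw [abs_mul, abs_of_pos (by positivity : 0 < 1 / ε)]
      gcongr
      rw [abs_le]
      constructor <;> linarith
    calc ‖(F b - F b') i‖ = |-(deriv Weps (b i) - deriv Weps (b' i)) +
          1 / ε * ((b (i + 1) - b' (i + 1) - (b i - b' i)) +
          (b (i - 1) - b' (i - 1) - (b i - b' i)) + (H b i 1 - H b' i 1 - (b i - b' i)))| := by
          rw [BoundedContinuousFunction.coe_sub, Pi.sub_apply, Real.norm_eq_abs]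
          congr 1
          change g b i - g b' i = _
          simp only [hg]
          ring
      _ ≤ |-(deriv Weps (b i) - deriv Weps (b' i))| + _ := abs_add_le _ _
      _ ≤ K * ‖b - b'‖ + 1 / ε * (6 * ‖b - b'‖) := by
          rw [abs_neg]; gcongr
      _ = _ := by ring
  obtain ⟨y, hyc, hy0, hyd⟩ := exists_global_solution_of_lipschitz (by positivity) hF
    (BoundedContinuousFunction.ofNormedAddCommGroup (fun i : ℤ => u₀ (latticePoint ε i 0))
      continuous_of_discreteTopology C₀ hC₀)
  set u : ℤ → ℕ → ℝ → ℝ := fun i j t => H (y t) i j with hu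
  have hucont : ∀ i j, Continuous (u i j) := by
    intro i j
    have h1 : Continuous fun b => H b i j := by
      refine (LipschitzWith.of_dist_le_mul (K := 1) fun b b' => ?_).continuous
      rw [Real.dist_eq, dist_eq_norm]
      simpa using hHabs b b' i j
    exact h1.comp hyc
  have hub : ∀ i t, u i 0 t = y t i := fun i t => hH0 _ i
  have huder : ∀ i, ∀ t > 0, HasDerivAt (u i 0) (boundaryForce ε ε₂ σ Weps u i t) t := by
    intro i t ht
    have h1 := (BoundedContinuousFunction.evalCLM ℝ i).hasFDerivAt.comp_hasDerivAt t (hyd t ht)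
    have h2 : (BoundedContinuousFunction.evalCLM ℝ i) (F (y t)) =
        boundaryForce ε ε₂ σ Weps u i t := by
      change g (y t) i = _
      simp only [hg, boundaryForce, boundaryOperator, hub]
      simp only [hu]
    rw [← h2]
    refine h1.congr_of_eventuallyEq (Eventually.of_forall fun s => hub i s)
  have hlap : ∀ i j t, discreteLaplacian ε u i j t = 0 := by
    intro i j t
    have := hH (y t) i j
    have h0 : (H (y t) (i + 1) (j + 1) - H (y t) i (j + 1)) +
        (H (y t) (i - 1) (j + 1) - H (y t) i (j + 1)) + (H (y t) i (j + 2) - H (y t) i (j + 1)) +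
        (H (y t) i j - H (y t) i (j + 1)) = 0 := by linarith
    simp only [discreteLaplacian, hu]
    rw [h0, mul_zero]
  have hstart : ∀ i, u i 0 0 = u₀ (latticePoint ε i 0) := by
    intro i
    rw [hub, hy0]
    rfl
  -- At a local extremum of `u - φ` the two derivatives agree, so both viscosity inequalities hold
  -- with equality.
  have htest : ∀ i, ∀ t > 0, ∀ φ : ℝ → ℝ, ContDiff ℝ 1 φ →
      IsLocalExtr (fun s => u i 0 s - φ s) t → deriv φ t = boundaryForce ε ε₂ σ Weps u i t := by
    intro i t ht φ hφ hloc
    have h1 := (huder i t ht).sub (hφ.differentiable one_ne_zero t).hasDerivAt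
    have h2 := hloc.hasDerivAt_eq_zero h1
    linarith
  refine ⟨u, ⟨fun i j => (hucont i j).upperSemicontinuous.upperSemicontinuousOn _,
    fun i j t _ => (hlap i j t).ge, fun i t ht φ hφ hloc => (htest i t ht φ hφ hloc.isExtr).le,
    fun i => (hstart i).le⟩, ⟨fun i j => (hucont i j).lowerSemicontinuous.lowerSemicontinuousOn _,
    fun i j t _ => (hlap i j t).le, fun i t ht φ hφ hloc => (htest i t ht φ hφ hloc.isExtr).ge,
    fun i => (hstart i).ge⟩, fun T => ?_⟩
  obtain ⟨C, hC⟩ := isCompact_Icc.exists_bound_of_continuousOn (hyc.continuousOn (s := Icc 0 T))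
  exact ⟨C, fun i j t ht => (hHb (y t) i j).trans (hC t ht)⟩

/-! ### Poisson averages -/

/-- The density of the standard Cauchy distribution, i.e. the Poisson kernel at height one. -/
noncomputable def cauchyDensity (z : ℝ) : ℝ := Real.pi⁻¹ * (1 + z ^ 2)⁻¹

theorem cauchyDensity_nonneg (z : ℝ) : 0 ≤ cauchyDensity z := by
  unfold cauchyDensity; positivity

theorem continuous_cauchyDensity : Continuous cauchyDensity := by
  unfold cauchyDensity
  exact continuous_const.mul (Continuous.inv₀ (by fun_prop) fun z => by positivity)

theorem integrable_cauchyDensity : Integrable cauchyDensity :=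
  integrable_inv_one_add_sq.const_mul _

theorem integral_cauchyDensity : ∫ z, cauchyDensity z = 1 := by
  unfold cauchyDensity
  rw [integral_const_mul, integral_univ_inv_one_add_sq, inv_mul_cancel₀ Real.pi_ne_zero]

/-- The Poisson integral of `h` at the point `(x, τ)`. -/
noncomputable def poissonAvg (τ : ℝ) (h : ℝ → ℝ) (x : ℝ) : ℝ :=
  ∫ z, cauchyDensity z * h (x + τ * z)

/-- The derivative of the Poisson integral of `h` in the direction normal to the boundary. -/
noncomputable def poissonDeriv (τ : ℝ) (h : ℝ → ℝ) (x : ℝ) : ℝ :=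
  τ⁻¹ * ∫ z, cauchyDensity z * ((z ^ 2 - 1) / (z ^ 2 + 1) * h (x + τ * z))

theorem integrable_cauchyDensity_mul {f : ℝ → ℝ} {M : ℝ} (hf : Continuous f)
    (hM : ∀ z, |f z| ≤ M) : Integrable fun z => cauchyDensity z * f z :=
  integrable_cauchyDensity.mul_bdd (c := M) hf.aestronglyMeasurable (Eventually.of_forall hM)

theorem poissonAvg_zero (h : ℝ → ℝ) (x : ℝ) : poissonAvg 0 h x = h x := by
  unfold poissonAvg
  simp [integral_mul_const, integral_cauchyDensity]

/-- Averages of functions that differ little along the respective lines differ little. -/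
theorem abs_poissonAvg_sub_le {h h' : ℝ → ℝ} {τ τ' x x' M M' : ℝ} {D : ℝ → ℝ}
    (hc : Continuous h) (hc' : Continuous h') (hM : ∀ w, |h w| ≤ M) (hM' : ∀ w, |h' w| ≤ M')
    (hDi : Integrable fun z => cauchyDensity z * D z)
    (hD : ∀ z, |h (x + τ * z) - h' (x' + τ' * z)| ≤ D z) :
    |poissonAvg τ h x - poissonAvg τ' h' x'| ≤ ∫ z, cauchyDensity z * D z := by
  unfold poissonAvg
  rw [← integral_sub (integrable_cauchyDensity_mul (by fun_prop) fun z => hM _)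
    (integrable_cauchyDensity_mul (by fun_prop) fun z => hM' _)]
  rw [← Real.norm_eq_abs]
  refine norm_integral_le_of_norm_le hDi (Eventually.of_forall fun z => ?_)
  rw [← mul_sub, Real.norm_eq_abs, abs_mul, abs_of_nonneg (cauchyDensity_nonneg z)]
  exact mul_le_mul_of_nonneg_left (hD z) (cauchyDensity_nonneg z)

theorem abs_poissonAvg_sub_le_const {h h' : ℝ → ℝ} {τ τ' x x' M M' D : ℝ}
    (hc : Continuous h) (hc' : Continuous h') (hM : ∀ w, |h w| ≤ M) (hM' : ∀ w, |h' w| ≤ M')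
    (hD : ∀ z, |h (x + τ * z) - h' (x' + τ' * z)| ≤ D) :
    |poissonAvg τ h x - poissonAvg τ' h' x'| ≤ D := by
  have := abs_poissonAvg_sub_le hc hc' hM hM' (D := fun _ => D)
    (integrable_cauchyDensity.mul_const D) hD
  rwa [integral_mul_const, integral_cauchyDensity, one_mul] at this

theorem abs_poissonAvg_le {h : ℝ → ℝ} {M : ℝ} (hM : ∀ w, |h w| ≤ M) (τ x : ℝ) :
    |poissonAvg τ h x| ≤ M := by
  have h1 : |poissonAvg τ h x| ≤ ∫ z, cauchyDensity z * M := by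
    rw [← Real.norm_eq_abs]
    refine norm_integral_le_of_norm_le (integrable_cauchyDensity.mul_const M)
      (Eventually.of_forall fun z => ?_)
    rw [Real.norm_eq_abs, abs_mul, abs_of_nonneg (cauchyDensity_nonneg z)]
    exact mul_le_mul_of_nonneg_left (hM _) (cauchyDensity_nonneg z)
  rwa [integral_mul_const, integral_cauchyDensity, one_mul] at h1

/-- Written against the fixed Cauchy density, the Poisson integral depends on its parameters only
through the integrand. Dominated convergence therefore applies also at height zero, where it reduces
to the boundary value. -/
theorem continuous_poissonAvg {α : Type*} [TopologicalSpace α] [FirstCountableTopology α]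
    {h : α → ℝ → ℝ} {τ x : α → ℝ} {M : ℝ} (hh : Continuous fun p : α × ℝ => h p.1 p.2)
    (hM : ∀ a w, |h a w| ≤ M) (hτ : Continuous τ) (hx : Continuous x) :
    Continuous fun a => poissonAvg (τ a) (h a) (x a) := by
  have hj : ∀ z, Continuous fun a => h a (x a + τ a * z) := fun z =>
    hh.comp (continuous_id.prodMk (hx.add (hτ.mul continuous_const)))
  have hz : ∀ a, Continuous fun z => h a (x a + τ a * z) := fun a =>
    hh.comp (continuous_const.prodMk (by fun_prop))
  unfold poissonAvg
  refine MeasureTheory.continuous_of_dominated (bound := fun z => cauchyDensity z * M)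
    (fun a => (continuous_cauchyDensity.mul (hz a)).aestronglyMeasurable)
    (fun a => Eventually.of_forall fun z => ?_) (integrable_cauchyDensity.mul_const M)
    (Eventually.of_forall fun z => continuous_const.mul (hj z))
  rw [Real.norm_eq_abs, abs_mul, abs_of_nonneg (cauchyDensity_nonneg z)]
  exact mul_le_mul_of_nonneg_left (hM _ _) (cauchyDensity_nonneg z)

theorem abs_sq_sub_div_le_one (z : ℝ) : |(z ^ 2 - 1) / (z ^ 2 + 1)| ≤ 1 := by
  rw [abs_div, abs_of_pos (by positivity : 0 < z ^ 2 + 1), div_le_one (by positivity), abs_le]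
  constructor <;> nlinarith [sq_nonneg z]

theorem continuous_sq_sub_div : Continuous fun z : ℝ => (z ^ 2 - 1) / (z ^ 2 + 1) :=
  Continuous.div (by fun_prop) (by fun_prop) fun z => by positivity

theorem continuousOn_poissonDeriv {α : Type*} [TopologicalSpace α] [FirstCountableTopology α]
    {h : α → ℝ → ℝ} {τ x : α → ℝ} {M : ℝ} (hh : Continuous fun p : α × ℝ => h p.1 p.2)
    (hM : ∀ a w, |h a w| ≤ M) (hτ : Continuous τ) (hx : Continuous x) :
    ContinuousOn (fun a => poissonDeriv (τ a) (h a) (x a)) {a | τ a ≠ 0} := by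
  have hj : ∀ z, Continuous fun a => h a (x a + τ a * z) := fun z =>
    hh.comp (continuous_id.prodMk (hx.add (hτ.mul continuous_const)))
  have hz : ∀ a, Continuous fun z => h a (x a + τ a * z) := fun a =>
    hh.comp (continuous_const.prodMk (by fun_prop))
  unfold poissonDeriv
  refine ContinuousOn.mul (hτ.continuousOn.inv₀ fun a ha => ha) (Continuous.continuousOn ?_)
  refine MeasureTheory.continuous_of_dominated (bound := fun z => cauchyDensity z * M)
    (fun a => (continuous_cauchyDensity.mul
      (continuous_sq_sub_div.mul (hz a))).aestronglyMeasurable)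
    (fun a => Eventually.of_forall fun z => ?_) (integrable_cauchyDensity.mul_const M)
    (Eventually.of_forall fun z => continuous_const.mul (continuous_const.mul (hj z)))
  rw [Real.norm_eq_abs, abs_mul, abs_of_nonneg (cauchyDensity_nonneg z), abs_mul]
  refine mul_le_mul_of_nonneg_left ?_ (cauchyDensity_nonneg z)
  calc |(z ^ 2 - 1) / (z ^ 2 + 1)| * |h a (x a + τ a * z)| ≤ 1 * M :=
        mul_le_mul (abs_sq_sub_div_le_one z) (hM _ _) (abs_nonneg _) zero_le_one
    _ = M := one_mul M

/-! ### The Poisson kernel as a function of a complex variable -/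

/-- The Poisson kernel of the half-plane. -/
noncomputable def poissonKer (z : ℂ) : ℝ := -(Real.pi⁻¹ * (z⁻¹).im)

/-- The normal derivative of the Poisson kernel of the half-plane. -/
noncomputable def poissonKerDeriv (z : ℂ) : ℝ := Real.pi⁻¹ * ((z ^ 2)⁻¹).re

theorem poissonKer_eq (z : ℂ) : poissonKer z = Real.pi⁻¹ * (z.im / ‖z‖ ^ 2) := by
  unfold poissonKer
  rw [Complex.inv_im, Complex.normSq_eq_norm_sq]
  ring

theorem poissonKer_mk (a : ℝ) {τ : ℝ} (hτ : 0 < τ) :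
    poissonKer ⟨a, τ⟩ = τ⁻¹ * cauchyDensity (a / τ) := by
  rw [poissonKer_eq, ← Complex.normSq_eq_norm_sq, Complex.normSq_mk, cauchyDensity]
  field_simp
  ring

theorem poissonKerDeriv_mk (a : ℝ) {τ : ℝ} (hτ : 0 < τ) : poissonKerDeriv ⟨a, τ⟩ =
    τ⁻¹ * (τ⁻¹ * (cauchyDensity (a / τ) * (((a / τ) ^ 2 - 1) / ((a / τ) ^ 2 + 1)))) := by
  rw [poissonKerDeriv, Complex.inv_re, map_pow, Complex.normSq_mk, cauchyDensity,
    sq (Complex.mk a τ)]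
  simp only [Complex.mul_re]
  have : 0 < a ^ 2 + τ ^ 2 := by positivity
  field_simp
  ring

theorem integrable_poissonKer (x : ℝ) {τ : ℝ} (hτ : 0 < τ) :
    Integrable fun w : ℝ => poissonKer ⟨x - w, τ⟩ := by
  simp_rw [poissonKer_mk _ hτ]
  exact ((integrable_cauchyDensity.comp_div hτ.ne').comp_sub_left x).const_mul _

theorem integral_comp_add_mul (f : ℝ → ℝ) (x : ℝ) {τ : ℝ} (hτ : 0 < τ) :
    ∫ z, f (x + τ * z) = τ⁻¹ * ∫ w, f w := by
  rw [Measure.integral_comp_mul_left (fun w => f (x + w)) τ, integral_add_left_eq_self,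
    abs_of_pos (inv_pos.2 hτ), smul_eq_mul]

theorem cauchyDensity_neg (z : ℝ) : cauchyDensity (-z) = cauchyDensity z := by
  simp [cauchyDensity]

/-- Substitution `w = x + τ * z`. In this form finite differences in position and height fall on the
kernel, so that `h` needs no regularity. -/
theorem poissonAvg_eq_integral_poissonKer (h : ℝ → ℝ) (x : ℝ) {τ : ℝ} (hτ : 0 < τ) :
    poissonAvg τ h x = ∫ w, poissonKer ⟨x - w, τ⟩ * h w := by
  have h1 := integral_comp_add_mul (fun w => cauchyDensity ((w - x) / τ) * h w) x hτ
  have h2 : ∀ z, (x + τ * z - x) / τ = z := fun z => by field_simp; ring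
  simp only [h2] at h1
  unfold poissonAvg
  rw [h1, ← integral_const_mul]
  congr 1
  ext w
  rw [poissonKer_mk _ hτ, ← neg_sub w x, neg_div, cauchyDensity_neg]
  ring

theorem poissonDeriv_eq_integral_poissonKerDeriv (h : ℝ → ℝ) (x : ℝ) {τ : ℝ} (hτ : 0 < τ) :
    poissonDeriv τ h x = ∫ w, poissonKerDeriv ⟨x - w, τ⟩ * h w := by
  have h1 := integral_comp_add_mul (fun w => cauchyDensity ((w - x) / τ) *
    ((((w - x) / τ) ^ 2 - 1) / (((w - x) / τ) ^ 2 + 1) * h w)) x hτ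
  have h2 : ∀ z, (x + τ * z - x) / τ = z := fun z => by field_simp; ring
  simp only [h2] at h1
  unfold poissonDeriv
  rw [h1, ← integral_const_mul, ← integral_const_mul]
  congr 1
  ext w
  rw [poissonKerDeriv_mk _ hτ, ← neg_sub w x, neg_div, cauchyDensity_neg, neg_sq]
  ring

theorem integrable_poissonKer_mul {h : ℝ → ℝ} {M : ℝ} (hc : Continuous h) (hM : ∀ w, |h w| ≤ M)
    (x : ℝ) {τ : ℝ} (hτ : 0 < τ) : Integrable fun w : ℝ => poissonKer ⟨x - w, τ⟩ * h w :=
  (integrable_poissonKer x hτ).mul_bdd (c := M) hc.aestronglyMeasurable (Eventually.of_forall hM)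

theorem integrable_poissonKerDeriv_mul {h : ℝ → ℝ} {M : ℝ} (hc : Continuous h)
    (hM : ∀ w, |h w| ≤ M) (x : ℝ) {τ : ℝ} (hτ : 0 < τ) :
    Integrable fun w : ℝ => poissonKerDeriv ⟨x - w, τ⟩ * h w := by
  refine Integrable.mul_bdd (c := M) ?_ hc.aestronglyMeasurable (Eventually.of_forall hM)
  simp_rw [poissonKerDeriv_mk _ hτ]
  refine Integrable.const_mul (Integrable.const_mul ?_ _) _
  refine ((integrable_cauchyDensity.comp_div hτ.ne').comp_sub_left x).mul_bdd (c := 1) ?_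
    (Eventually.of_forall fun w => abs_sq_sub_div_le_one _)
  exact (continuous_sq_sub_div.comp (by fun_prop : Continuous fun w : ℝ =>
    (x - w) / τ)).aestronglyMeasurable

/-- Integrals against kernels dominated by the Poisson kernel. -/
theorem abs_integral_mul_le {κ h : ℝ → ℝ} {M C x τ : ℝ} (hτ : 0 < τ)
    (hM : ∀ w, |h w| ≤ M) (hκ : ∀ w, |κ w| ≤ C * poissonKer ⟨x - w, τ⟩) :
    |∫ w, κ w * h w| ≤ C * M := by
  have h0 : ∫ w, poissonKer ⟨x - w, τ⟩ = 1 := by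
    have := poissonAvg_eq_integral_poissonKer (fun _ => 1) x hτ
    simpa [poissonAvg, integral_cauchyDensity] using this.symm
  have h1 : |∫ w, κ w * h w| ≤ ∫ w, poissonKer ⟨x - w, τ⟩ * (C * M) := by
    rw [← Real.norm_eq_abs]
    refine norm_integral_le_of_norm_le ((integrable_poissonKer x hτ).mul_const _)
      (Eventually.of_forall fun w => ?_)
    rw [Real.norm_eq_abs, abs_mul]
    calc |κ w| * |h w| ≤ C * poissonKer ⟨x - w, τ⟩ * M :=
          mul_le_mul (hκ w) (hM w) (abs_nonneg _) ((abs_nonneg _).trans (hκ w))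
      _ = _ := by ring
  rwa [integral_mul_const, h0, one_mul] at h1

theorem abs_im_le_poissonKer {z ζ : ℂ} {C : ℝ}
    (h : ‖ζ‖ ≤ C * (z.im / ‖z‖ ^ 2)) :
    |Real.pi⁻¹ * ζ.im| ≤ C * poissonKer z := by
  have hpi : (0 : ℝ) < Real.pi⁻¹ := by positivity
  rw [poissonKer_eq, abs_mul, abs_of_pos hpi]
  calc Real.pi⁻¹ * |ζ.im| ≤ Real.pi⁻¹ * (C * (z.im / ‖z‖ ^ 2)) := by
        gcongr; exact (Complex.abs_im_le_norm ζ).trans h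
    _ = _ := by ring

/-! ### Finite differences of `1 / z`, bounded by the Poisson kernel -/

section KernelEstimates

variable {z : ℂ} {ε : ℝ}

theorem im_le_norm (z : ℂ) : z.im ≤ ‖z‖ :=
  (le_abs_self _).trans (Complex.abs_im_le_norm z)

theorem add_ne_zero_of_abs_lt {ζ : ℂ} (hz : 0 < z.im) (hζ : ‖ζ‖ ≤ z.im / 2) : z + ζ ≠ 0 := by
  intro h
  have h1 : (z + ζ).im = 0 := by rw [h]; rfl
  have h2 := (abs_le.1 ((Complex.abs_im_le_norm ζ).trans hζ)).1
  rw [Complex.add_im] at h1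
  linarith

theorem half_im_le_norm_add {ζ : ℂ} (hζ : ‖ζ‖ ≤ z.im / 2) :
    z.im / 2 ≤ ‖z + ζ‖ := by
  have h1 := im_le_norm z
  have h2 := norm_sub_norm_le z (-ζ)
  rw [norm_neg, sub_neg_eq_add] at h2
  linarith

/-- The second difference is exactly `2 * ε ^ 2 / (z * (z ^ 2 - ε ^ 2))`, and a step of at most half
the height keeps the denominator comparable to `z ^ 3`. The factor `z.im / ‖z‖ ^ 2` is split off
because it is `π` times the Poisson kernel. -/
theorem norm_second_difference_inv_le (hz : 0 < z.im) (hε : |ε| ≤ z.im / 2) :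
    ‖(z + ε)⁻¹ + (z - ε)⁻¹ - 2 * z⁻¹‖ ≤ 4 * ε ^ 2 / z.im ^ 2 * (z.im / ‖z‖ ^ 2) := by
  have hzn := im_le_norm z
  have hz0 : z ≠ 0 := by rintro rfl; simp at hz
  have hn0 : 0 < ‖z‖ := norm_pos_iff.2 hz0
  have h1 : z + ε ≠ 0 := add_ne_zero_of_abs_lt hz (by simpa using hε)
  have h2 : z - ε ≠ 0 := by
    rw [sub_eq_add_neg]; exact add_ne_zero_of_abs_lt hz (by simpa using hε)
  have heq : (z + ε)⁻¹ + (z - ε)⁻¹ - 2 * z⁻¹ = 2 * ε ^ 2 / (z * (z ^ 2 - ε ^ 2)) := by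
    have h3 : z ^ 2 - (ε : ℂ) ^ 2 = (z + ε) * (z - ε) := by ring
    rw [h3]
    field_simp
    ring
  have hsq : ε ^ 2 ≤ z.im ^ 2 / 4 := by
    have := sq_le_sq' (by linarith [abs_nonneg ε]) hε
    rw [sq_abs] at this
    linarith [this, (by ring : (z.im / 2) ^ 2 = z.im ^ 2 / 4)]
  have hzz : z.im ^ 2 ≤ ‖z‖ ^ 2 := by gcongr
  have hden : ‖z‖ ^ 2 / 2 ≤ ‖z ^ 2 - (ε : ℂ) ^ 2‖ := by
    have := norm_sub_norm_le (z ^ 2) ((ε : ℂ) ^ 2)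
    rw [norm_pow, norm_pow, Complex.norm_real, Real.norm_eq_abs, sq_abs] at this
    linarith [sq_nonneg ‖z‖]
  rw [heq, norm_div, norm_mul, norm_mul, norm_pow, Complex.norm_real, Real.norm_eq_abs, sq_abs]
  have : ‖(2 : ℂ)‖ = 2 := by simp
  rw [this]
  calc 2 * ε ^ 2 / (‖z‖ * ‖z ^ 2 - (ε : ℂ) ^ 2‖) ≤ 2 * ε ^ 2 / (z.im * (‖z‖ ^ 2 / 2)) := by
        gcongr
    _ = _ := by field_simp; ring

/-- The second-order terms along the two axes cancel by holomorphy: the sum is exactly `4 * ε ^ 4 /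
(z * (z ^ 4 - ε ^ 4))`, hence the fourth power of `ε`. -/
theorem norm_discrete_laplacian_inv_le (hz : 0 < z.im) (hε : |ε| ≤ z.im / 2) :
    ‖(z + ε)⁻¹ + (z - ε)⁻¹ + (z + ε * Complex.I)⁻¹ + (z - ε * Complex.I)⁻¹ - 4 * z⁻¹‖ ≤
      8 * ε ^ 4 / z.im ^ 4 * (z.im / ‖z‖ ^ 2) := by
  have hzn := im_le_norm z
  have hz0 : z ≠ 0 := by rintro rfl; simp at hz
  have hn0 : 0 < ‖z‖ := norm_pos_iff.2 hz0
  have h1 : z + ε ≠ 0 := add_ne_zero_of_abs_lt hz (by simpa using hε)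
  have h2 : z - ε ≠ 0 := by
    rw [sub_eq_add_neg]; exact add_ne_zero_of_abs_lt hz (by simpa using hε)
  have h1' : z + ε * Complex.I ≠ 0 := add_ne_zero_of_abs_lt hz (by simpa using hε)
  have h2' : z - ε * Complex.I ≠ 0 := by
    rw [sub_eq_add_neg]; exact add_ne_zero_of_abs_lt hz (by simpa using hε)
  have hA : (z + ε)⁻¹ + (z - ε)⁻¹ = 2 * z / (z ^ 2 - ε ^ 2) := by
    rw [show z ^ 2 - (ε : ℂ) ^ 2 = (z + ε) * (z - ε) by ring]
    field_simp
    ring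
  have hI : z ^ 2 + (ε : ℂ) ^ 2 = (z + ε * Complex.I) * (z - ε * Complex.I) := by
    ring_nf
    rw [Complex.I_sq]
    ring
  have hB : (z + ε * Complex.I)⁻¹ + (z - ε * Complex.I)⁻¹ = 2 * z / (z ^ 2 + ε ^ 2) := by
    rw [hI]
    field_simp
    ring
  have hn1 : z ^ 2 - (ε : ℂ) ^ 2 ≠ 0 := by
    rw [show z ^ 2 - (ε : ℂ) ^ 2 = (z + ε) * (z - ε) by ring]; exact mul_ne_zero h1 h2
  have hn2 : z ^ 2 + (ε : ℂ) ^ 2 ≠ 0 := by rw [hI]; exact mul_ne_zero h1' h2'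
  have heq : (z + ε)⁻¹ + (z - ε)⁻¹ + (z + ε * Complex.I)⁻¹ + (z - ε * Complex.I)⁻¹ - 4 * z⁻¹ =
      4 * ε ^ 4 / (z * (z ^ 4 - ε ^ 4)) := by
    rw [add_assoc ((z + ε)⁻¹ + (z - ε)⁻¹), hA, hB,
      show z ^ 4 - (ε : ℂ) ^ 4 = (z ^ 2 - ε ^ 2) * (z ^ 2 + ε ^ 2) by ring]
    field_simp
    ring
  have hsq : ε ^ 2 ≤ z.im ^ 2 / 4 := by
    have := sq_le_sq' (by linarith [abs_nonneg ε]) hε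
    rw [sq_abs] at this
    linarith [this, (by ring : (z.im / 2) ^ 2 = z.im ^ 2 / 4)]
  have hq : ε ^ 4 ≤ z.im ^ 4 / 2 := by
    have : (ε ^ 2) ^ 2 ≤ (z.im ^ 2 / 4) ^ 2 := by gcongr
    nlinarith [pow_pos hz 4]
  have hzz : z.im ^ 4 ≤ ‖z‖ ^ 4 := by gcongr
  have hden : ‖z‖ ^ 4 / 2 ≤ ‖z ^ 4 - (ε : ℂ) ^ 4‖ := by
    have := norm_sub_norm_le (z ^ 4) ((ε : ℂ) ^ 4)
    rw [norm_pow, norm_pow, Complex.norm_real, Real.norm_eq_abs,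
      show |ε| ^ 4 = ε ^ 4 by rw [← abs_pow, abs_of_nonneg (by positivity)]] at this
    linarith
  rw [heq, norm_div, norm_mul, norm_mul, norm_pow, Complex.norm_real, Real.norm_eq_abs,
    show |ε| ^ 4 = ε ^ 4 by rw [← abs_pow, abs_of_nonneg (by positivity)]]
  have : ‖(4 : ℂ)‖ = 4 := by simp
  rw [this]
  calc 4 * ε ^ 4 / (‖z‖ * ‖z ^ 4 - (ε : ℂ) ^ 4‖)
      ≤ 4 * ε ^ 4 / (z.im * (z.im ^ 2 * ‖z‖ ^ 2 / 2)) := by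
        gcongr
        refine le_trans ?_ hden
        have : z.im ^ 2 * ‖z‖ ^ 2 ≤ ‖z‖ ^ 2 * ‖z‖ ^ 2 := by gcongr
        nlinarith
    _ = _ := by field_simp; ring

theorem norm_taylor_inv_le (hz : 0 < z.im) (hε : |ε| ≤ z.im / 2) :
    ‖(z + ε * Complex.I)⁻¹ - z⁻¹ + ε * Complex.I * (z ^ 2)⁻¹‖ ≤
      2 * ε ^ 2 / z.im ^ 2 * (z.im / ‖z‖ ^ 2) := by
  have hz0 : z ≠ 0 := by rintro rfl; simp at hz
  have hn0 : 0 < ‖z‖ := norm_pos_iff.2 hz0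
  have h1 : z + ε * Complex.I ≠ 0 := add_ne_zero_of_abs_lt hz (by simpa using hε)
  have heq : (z + ε * Complex.I)⁻¹ - z⁻¹ + ε * Complex.I * (z ^ 2)⁻¹ =
      -(ε : ℂ) ^ 2 / (z ^ 2 * (z + ε * Complex.I)) := by
    field_simp
    ring_nf
    rw [Complex.I_sq]
    ring
  have hden := half_im_le_norm_add (z := z) (ζ := ε * Complex.I) (by simpa using hε)
  rw [heq, norm_div, norm_mul, norm_neg, norm_pow, norm_pow, Complex.norm_real, Real.norm_eq_abs,
    sq_abs]
  calc ε ^ 2 / (‖z‖ ^ 2 * ‖z + ε * Complex.I‖) ≤ ε ^ 2 / (‖z‖ ^ 2 * (z.im / 2)) := by gcongr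
    _ = _ := by field_simp

end KernelEstimates

/-! ### Finite differences of Poisson integrals of bounded functions -/

section AverageEstimates

variable {h : ℝ → ℝ} {M x y ε : ℝ}

theorem abs_second_difference_poissonAvg_le (hc : Continuous h) (hM : ∀ w, |h w| ≤ M)
    (hy : 0 < y) (hε : |ε| ≤ y / 2) :
    |poissonAvg y h (x + ε) + poissonAvg y h (x - ε) - 2 * poissonAvg y h x| ≤
      4 * ε ^ 2 / y ^ 2 * M := by
  have i1 := integrable_poissonKer_mul hc hM (x + ε) hy
  have i2 := integrable_poissonKer_mul hc hM (x - ε) hy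
  have i3 := integrable_poissonKer_mul hc hM x hy
  have h1 : poissonAvg y h (x + ε) + poissonAvg y h (x - ε) - 2 * poissonAvg y h x =
      ∫ w, (poissonKer ⟨x + ε - w, y⟩ + poissonKer ⟨x - ε - w, y⟩ - 2 * poissonKer ⟨x - w, y⟩) *
        h w := by
    rw [poissonAvg_eq_integral_poissonKer h _ hy, poissonAvg_eq_integral_poissonKer h _ hy,
      poissonAvg_eq_integral_poissonKer h _ hy, ← integral_const_mul, ← integral_add i1 i2,
      ← integral_sub (i1.fun_add i2) (i3.const_mul 2)]
    congr 1
    ext w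
    ring
  rw [h1]
  refine abs_integral_mul_le (x := x) hy hM fun w => ?_
  have h2 := norm_second_difference_inv_le (z := ⟨x - w, y⟩) hy hε
  have e1 : (⟨x + ε - w, y⟩ : ℂ) = ⟨x - w, y⟩ + ε := by apply Complex.ext <;> simp; ring
  have e2 : (⟨x - ε - w, y⟩ : ℂ) = ⟨x - w, y⟩ - ε := by apply Complex.ext <;> simp; ring
  have h3 := abs_im_le_poissonKer h2
  rw [e1, e2]
  refine le_of_eq_of_le ?_ h3
  rw [← abs_neg]
  simp only [poissonKer, Complex.add_im, Complex.sub_im, Complex.mul_im, Complex.re_ofNat,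
    Complex.im_ofNat]
  congr 1
  ring

/-- The five shifted kernels combine into the imaginary part of one finite difference of `1 / z`,
which is dominated by a multiple of the Poisson kernel of total mass one. -/
theorem abs_discrete_laplacian_poissonAvg_le (hc : Continuous h) (hM : ∀ w, |h w| ≤ M)
    (hy : 0 < y) (hε : |ε| ≤ y / 2) :
    |poissonAvg y h (x + ε) + poissonAvg y h (x - ε) + poissonAvg (y + ε) h x +
      poissonAvg (y - ε) h x - 4 * poissonAvg y h x| ≤ 8 * ε ^ 4 / y ^ 4 * M := by
  have hε' := abs_le.1 hε
  have hy1 : 0 < y + ε := by linarith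
  have hy2 : 0 < y - ε := by linarith
  have i1 := integrable_poissonKer_mul hc hM (x + ε) hy
  have i2 := integrable_poissonKer_mul hc hM (x - ε) hy
  have i3 := integrable_poissonKer_mul hc hM x hy
  have i4 := integrable_poissonKer_mul hc hM x hy1
  have i5 := integrable_poissonKer_mul hc hM x hy2
  have h1 : poissonAvg y h (x + ε) + poissonAvg y h (x - ε) + poissonAvg (y + ε) h x +
      poissonAvg (y - ε) h x - 4 * poissonAvg y h x =
      ∫ w, (poissonKer ⟨x + ε - w, y⟩ + poissonKer ⟨x - ε - w, y⟩ + poissonKer ⟨x - w, y + ε⟩ +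
        poissonKer ⟨x - w, y - ε⟩ - 4 * poissonKer ⟨x - w, y⟩) * h w := by
    rw [poissonAvg_eq_integral_poissonKer h _ hy, poissonAvg_eq_integral_poissonKer h _ hy,
      poissonAvg_eq_integral_poissonKer h _ hy, poissonAvg_eq_integral_poissonKer h _ hy1,
      poissonAvg_eq_integral_poissonKer h _ hy2, ← integral_const_mul, ← integral_add i1 i2,
      ← integral_add (i1.fun_add i2) i4, ← integral_add ((i1.fun_add i2).fun_add i4) i5,
      ← integral_sub (((i1.fun_add i2).fun_add i4).fun_add i5) (i3.const_mul 4)]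
    congr 1
    ext w
    ring
  rw [h1]
  refine abs_integral_mul_le (x := x) hy hM fun w => ?_
  have h2 := norm_discrete_laplacian_inv_le (z := ⟨x - w, y⟩) hy hε
  have e1 : (⟨x + ε - w, y⟩ : ℂ) = ⟨x - w, y⟩ + ε := by apply Complex.ext <;> simp; ring
  have e2 : (⟨x - ε - w, y⟩ : ℂ) = ⟨x - w, y⟩ - ε := by apply Complex.ext <;> simp; ring
  have e3 : (⟨x - w, y + ε⟩ : ℂ) = ⟨x - w, y⟩ + ε * Complex.I := by apply Complex.ext <;> simp
  have e4 : (⟨x - w, y - ε⟩ : ℂ) = ⟨x - w, y⟩ - ε * Complex.I := by apply Complex.ext <;> simp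
  have h3 := abs_im_le_poissonKer h2
  rw [e1, e2, e3, e4]
  refine le_of_eq_of_le ?_ h3
  rw [← abs_neg]
  simp only [poissonKer, Complex.add_im, Complex.sub_im, Complex.mul_im, Complex.re_ofNat,
    Complex.im_ofNat]
  congr 1
  ring

theorem abs_taylor_poissonAvg_le (hc : Continuous h) (hM : ∀ w, |h w| ≤ M)
    (hy : 0 < y) (hε : |ε| ≤ y / 2) :
    |poissonAvg (y + ε) h x - poissonAvg y h x - ε * poissonDeriv y h x| ≤
      2 * ε ^ 2 / y ^ 2 * M := by
  have hε' := abs_le.1 hε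
  have hy1 : 0 < y + ε := by linarith
  have i1 := integrable_poissonKer_mul hc hM x hy1
  have i2 := integrable_poissonKer_mul hc hM x hy
  have i3 := integrable_poissonKerDeriv_mul hc hM x hy
  have h1 : poissonAvg (y + ε) h x - poissonAvg y h x - ε * poissonDeriv y h x =
      ∫ w, (poissonKer ⟨x - w, y + ε⟩ - poissonKer ⟨x - w, y⟩ -
        ε * poissonKerDeriv ⟨x - w, y⟩) * h w := by
    rw [poissonAvg_eq_integral_poissonKer h _ hy, poissonAvg_eq_integral_poissonKer h _ hy1,
      poissonDeriv_eq_integral_poissonKerDeriv h _ hy, ← integral_const_mul, sub_sub,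
      ← integral_add i2 (i3.const_mul ε), ← integral_sub i1 (i2.fun_add (i3.const_mul ε))]
    congr 1
    ext w
    ring
  rw [h1]
  refine abs_integral_mul_le (x := x) hy hM fun w => ?_
  have h2 := norm_taylor_inv_le (z := ⟨x - w, y⟩) hy hε
  have e3 : (⟨x - w, y + ε⟩ : ℂ) = ⟨x - w, y⟩ + ε * Complex.I := by apply Complex.ext <;> simp
  have h3 := abs_im_le_poissonKer h2
  rw [e3]
  refine le_of_eq_of_le ?_ h3
  rw [← abs_neg]
  have h4 : ((ε : ℂ) * Complex.I * ((⟨x - w, y⟩ : ℂ) ^ 2)⁻¹).im =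
      ε * (((⟨x - w, y⟩ : ℂ) ^ 2)⁻¹).re := by
    rw [mul_assoc, Complex.im_ofReal_mul, Complex.I_mul_im]
  simp only [poissonKer, poissonKerDeriv, Complex.add_im, Complex.sub_im, h4]
  congr 1
  ring

end AverageEstimates

/-! ### Duhamel's formula -/

/-- The harmonic extension, at the point `(x, y)` and at time `t`, of the solution of the linear
evolution equation `v_t = ∂v/∂y + G` on the boundary with initial data `g`. -/
noncomputable def duhamel (g : ℝ → ℝ) (G : ℝ → ℝ → ℝ) (x y t : ℝ) : ℝ :=
  poissonAvg (t + y) g x + ∫ s in (0 : ℝ)..t, poissonAvg (t - s + y) (fun w => G w s) x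

theorem continuous_poissonAvg_slice {G : ℝ → ℝ → ℝ} {M : ℝ}
    (hG : Continuous fun p : ℝ × ℝ => G p.1 p.2) (hM : ∀ w s, |G w s| ≤ M) {α : Type*}
    [TopologicalSpace α] [FirstCountableTopology α] {τ x s : α → ℝ} (hτ : Continuous τ)
    (hx : Continuous x) (hs : Continuous s) :
    Continuous fun a => poissonAvg (τ a) (fun w => G w (s a)) (x a) :=
  continuous_poissonAvg (h := fun a w => G w (s a))
    (hG.comp (continuous_snd.prodMk (hs.comp continuous_fst))) (fun _ _ => hM _ _) hτ hx

theorem continuous_duhamel {g : ℝ → ℝ} {G : ℝ → ℝ → ℝ} {M M' : ℝ} (hg : Continuous g)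
    (hgM : ∀ w, |g w| ≤ M') (hG : Continuous fun p : ℝ × ℝ => G p.1 p.2)
    (hM : ∀ w s, |G w s| ≤ M) :
    Continuous fun p : ℝ × ℝ × ℝ => duhamel g G p.1 p.2.1 p.2.2 := by
  unfold duhamel
  refine Continuous.add ?_ ?_
  · exact continuous_poissonAvg (h := fun _ => g) (by fun_prop) (fun _ => hgM) (by fun_prop)
      (by fun_prop)
  · refine intervalIntegral.continuous_parametric_intervalIntegral_of_continuous
      (f := fun (p : ℝ × ℝ × ℝ) s => poissonAvg (p.2.2 - s + p.2.1) (fun w => G w s) p.1) ?_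
      (by fun_prop)
    exact continuous_poissonAvg_slice hG hM
      (τ := fun q : (ℝ × ℝ × ℝ) × ℝ => q.1.2.2 - q.2 + q.1.2.1)
      (x := fun q => q.1.1) (s := fun q => q.2) (by fun_prop) (by fun_prop) (by fun_prop)

theorem abs_duhamel_le {g : ℝ → ℝ} {G : ℝ → ℝ → ℝ} {M M' : ℝ} (hgM : ∀ w, |g w| ≤ M')
    (hM : ∀ w s, |G w s| ≤ M) (x y : ℝ) {t : ℝ} (ht : 0 ≤ t) :
    |duhamel g G x y t| ≤ M' + M * t := by
  have h1 : ‖∫ s in (0 : ℝ)..t, poissonAvg (t - s + y) (fun w => G w s) x‖ ≤ M * |t - 0| :=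
    intervalIntegral.norm_integral_le_of_norm_le_const fun s _ =>
      abs_poissonAvg_le (fun w => hM w s) _ _
  rw [sub_zero, abs_of_nonneg ht] at h1
  exact (abs_add_le _ _).trans (add_le_add (abs_poissonAvg_le hgM _ _) h1)

/-- Existence of a mild solution of `b_t = ∂b/∂y + F(x, b)`, Lipschitz continuous in space. -/
theorem exists_mild_solution {g : ℝ → ℝ} {F : ℝ → ℝ → ℝ} {M K L : ℝ} (hK : 0 ≤ K)
    (hg : Continuous g) (hgM : ∀ w, |g w| ≤ M) (hgL : ∀ w w', |g w - g w'| ≤ L * |w - w'|)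
    (hF : Continuous fun p : ℝ × ℝ => F p.1 p.2) (hFM : ∀ w r, |F w r| ≤ M)
    (hFK : ∀ w r r', |F w r - F w r'| ≤ K * |r - r'|)
    (hFL : ∀ w w' r, |F w r - F w' r| ≤ L * |w - w'|) :
    ∃ b : ℝ → ℝ → ℝ, Continuous (fun p : ℝ × ℝ => b p.1 p.2) ∧
      (∀ x t, 0 ≤ t → b x t = duhamel g (fun w s => F w (b w s)) x 0 t) ∧
      ∃ l C, 0 ≤ l ∧ 0 ≤ C ∧ ∀ x x' t, |b x t - b x' t| ≤ C * Real.exp (l * t) * |x - x'| := by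
  have hM0 : 0 ≤ M := (abs_nonneg _).trans (hgM 0)
  have hL0 : 0 ≤ L := by
    have := (abs_nonneg _).trans (hgL 0 1)
    simpa using this
  set l : ℝ := 2 * K + 1 with hl
  have hl1 : 1 ≤ l := by linarith
  have hKl : K / l ≤ 1 / 2 := by
    rw [div_le_div_iff₀ (by linarith) two_pos]; linarith
  -- The unknown is the weighted function `c = exp (-(l * t)) * b`. Poisson averaging does not
  -- increase the sup norm, so the contraction is as for an ODE with Lipschitz constant `K`.
  set G : BoundedContinuousFunction (ℝ × ℝ) ℝ → ℝ → ℝ → ℝ := fun c w s =>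
    F w (Real.exp (l * s) * c (w, s)) with hGdef
  have hGc : ∀ c, Continuous fun p : ℝ × ℝ => G c p.1 p.2 := fun c =>
    hF.comp (continuous_fst.prodMk
      (by fun_prop : Continuous fun p : ℝ × ℝ => Real.exp (l * p.2) * c (p.1, p.2)))
  have hGM : ∀ c w s, |G c w s| ≤ M := fun c w s => hFM _ _
  have hGs : ∀ c s, Continuous fun w => G c w s := fun c s =>
    (hGc c).comp (continuous_id.prodMk continuous_const)
  have hQ : ∀ c x t, Continuous fun s => poissonAvg (t - s + 0) (fun w => G c w s) x :=
    fun c x t => continuous_poissonAvg_slice (hGc c) (hGM c)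
      (by fun_prop : Continuous fun s => t - s + 0) continuous_const
      continuous_id
  set Φ : BoundedContinuousFunction (ℝ × ℝ) ℝ → ℝ × ℝ → ℝ := fun c p =>
    Real.exp (-(l * max p.2 0)) * duhamel g (G c) p.1 0 (max p.2 0) with hΦ
  have hΦc : ∀ c, Continuous (Φ c) := by
    intro c
    have h1 : Continuous fun p : ℝ × ℝ => duhamel g (G c) p.1 0 (max p.2 0) :=
      (continuous_duhamel hg hgM (hGc c) (hGM c)).comp
        (by fun_prop : Continuous fun p : ℝ × ℝ => (p.1, (0 : ℝ), max p.2 0))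
    simp only [hΦ]
    fun_prop
  have hexp1 : ∀ t : ℝ, Real.exp (-(l * max t 0)) ≤ 1 := fun t =>
    Real.exp_le_one_iff.2 (by nlinarith [le_max_right t 0])
  have hΦb : ∀ c p, ‖Φ c p‖ ≤ M + M := by
    intro c p
    have h1 := exp_neg_mul_integral_le (A := M) (B := 0) (l := l) (t := max p.2 0)
      (f := fun s => poissonAvg (max p.2 0 - s + 0) (fun w => G c w s) p.1) hM0 le_rfl hl1
      (le_max_right _ _) (fun s _ => by
        rw [zero_mul, add_zero M]
        exact abs_poissonAvg_le (fun w => hGM c w s) _ _)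
    rw [zero_div, add_zero] at h1
    have he := (Real.exp_pos (-(l * max p.2 0))).le
    calc ‖Φ c p‖ = Real.exp (-(l * max p.2 0)) * ‖duhamel g (G c) p.1 0 (max p.2 0)‖ := by
          simp only [hΦ]; rw [norm_mul, Real.norm_of_nonneg he]
      _ ≤ Real.exp (-(l * max p.2 0)) * (‖poissonAvg (max p.2 0 + 0) g p.1‖ + ‖∫ s in
          (0 : ℝ)..(max p.2 0), poissonAvg (max p.2 0 - s + 0) (fun w => G c w s) p.1‖) := by
          gcongr; exact norm_add_le _ _
      _ ≤ 1 * M + M := by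
          rw [mul_add]
          gcongr
          · exact hexp1 _
          · exact abs_poissonAvg_le hgM _ _
      _ = M + M := by ring
  set Ψ : BoundedContinuousFunction (ℝ × ℝ) ℝ → BoundedContinuousFunction (ℝ × ℝ) ℝ := fun c =>
    BoundedContinuousFunction.ofNormedAddCommGroup (Φ c) (hΦc c) _ (hΦb c) with hΨ
  have hcontr : ContractingWith (1 / 2) Ψ := by
    refine ⟨by norm_num, LipschitzWith.of_dist_le_mul fun c c' => ?_⟩
    refine (BoundedContinuousFunction.dist_le (by positivity)).2 fun p => ?_
    have h1 := exp_neg_mul_integral_le (A := 0) (B := K * dist c c') (l := l) (t := max p.2 0)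
      (f := fun s => poissonAvg (max p.2 0 - s + 0) (fun w => G c w s) p.1 -
        poissonAvg (max p.2 0 - s + 0) (fun w => G c' w s) p.1) le_rfl (by positivity) hl1
      (le_max_right _ _) (fun s _ => by
        refine abs_poissonAvg_sub_le_const (hGs c s) (hGs c' s) (fun w => hGM c w s)
          (fun w => hGM c' w s) fun z => ?_
        refine (hFK _ _ _).trans ?_
        rw [← mul_sub, abs_mul, abs_of_pos (Real.exp_pos _), zero_add, mul_right_comm, mul_assoc]
        gcongr
        exact c.dist_coe_le_dist (g := c') _)
    have he := (Real.exp_pos (-(l * max p.2 0))).le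
    calc dist (Ψ c p) (Ψ c' p) = ‖Φ c p - Φ c' p‖ := dist_eq_norm _ _
      _ = Real.exp (-(l * max p.2 0)) * ‖∫ s in (0 : ℝ)..(max p.2 0),
          (poissonAvg (max p.2 0 - s + 0) (fun w => G c w s) p.1 -
            poissonAvg (max p.2 0 - s + 0) (fun w => G c' w s) p.1)‖ := by
          rw [intervalIntegral.integral_sub ((hQ c _ _).intervalIntegrable _ _)
            ((hQ c' _ _).intervalIntegrable _ _)]
          simp only [hΦ, duhamel]
          rw [← mul_sub, norm_mul, Real.norm_of_nonneg he, add_sub_add_left_eq_sub]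
      _ ≤ 0 + K * dist c c' / l := h1
      _ = K / l * dist c c' := by ring
      _ ≤ 1 / 2 * dist c c' := by gcongr
      _ = _ := by simp
  obtain ⟨c, hc⟩ : ∃ c, Ψ c = c := ⟨hcontr.fixedPoint, hcontr.fixedPoint_isFixedPt⟩
  have hct : ∀ p, c p = Φ c p := fun p => by
    conv_lhs => rw [← hc]
    rfl
  -- A translate of the solution solves the equation with data changed by at most `L * |a|`. The
  -- fixed-point estimate for the difference `d` gives `‖d‖ ≤ 2 * L * |a| + ‖d‖ / 2`, and `‖d‖` is
  -- finite, so it can be absorbed.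
  have hlip : ∀ a : ℝ, ∀ x t, |c (x + a, t) - c (x, t)| ≤ 4 * L * |a| := by
    intro a
    set d : BoundedContinuousFunction (ℝ × ℝ) ℝ :=
      c.compContinuous ⟨fun p : ℝ × ℝ => (p.1 + a, p.2), by fun_prop⟩ - c with hd
    have hdv : ∀ x t, d (x, t) = c (x + a, t) - c (x, t) := fun x t => rfl
    have hdn : ‖d‖ ≤ 2 * L * |a| + ‖d‖ / 2 := by
      refine (BoundedContinuousFunction.norm_le (by positivity)).2 fun p => ?_
      have h1 := exp_neg_mul_integral_le (A := L * |a|) (B := K * ‖d‖) (l := l) (t := max p.2 0)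
        (f := fun s => poissonAvg (max p.2 0 - s + 0) (fun w => G c w s) (p.1 + a) -
          poissonAvg (max p.2 0 - s + 0) (fun w => G c w s) p.1) (by positivity) (by positivity) hl1
        (le_max_right _ _) (fun s _ => by
          refine abs_poissonAvg_sub_le_const (hGs c s) (hGs c s) (fun w => hGM c w s)
            (fun w => hGM c w s) fun z => ?_
          set w := p.1 + (max p.2 0 - s + 0) * z with hw
          rw [show p.1 + a + (max p.2 0 - s + 0) * z = w + a by rw [hw]; ring]
          have h2 := hFL (w + a) w (Real.exp (l * s) * c (w + a, s))
          have h3 := hFK w (Real.exp (l * s) * c (w + a, s)) (Real.exp (l * s) * c (w, s))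
          rw [← mul_sub, abs_mul, abs_of_pos (Real.exp_pos _), ← hdv] at h3
          have h4 : |d (w, s)| ≤ ‖d‖ := d.norm_coe_le_norm _
          have h5 : K * (Real.exp (l * s) * |d (w, s)|) ≤ K * ‖d‖ * Real.exp (l * s) := by
            rw [mul_assoc, mul_comm ‖d‖]; gcongr
          rw [add_sub_cancel_left] at h2
          have h6 := abs_sub_le (G c (w + a) s) (F w (Real.exp (l * s) * c (w + a, s))) (G c w s)
          linarith)
      have he := (Real.exp_pos (-(l * max p.2 0))).le
      have h0 : |poissonAvg (max p.2 0 + 0) g (p.1 + a) - poissonAvg (max p.2 0 + 0) g p.1| ≤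
          L * |a| := by
        refine abs_poissonAvg_sub_le_const hg hg hgM hgM fun z => (hgL _ _).trans (le_of_eq ?_)
        congr 2
        ring
      calc ‖d p‖ = ‖Φ c (p.1 + a, p.2) - Φ c p‖ := by
            rw [← hct, ← hct]; rfl
        _ = Real.exp (-(l * max p.2 0)) * ‖(poissonAvg (max p.2 0 + 0) g (p.1 + a) -
            poissonAvg (max p.2 0 + 0) g p.1) + ∫ s in (0 : ℝ)..(max p.2 0),
            (poissonAvg (max p.2 0 - s + 0) (fun w => G c w s) (p.1 + a) -
              poissonAvg (max p.2 0 - s + 0) (fun w => G c w s) p.1)‖ := by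
            rw [intervalIntegral.integral_sub ((hQ c _ _).intervalIntegrable _ _)
              ((hQ c _ _).intervalIntegrable _ _)]
            simp only [hΦ, duhamel]
            rw [← mul_sub, norm_mul, Real.norm_of_nonneg he, add_sub_add_comm]
        _ ≤ Real.exp (-(l * max p.2 0)) * (‖poissonAvg (max p.2 0 + 0) g (p.1 + a) -
            poissonAvg (max p.2 0 + 0) g p.1‖ + ‖∫ s in (0 : ℝ)..(max p.2 0),
            (poissonAvg (max p.2 0 - s + 0) (fun w => G c w s) (p.1 + a) -
              poissonAvg (max p.2 0 - s + 0) (fun w => G c w s) p.1)‖) := by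
            gcongr; exact norm_add_le _ _
        _ ≤ 1 * (L * |a|) + (L * |a| + K * ‖d‖ / l) := by
            rw [mul_add]
            gcongr
            · exact hexp1 _
            · exact h0
        _ = 2 * L * |a| + K / l * ‖d‖ := by ring
        _ ≤ 2 * L * |a| + 1 / 2 * ‖d‖ := by gcongr
        _ = _ := by ring
    intro x t
    have h1 : |d (x, t)| ≤ ‖d‖ := d.norm_coe_le_norm _
    rw [hdv] at h1
    linarith
  refine ⟨fun x t => Real.exp (l * t) * c (x, t), by fun_prop, fun x t ht => ?_, l, 4 * L,
    by linarith, by positivity, fun x x' t => ?_⟩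
  · change Real.exp (l * t) * c (x, t) = _
    rw [hct]
    simp only [hΦ, max_eq_left ht]
    rw [← mul_assoc, ← Real.exp_add, add_neg_cancel, Real.exp_zero, one_mul]
  · have h1 := hlip (x - x') x' t
    rw [add_sub_cancel] at h1
    change |Real.exp (l * t) * c (x, t) - Real.exp (l * t) * c (x', t)| ≤ _
    rw [← mul_sub, abs_mul, abs_of_pos (Real.exp_pos _)]
    calc Real.exp (l * t) * |c (x, t) - c (x', t)| ≤ Real.exp (l * t) * (4 * L * |x - x'|) := by
          gcongr
      _ = _ := by ring

/-! ### Differential properties of Duhamel's formula -/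

theorem hasDerivAt_integral_diagonal {q : ℝ → ℝ → ℝ} (hq : Continuous fun p : ℝ × ℝ => q p.1 p.2)
    (t : ℝ) : HasDerivAt (fun δ => ∫ s in t..(t + δ), q δ s) (q 0 t) 0 := by
  rw [hasDerivAt_iff_isLittleO_nhds_zero, Asymptotics.isLittleO_iff]
  intro c hc
  obtain ⟨r, hr, hball⟩ := Metric.continuousAt_iff.1 (hq.continuousAt (x := (0, t))) c hc
  filter_upwards [Metric.ball_mem_nhds (0 : ℝ) hr] with δ hδ
  rw [Metric.mem_ball, Real.dist_eq, sub_zero] at hδ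
  have hqc : Continuous fun s => q δ s := hq.comp (continuous_const.prodMk continuous_id)
  have h1 : (∫ s in t..(t + (0 + δ)), q (0 + δ) s) - (∫ s in t..(t + 0), q 0 s) - δ • q 0 t =
      ∫ s in t..(t + δ), (q δ s - q 0 t) := by
    rw [intervalIntegral.integral_sub (hqc.intervalIntegrable _ _)
      (continuous_const.intervalIntegrable _ _)]
    simp
  rw [h1]
  have h2 := intervalIntegral.norm_integral_le_of_norm_le_const (a := t) (b := t + δ) (C := c)
    (f := fun s => q δ s - q 0 t) (fun s hs => by
      have hs' : |s - t| ≤ |δ| := by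
        have := abs_sub_left_of_mem_uIcc (uIoc_subset_uIcc hs)
        simpa using this
      have : dist (δ, s) ((0 : ℝ), t) < r := by
        rw [Prod.dist_eq, max_lt_iff, Real.dist_eq, Real.dist_eq, sub_zero]
        exact ⟨hδ, hs'.trans_lt hδ⟩
      exact (hball this).le)
  simpa using h2

/-- The normal derivative of `duhamel g G`. -/
noncomputable def duhamelDeriv (g : ℝ → ℝ) (G : ℝ → ℝ → ℝ) (x y t : ℝ) : ℝ :=
  poissonDeriv (t + y) g x + ∫ s in (0 : ℝ)..t, poissonDeriv (t - s + y) (fun w => G w s) x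

section Duhamel

variable {g : ℝ → ℝ} {G : ℝ → ℝ → ℝ} {M : ℝ}

theorem continuous_poissonAvg_time {G : ℝ → ℝ → ℝ} {M : ℝ}
    (hG : Continuous fun p : ℝ × ℝ => G p.1 p.2) (hM : ∀ w s, |G w s| ≤ M) (x y t : ℝ) :
    Continuous fun s => poissonAvg (t - s + y) (fun w => G w s) x :=
  continuous_poissonAvg_slice hG hM (by fun_prop : Continuous fun s => t - s + y) continuous_const
    continuous_id

theorem intervalIntegrable_poissonDeriv {G : ℝ → ℝ → ℝ} {M : ℝ}
    (hG : Continuous fun p : ℝ × ℝ => G p.1 p.2) (hM : ∀ w s, |G w s| ≤ M) (x : ℝ) {y t : ℝ}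
    (hy : 0 < y) (ht : 0 ≤ t) :
    IntervalIntegrable (fun s => poissonDeriv (t - s + y) (fun w => G w s) x) volume 0 t := by
  have h1 := continuousOn_poissonDeriv (h := fun s w => G w s) (τ := fun s => t - s + y)
    (x := fun _ => x) (hG.comp continuous_swap) (fun s w => hM w s) (by fun_prop) continuous_const
  refine (h1.mono fun s hs => ?_).intervalIntegrable
  rw [uIcc_of_le ht] at hs
  have : 0 < t - s + y := by linarith [hs.2]
  exact this.ne'

theorem abs_integral_le_of_forall {f : ℝ → ℝ} {C t : ℝ} (ht : 0 ≤ t)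
    (hf : ∀ s ∈ Icc 0 t, |f s| ≤ C) : |∫ s in (0 : ℝ)..t, f s| ≤ C * t := by
  have := intervalIntegral.norm_integral_le_of_norm_le_const (a := 0) (b := t) (f := f) (C := C)
    (fun s hs => by
      rw [uIoc_of_le ht] at hs
      exact hf s ⟨hs.1.le, hs.2⟩)
  rwa [sub_zero, abs_of_nonneg ht] at this

/-- Every Poisson average in the formula is taken at height at least `y`, so the bound for a single
average at height `y` integrates over `[0, t]`. -/
theorem abs_discrete_laplacian_duhamel_le (hg : Continuous g) (hgM : ∀ w, |g w| ≤ M)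
    (hG : Continuous fun p : ℝ × ℝ => G p.1 p.2) (hM : ∀ w s, |G w s| ≤ M)
    {x y t ε : ℝ} (hy : 0 < y) (ht : 0 ≤ t)
    (hε : |ε| ≤ y / 2) :
    |duhamel g G (x + ε) y t + duhamel g G (x - ε) y t + duhamel g G x (y + ε) t +
      duhamel g G x (y - ε) t - 4 * duhamel g G x y t| ≤ 8 * ε ^ 4 / y ^ 4 * M * (1 + t) := by
  have hM0 : 0 ≤ M := (abs_nonneg _).trans (hgM 0)
  have hGs : ∀ s, Continuous fun w => G w s := fun s =>
    hG.comp (continuous_id.prodMk continuous_const)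
  have key : ∀ τ, y ≤ τ → ∀ h : ℝ → ℝ, Continuous h → (∀ w, |h w| ≤ M) →
      |poissonAvg τ h (x + ε) + poissonAvg τ h (x - ε) + poissonAvg (τ + ε) h x +
        poissonAvg (τ - ε) h x - 4 * poissonAvg τ h x| ≤ 8 * ε ^ 4 / y ^ 4 * M := by
    intro τ hτ h hc hhM
    refine (abs_discrete_laplacian_poissonAvg_le hc hhM (hy.trans_le hτ) (by linarith)).trans ?_
    gcongr
  have i := fun x y => (continuous_poissonAvg_time hG hM x y t).intervalIntegrable (μ := volume) 0 t
  have h1 := key (t + y) (by linarith) g hg hgM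
  have h2 : |∫ s in (0 : ℝ)..t, (poissonAvg (t - s + y) (fun w => G w s) (x + ε) +
      poissonAvg (t - s + y) (fun w => G w s) (x - ε) +
      poissonAvg (t - s + (y + ε)) (fun w => G w s) x +
      poissonAvg (t - s + (y - ε)) (fun w => G w s) x -
      4 * poissonAvg (t - s + y) (fun w => G w s) x)| ≤ 8 * ε ^ 4 / y ^ 4 * M * t := by
    refine abs_integral_le_of_forall ht fun s hs => ?_
    have := key (t - s + y) (by linarith [hs.2]) (fun w => G w s) (hGs s) (fun w => hM w s)
    rwa [add_assoc (t - s), add_sub_assoc (t - s)] at this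
  rw [intervalIntegral.integral_sub
      ((((i (x + ε) y).add (i (x - ε) y)).add (i x (y + ε))).add (i x (y - ε)))
      ((i x y).const_mul 4), intervalIntegral.integral_add
      (((i (x + ε) y).add (i (x - ε) y)).add (i x (y + ε))) (i x (y - ε)),
    intervalIntegral.integral_add ((i (x + ε) y).add (i (x - ε) y)) (i x (y + ε)),
    intervalIntegral.integral_add (i (x + ε) y) (i (x - ε) y),
    intervalIntegral.integral_const_mul] at h2
  rw [add_assoc t, add_sub_assoc t] at h1
  unfold duhamel
  calc _ = |_ + _| := by congr 1; ring
    _ ≤ _ := abs_add_le _ _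
    _ ≤ 8 * ε ^ 4 / y ^ 4 * M + 8 * ε ^ 4 / y ^ 4 * M * t := add_le_add h1 h2
    _ = _ := by ring

theorem abs_second_difference_duhamel_le (hg : Continuous g) (hgM : ∀ w, |g w| ≤ M)
    (hG : Continuous fun p : ℝ × ℝ => G p.1 p.2) (hM : ∀ w s, |G w s| ≤ M)
    {x y t ε : ℝ} (hy : 0 < y) (ht : 0 ≤ t)
    (hε : |ε| ≤ y / 2) :
    |duhamel g G (x + ε) y t + duhamel g G (x - ε) y t - 2 * duhamel g G x y t| ≤
      4 * ε ^ 2 / y ^ 2 * M * (1 + t) := by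
  have hM0 : 0 ≤ M := (abs_nonneg _).trans (hgM 0)
  have hGs : ∀ s, Continuous fun w => G w s := fun s =>
    hG.comp (continuous_id.prodMk continuous_const)
  have key : ∀ τ, y ≤ τ → ∀ h : ℝ → ℝ, Continuous h → (∀ w, |h w| ≤ M) →
      |poissonAvg τ h (x + ε) + poissonAvg τ h (x - ε) - 2 * poissonAvg τ h x| ≤
        4 * ε ^ 2 / y ^ 2 * M := by
    intro τ hτ h hc hhM
    refine (abs_second_difference_poissonAvg_le hc hhM (hy.trans_le hτ) (by linarith)).trans ?_
    gcongr
  have i := fun x y => (continuous_poissonAvg_time hG hM x y t).intervalIntegrable (μ := volume) 0 t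
  have h1 := key (t + y) (by linarith) g hg hgM
  have h2 : |∫ s in (0 : ℝ)..t, (poissonAvg (t - s + y) (fun w => G w s) (x + ε) +
      poissonAvg (t - s + y) (fun w => G w s) (x - ε) -
      2 * poissonAvg (t - s + y) (fun w => G w s) x)| ≤ 4 * ε ^ 2 / y ^ 2 * M * t :=
    abs_integral_le_of_forall ht fun s hs =>
      key (t - s + y) (by linarith [hs.2]) (fun w => G w s) (hGs s) (fun w => hM w s)
  rw [intervalIntegral.integral_sub ((i (x + ε) y).add (i (x - ε) y)) ((i x y).const_mul 2),
    intervalIntegral.integral_add (i (x + ε) y) (i (x - ε) y),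
    intervalIntegral.integral_const_mul] at h2
  unfold duhamel
  calc _ = |_ + _| := by congr 1; ring
    _ ≤ _ := abs_add_le _ _
    _ ≤ 4 * ε ^ 2 / y ^ 2 * M + 4 * ε ^ 2 / y ^ 2 * M * t := add_le_add h1 h2
    _ = _ := by ring

theorem abs_taylor_duhamel_le (hg : Continuous g) (hgM : ∀ w, |g w| ≤ M)
    (hG : Continuous fun p : ℝ × ℝ => G p.1 p.2) (hM : ∀ w s, |G w s| ≤ M)
    {x y t ε : ℝ} (hy : 0 < y) (ht : 0 ≤ t) (hε : |ε| ≤ y / 2) :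
    |duhamel g G x (y + ε) t - duhamel g G x y t - ε * duhamelDeriv g G x y t| ≤
      2 * ε ^ 2 / y ^ 2 * M * (1 + t) := by
  have hM0 : 0 ≤ M := (abs_nonneg _).trans (hgM 0)
  have hGs : ∀ s, Continuous fun w => G w s := fun s =>
    hG.comp (continuous_id.prodMk continuous_const)
  have key : ∀ τ, y ≤ τ → ∀ h : ℝ → ℝ, Continuous h → (∀ w, |h w| ≤ M) →
      |poissonAvg (τ + ε) h x - poissonAvg τ h x - ε * poissonDeriv τ h x| ≤
        2 * ε ^ 2 / y ^ 2 * M := by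
    intro τ hτ h hc hhM
    refine (abs_taylor_poissonAvg_le hc hhM (hy.trans_le hτ) (by linarith)).trans ?_
    gcongr
  have i := fun x y => (continuous_poissonAvg_time hG hM x y t).intervalIntegrable (μ := volume) 0 t
  have h1 := key (t + y) (by linarith) g hg hgM
  have h2 : |∫ s in (0 : ℝ)..t, (poissonAvg (t - s + (y + ε)) (fun w => G w s) x -
      poissonAvg (t - s + y) (fun w => G w s) x -
      ε * poissonDeriv (t - s + y) (fun w => G w s) x)| ≤ 2 * ε ^ 2 / y ^ 2 * M * t := by
    refine abs_integral_le_of_forall ht fun s hs => ?_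
    have := key (t - s + y) (by linarith [hs.2]) (fun w => G w s) (hGs s) (fun w => hM w s)
    rwa [add_assoc (t - s)] at this
  rw [intervalIntegral.integral_sub ((i x (y + ε)).sub (i x y))
    ((intervalIntegrable_poissonDeriv hG hM x hy ht).const_mul ε),
    intervalIntegral.integral_sub (i x (y + ε)) (i x y),
    intervalIntegral.integral_const_mul] at h2
  rw [add_assoc t] at h1
  unfold duhamel duhamelDeriv
  calc _ = |_ + _| := by congr 1; ring
    _ ≤ _ := abs_add_le _ _
    _ ≤ 2 * ε ^ 2 / y ^ 2 * M + 2 * ε ^ 2 / y ^ 2 * M * t := add_le_add h1 h2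
    _ = _ := by ring

theorem hasDerivAt_duhamel_normal (hg : Continuous g) (hgM : ∀ w, |g w| ≤ M)
    (hG : Continuous fun p : ℝ × ℝ => G p.1 p.2) (hM : ∀ w s, |G w s| ≤ M)
    {x y t : ℝ} (hy : 0 < y) (ht : 0 ≤ t) :
    HasDerivAt (fun δ => duhamel g G x (y + δ) t) (duhamelDeriv g G x y t) 0 := by
  have hM0 : 0 ≤ M := (abs_nonneg _).trans (hgM 0)
  rw [hasDerivAt_iff_isLittleO_nhds_zero, Asymptotics.isLittleO_iff]
  intro c hc
  set A : ℝ := 2 / y ^ 2 * M * (1 + t) + 1 with hA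
  have hA0 : 0 < A := by positivity
  filter_upwards [Metric.ball_mem_nhds (0 : ℝ) (half_pos hy),
    Metric.ball_mem_nhds (0 : ℝ) (div_pos hc hA0)] with δ h1 h2
  rw [Metric.mem_ball, Real.dist_eq, sub_zero] at h1 h2
  have h3 := abs_taylor_duhamel_le hg hgM hG hM (x := x) hy ht h1.le
  simp only [zero_add, add_zero, smul_eq_mul]
  rw [Real.norm_eq_abs, Real.norm_eq_abs]
  refine h3.trans ?_
  calc 2 * δ ^ 2 / y ^ 2 * M * (1 + t) = (A - 1) * |δ| * |δ| := by
        rw [hA, mul_assoc (_ - 1), ← sq, sq_abs]; ring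
    _ ≤ A * (c / A) * |δ| := by
        gcongr
        linarith
    _ = c * |δ| := by field_simp

/-- This is the evolution equation `v_t = ∂v/∂y + P_y G` at positive height `y`: time and height
enter through their sum, apart from the upper limit of the integral. -/
theorem hasDerivAt_duhamel_time (hg : Continuous g) (hgM : ∀ w, |g w| ≤ M)
    (hG : Continuous fun p : ℝ × ℝ => G p.1 p.2) (hM : ∀ w s, |G w s| ≤ M)
    {x y t : ℝ} (hy : 0 < y) (ht : 0 ≤ t) :
    HasDerivAt (fun s => duhamel g G x y s)
      (duhamelDeriv g G x y t + poissonAvg y (fun w => G w t) x) t := by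
  have h1 := hasDerivAt_duhamel_normal hg hgM hG hM (x := x) hy ht
  have h2 := hasDerivAt_integral_diagonal (q := fun δ s => poissonAvg (t + δ - s + y)
    (fun w => G w s) x) (continuous_poissonAvg_slice hG hM
      (by fun_prop : Continuous fun p : ℝ × ℝ => t + p.1 - p.2 + y) continuous_const
      continuous_snd) t
  have h3 := h1.add h2
  have hq0 : t + 0 - t + y = y := by ring
  rw [hq0] at h3
  -- Waiting for time `δ` amounts to rising by `δ`, plus the forcing collected on `[t, t + δ]`.
  have h4 : (fun δ => duhamel g G x y (t + δ)) = (fun δ => duhamel g G x (y + δ) t) +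
      fun δ => ∫ s in t..(t + δ), poissonAvg (t + δ - s + y) (fun w => G w s) x := by
    ext δ
    have i := fun a b => (continuous_poissonAvg_time hG hM x y (t + δ)).intervalIntegrable
      (μ := volume) a b
    simp only [duhamel, Pi.add_apply]
    rw [← intervalIntegral.integral_add_adjacent_intervals (i 0 t) (i t (t + δ))]
    have e1 : t + δ + y = t + (y + δ) := by ring
    have e2 : ∀ s, t + δ - s + y = t - s + (y + δ) := fun s => by ring
    rw [e1]
    simp only [e2]
    ring
  rw [← h4] at h3
  have h5 : HasDerivAt (fun s => s - t) 1 t := (hasDerivAt_id t).sub_const t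
  have h6 := HasDerivAt.comp_of_eq t h3 h5 (sub_self t).symm
  simpa [Function.comp_def] using h6

end Duhamel

/-! ### Moduli of continuity -/

/-- A modulus of continuity for Poisson averages of functions bounded by `M` and Lipschitz
continuous with constant `L`. -/
noncomputable def poissonModulus (M L h : ℝ) : ℝ :=
  ∫ z, cauchyDensity z * min (2 * M) (L * (|h| * |z|))

theorem continuous_poissonModulus {M L : ℝ} (hM : 0 ≤ M) (hL : 0 ≤ L) :
    Continuous (poissonModulus M L) := by
  unfold poissonModulus
  refine MeasureTheory.continuous_of_dominated (bound := fun z => cauchyDensity z * (2 * M))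
    (fun h => (continuous_cauchyDensity.mul (by fun_prop)).aestronglyMeasurable)
    (fun h => Eventually.of_forall fun z => ?_) (integrable_cauchyDensity.mul_const _)
    (Eventually.of_forall fun z => by fun_prop)
  rw [Real.norm_eq_abs, abs_mul, abs_of_nonneg (cauchyDensity_nonneg z),
    abs_of_nonneg (by positivity)]
  exact mul_le_mul_of_nonneg_left (min_le_left _ _) (cauchyDensity_nonneg z)

/-- The Cauchy density has no first moment, so the Lipschitz bound alone is not integrable; the
truncation at `2 * M` makes the modulus finite and, by dominated convergence, continuous with value
zero at zero. -/
theorem poissonModulus_zero {M L : ℝ} (hM : 0 ≤ M) : poissonModulus M L 0 = 0 := by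
  simp [poissonModulus, hM]

theorem poissonModulus_nonneg {M L : ℝ} (hM : 0 ≤ M) (hL : 0 ≤ L) (h : ℝ) :
    0 ≤ poissonModulus M L h :=
  integral_nonneg fun z => mul_nonneg (cauchyDensity_nonneg z) (by positivity)

theorem abs_poissonAvg_add_sub_le {h : ℝ → ℝ} {M L : ℝ} (hc : Continuous h) (hM : ∀ w, |h w| ≤ M)
    (hL0 : 0 ≤ L) (hL : ∀ w w', |h w - h w'| ≤ L * |w - w'|) (τ δ x : ℝ) :
    |poissonAvg (τ + δ) h x - poissonAvg τ h x| ≤ poissonModulus M L δ := by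
  have hM0 : 0 ≤ M := (abs_nonneg _).trans (hM 0)
  refine abs_poissonAvg_sub_le hc hc hM hM ?_ fun z => ?_
  · refine integrable_cauchyDensity_mul (M := 2 * M) (by fun_prop) fun z => ?_
    rw [abs_of_nonneg (by positivity)]
    exact min_le_left _ _
  · refine le_min ?_ ?_
    · linarith [abs_sub (h (x + (τ + δ) * z)) (h (x + τ * z)), hM (x + (τ + δ) * z), hM (x + τ * z)]
    · refine (hL _ _).trans (le_of_eq ?_)
      rw [← abs_mul]
      congr 2
      ring

theorem abs_duhamel_shift_sub_le {g : ℝ → ℝ} {G : ℝ → ℝ → ℝ} {M L : ℝ} (hg : Continuous g)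
    (hgM : ∀ w, |g w| ≤ M) (hG : Continuous fun p : ℝ × ℝ => G p.1 p.2)
    (hM : ∀ w s, |G w s| ≤ M) (hL0 : 0 ≤ L) (hgL : ∀ w w', |g w - g w'| ≤ L * |w - w'|) {t : ℝ}
    (ht : 0 ≤ t) (hGL : ∀ s ∈ Icc 0 t, ∀ w w', |G w s - G w' s| ≤ L * |w - w'|) (x y δ : ℝ) :
    |duhamel g G x (y + δ) t - duhamel g G x y t| ≤ poissonModulus M L δ * (1 + t) := by
  have hGs : ∀ s, Continuous fun w => G w s := fun s =>
    hG.comp (continuous_id.prodMk continuous_const)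
  have i := fun x y => (continuous_poissonAvg_time hG hM x y t).intervalIntegrable (μ := volume) 0 t
  have h1 := abs_poissonAvg_add_sub_le hg hgM hL0 hgL (t + y) δ x
  have h2 : |∫ s in (0 : ℝ)..t, (poissonAvg (t - s + (y + δ)) (fun w => G w s) x -
      poissonAvg (t - s + y) (fun w => G w s) x)| ≤ poissonModulus M L δ * t := by
    refine abs_integral_le_of_forall ht fun s hs => ?_
    have := abs_poissonAvg_add_sub_le (hGs s) (fun w => hM w s) hL0 (hGL s hs) (t - s + y) δ x
    rwa [add_assoc (t - s)] at this
  rw [intervalIntegral.integral_sub (i x (y + δ)) (i x y)] at h2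
  rw [add_assoc t] at h1
  unfold duhamel
  calc _ = |_ + _| := by congr 1; ring
    _ ≤ _ := abs_add_le _ _
    _ ≤ poissonModulus M L δ + poissonModulus M L δ * t := add_le_add h1 h2
    _ = _ := by ring

/-! ### Second derivatives as limits of second differences -/

theorem tendsto_second_difference {f : ℝ → ℝ} (hf : ContDiff ℝ 2 f) :
    Tendsto (fun s => (f s + f (-s) - 2 * f 0) / s ^ 2) (𝓝[≠] 0) (𝓝 (deriv (deriv f) 0)) := by
  have h1 : (fun s => f s - (f 0 + s * deriv f 0 + s ^ 2 / 2 * deriv (deriv f) 0)) =o[𝓝 0]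
      fun s => s ^ 2 := by
    have := taylor_isLittleO_univ (f := f) (x₀ := 0) (n := 2) hf
    simp only [sub_zero] at this
    refine this.congr_left fun s => ?_
    simp only [taylorWithinEval_succ, taylor_within_zero_eval, iteratedDerivWithin_univ,
      iteratedDeriv_succ, iteratedDeriv_zero, sub_zero, Nat.cast_zero, zero_add, Nat.factorial,
      Nat.cast_one, smul_eq_mul]
    ring
  have h2 := h1.comp_tendsto (k := fun s : ℝ => -s) (l' := 𝓝 0)
    (by simpa using (continuous_neg.tendsto (0 : ℝ)))
  have h3 := (h1.add (h2.congr_right (fun s => by simp)))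
  have h4 := (h3.mono (nhdsWithin_le_nhds (s := {0}ᶜ))).tendsto_div_nhds_zero
  have h5 := h4.add_const (deriv (deriv f) 0)
  rw [zero_add] at h5
  refine h5.congr' ?_
  filter_upwards [self_mem_nhdsWithin] with s hs
  have hs' : s ≠ 0 := hs
  simp only [Function.comp_apply]
  field_simp
  ring

section SecondDerivative

variable {E : Type*} [NormedAddCommGroup E] [NormedSpace ℝ E] {Φ : E → ℝ}

theorem hasDerivAt_comp_line {F : Type*} [NormedAddCommGroup F] [NormedSpace ℝ F] {Φ : E → F}
    (hΦ : Differentiable ℝ Φ) (p v : E) (s : ℝ) :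
    HasDerivAt (fun s : ℝ => Φ (p + s • v)) (fderiv ℝ Φ (p + s • v) v) s := by
  have h1 : HasDerivAt (fun s : ℝ => p + s • v) ((1 : ℝ) • v) s :=
    ((hasDerivAt_id s).smul_const v).const_add p
  rw [one_smul] at h1
  exact (hΦ (p + s • v)).hasFDerivAt.comp_hasDerivAt s h1

theorem deriv_deriv_comp_line (hΦ : ContDiff ℝ 2 Φ) (p v : E) :
    deriv (deriv fun s : ℝ => Φ (p + s • v)) 0 = iteratedFDeriv ℝ 2 Φ p ![v, v] := by
  have h1 : (deriv fun s : ℝ => Φ (p + s • v)) = fun s => fderiv ℝ Φ (p + s • v) v :=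
    funext fun s => (hasDerivAt_comp_line (hΦ.differentiable two_ne_zero) p v s).deriv
  have h2 : Differentiable ℝ (fderiv ℝ Φ) :=
    (hΦ.fderiv_right (m := 1) (by norm_num)).differentiable one_ne_zero
  have h3 := (hasDerivAt_comp_line h2 p v 0).clm_apply (hasDerivAt_const (0 : ℝ) v)
  rw [zero_smul, add_zero, map_zero, add_zero] at h3
  rw [h1, iteratedFDeriv_two_apply, h3.deriv]
  rfl

end SecondDerivative

/-- The first unit vector. -/
noncomputable abbrev unitX : Plane := EuclideanSpace.single 0 1

/-- The second unit vector. -/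
noncomputable abbrev unitY : Plane := EuclideanSpace.single 1 1

theorem laplacian_eq_sum_plane (ψ : Plane → ℝ) (X : Plane) : Laplacian.laplacian ψ X =
    iteratedFDeriv ℝ 2 ψ X ![unitX, unitX] + iteratedFDeriv ℝ 2 ψ X ![unitY, unitY] := by
  rw [InnerProductSpace.laplacian_eq_iteratedFDeriv_orthonormalBasis ψ
    (EuclideanSpace.basisFun (Fin 2) ℝ)]
  simp

/-- At a maximum of `f - ψ` the second differences of `ψ` dominate those of `f`; dividing by `s ^ 2`
makes the error `C * s ^ 4` disappear. Only finite differences of `f` enter, so second derivatives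
of Duhamel's formula are never computed. -/
theorem laplacian_nonneg_of_isLocalMax {f ψ : Plane → ℝ} {X : Plane} (hψ : ContDiff ℝ 2 ψ) {C : ℝ}
    (hf : ∀ᶠ s in 𝓝[>] (0 : ℝ), -(C * s ^ 4) ≤ f (X + s • unitX) + f (X + (-s) • unitX) +
      f (X + s • unitY) + f (X + (-s) • unitY) - 4 * f X)
    (hmax : IsLocalMax (fun Y => f Y - ψ Y) X) : 0 ≤ Laplacian.laplacian ψ X := by
  have hline : ∀ v : Plane, Tendsto (fun s : ℝ =>
      (ψ (X + s • v) + ψ (X + (-s) • v) - 2 * ψ (X + (0 : ℝ) • v)) / s ^ 2) (𝓝[>] 0)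
      (𝓝 (iteratedFDeriv ℝ 2 ψ X ![v, v])) := by
    intro v
    rw [← deriv_deriv_comp_line hψ]
    have hc : ContDiff ℝ 2 fun s : ℝ => ψ (X + s • v) := hψ.comp (by fun_prop)
    exact (tendsto_second_difference hc).mono_left
      (nhdsWithin_mono _ fun s (hs : 0 < s) => hs.ne')
  have hmaxv : ∀ v : Plane, ∀ᶠ s in 𝓝[>] (0 : ℝ), f (X + s • v) - ψ (X + s • v) ≤ f X - ψ X := by
    intro v
    have h1 : Tendsto (fun s : ℝ => X + s • v) (𝓝[>] 0) (𝓝 X) := by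
      have : Continuous fun s : ℝ => X + s • v := by fun_prop
      simpa using (this.tendsto 0).mono_left nhdsWithin_le_nhds
    exact h1.eventually hmax
  rw [laplacian_eq_sum_plane]
  have hlow : Tendsto (fun s : ℝ => -(C * s ^ 2)) (𝓝[>] 0) (𝓝 0) := by
    have : Continuous fun s : ℝ => -(C * s ^ 2) := by fun_prop
    simpa using (this.tendsto 0).mono_left nhdsWithin_le_nhds
  refine le_of_tendsto_of_tendsto hlow ((hline unitX).add (hline unitY)) ?_
  filter_upwards [hf, hmaxv unitX, hmaxv (-unitX), hmaxv unitY, hmaxv (-unitY),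
    self_mem_nhdsWithin] with s h0 h1 h2 h3 h4 hs
  have hs' : 0 < s := hs
  rw [smul_neg, ← neg_smul] at h2 h4
  rw [← add_div, le_div_iff₀ (by positivity)]
  simp only [zero_smul, add_zero]
  nlinarith

/-! ### Derivatives of test functions as continuous expressions in space and time -/

section TestFunction

variable {φ : Plane → ℝ → ℝ}

theorem contDiff_space_slice
    (hφ : ContDiff ℝ 2 fun p : Plane × ℝ => φ p.1 p.2) (t : ℝ) : ContDiff ℝ 2 fun Y => φ Y t :=
  hφ.comp (contDiff_id.prodMk contDiff_const)

theorem spaceLaplacian_eq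
    (hφ : ContDiff ℝ 2 fun p : Plane × ℝ => φ p.1 p.2) (X : Plane) (t : ℝ) : spaceLaplacian φ X t =
    iteratedFDeriv ℝ 2 (fun p : Plane × ℝ => φ p.1 p.2) (X, t) ![(unitX, 0), (unitX, 0)] +
    iteratedFDeriv ℝ 2 (fun p : Plane × ℝ => φ p.1 p.2) (X, t) ![(unitY, 0), (unitY, 0)] := by
  have hs := contDiff_space_slice hφ t
  rw [spaceLaplacian, laplacian_eq_sum_plane, ← deriv_deriv_comp_line hs,
    ← deriv_deriv_comp_line hs, ← deriv_deriv_comp_line hφ, ← deriv_deriv_comp_line hφ]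
  simp

theorem hasDerivAt_time
    (hφ : ContDiff ℝ 2 fun p : Plane × ℝ => φ p.1 p.2) (X : Plane) (t : ℝ) :
    HasDerivAt (fun s => φ X s)
    (fderiv ℝ (fun p : Plane × ℝ => φ p.1 p.2) (X, t) (0, 1)) t := by
  have h1 : HasDerivAt (fun s : ℝ => (X, s)) ((0 : Plane), (1 : ℝ)) t :=
    (hasDerivAt_const t X).prodMk (hasDerivAt_id t)
  exact (hφ.differentiable two_ne_zero (X, t)).hasFDerivAt.comp_hasDerivAt t h1

theorem hasDerivAt_line
    (hφ : ContDiff ℝ 2 fun p : Plane × ℝ => φ p.1 p.2) (X v : Plane) (t : ℝ) :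
    HasDerivAt (fun s : ℝ => φ (X + s • v) t)
    (fderiv ℝ (fun p : Plane × ℝ => φ p.1 p.2) (X, t) (v, 0)) 0 := by
  have := hasDerivAt_comp_line (hφ.differentiable two_ne_zero) (X, t) (v, 0) 0
  simpa using this

theorem lineDeriv_eq
    (hφ : ContDiff ℝ 2 fun p : Plane × ℝ => φ p.1 p.2) (X v : Plane) (t : ℝ) :
    lineDeriv ℝ (fun Y => φ Y t) X v =
    fderiv ℝ (fun p : Plane × ℝ => φ p.1 p.2) (X, t) (v, 0) :=
  (hasDerivAt_line hφ X v t).deriv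

end TestFunction

/-! ### The quartic perturbation of test functions -/

/-- A quartic function with a strict minimum at `(X₀, t₀)` and vanishing second derivatives
there. -/
def quartic (X₀ : Plane) (t₀ : ℝ) (X : Plane) (t : ℝ) : ℝ :=
  (X 0 - X₀ 0) ^ 4 + (X 1 - X₀ 1) ^ 4 + (t - t₀) ^ 4

theorem contDiff_quartic (X₀ : Plane) (t₀ : ℝ) :
    ContDiff ℝ 2 fun p : Plane × ℝ => quartic X₀ t₀ p.1 p.2 := by
  have h : ∀ k : Fin 2, ContDiff ℝ 2 fun p : Plane × ℝ => p.1 k := fun k =>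
    (EuclideanSpace.proj (𝕜 := ℝ) k).contDiff.comp contDiff_fst
  unfold quartic
  have h0 := h 0
  have h1 := h 1
  fun_prop

theorem quartic_nonneg (X₀ : Plane) (t₀ : ℝ) (X : Plane) (t : ℝ) : 0 ≤ quartic X₀ t₀ X t := by
  unfold quartic; positivity

theorem quartic_self (X₀ : Plane) (t₀ : ℝ) : quartic X₀ t₀ X₀ t₀ = 0 := by simp [quartic]

/-- The perturbation is at least `r ^ 4 / 2` off the product of the two balls of radius `r`; in
space this is `(a ^ 2 + b ^ 2) ^ 2 ≤ 2 * (a ^ 4 + b ^ 4)`. -/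
theorem le_quartic {X₀ X : Plane} {t₀ t r : ℝ} (h : r ^ 2 ≤ ‖X - X₀‖ ^ 2 ∨ r ^ 2 ≤ (t - t₀) ^ 2) :
    r ^ 4 / 2 ≤ quartic X₀ t₀ X t := by
  unfold quartic
  rcases h with h | h
  · rw [EuclideanSpace.norm_sq_eq] at h
    simp only [Fin.sum_univ_two, PiLp.sub_apply, Real.norm_eq_abs, sq_abs] at h
    have h1 : (r ^ 2) ^ 2 ≤ ((X 0 - X₀ 0) ^ 2 + (X 1 - X₀ 1) ^ 2) ^ 2 := by gcongr
    have h2 : 0 ≤ (t - t₀) ^ 4 := by positivity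
    nlinarith [sq_nonneg ((X 0 - X₀ 0) ^ 2 - (X 1 - X₀ 1) ^ 2)]
  · have h1 : (r ^ 2) ^ 2 ≤ ((t - t₀) ^ 2) ^ 2 := by gcongr
    have h2 : 0 ≤ (X 0 - X₀ 0) ^ 4 := by positivity
    have h3 : 0 ≤ (X 1 - X₀ 1) ^ 4 := by positivity
    nlinarith [sq_nonneg (r ^ 2)]

theorem fderiv_quartic (X₀ : Plane) (t₀ : ℝ) :
    fderiv ℝ (fun p : Plane × ℝ => quartic X₀ t₀ p.1 p.2) (X₀, t₀) = 0 := by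
  apply IsLocalMin.fderiv_eq_zero
  refine Eventually.of_forall fun p => ?_
  simpa only [quartic_self] using quartic_nonneg X₀ t₀ p.1 p.2

theorem iteratedFDeriv_quartic (X₀ : Plane) (t₀ : ℝ) (v : Plane × ℝ) :
    iteratedFDeriv ℝ 2 (fun p : Plane × ℝ => quartic X₀ t₀ p.1 p.2) (X₀, t₀) ![v, v] = 0 := by
  rw [← deriv_deriv_comp_line (contDiff_quartic X₀ t₀)]
  have h1 : (fun s : ℝ => quartic X₀ t₀ ((X₀, t₀) + s • v).1 ((X₀, t₀) + s • v).2) =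
      fun s => (v.1 0 ^ 4 + v.1 1 ^ 4 + v.2 ^ 4) * s ^ 4 := by
    ext s
    simp only [quartic, Prod.fst_add, Prod.snd_add, Prod.smul_fst, Prod.smul_snd, PiLp.add_apply,
      PiLp.smul_apply, smul_eq_mul]
    ring
  rw [h1]
  have h2 : (deriv fun s : ℝ => (v.1 0 ^ 4 + v.1 1 ^ 4 + v.2 ^ 4) * s ^ 4) =
      fun s => (v.1 0 ^ 4 + v.1 1 ^ 4 + v.2 ^ 4) * (4 * s ^ 3) := by
    ext s
    simp
  rw [h2]
  simp

/-! ### Duhamel's formula gives viscosity solutions -/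

/-- Data for which Duhamel's formula is used: bounded, jointly continuous, and Lipschitz continuous
in space locally uniformly in time. -/
structure IsDuhamelData (g : ℝ → ℝ) (G : ℝ → ℝ → ℝ) (M : ℝ) : Prop where
  cont_init : Continuous g
  bound_init : ∀ w, |g w| ≤ M
  cont : Continuous fun p : ℝ × ℝ => G p.1 p.2
  bound : ∀ w s, |G w s| ≤ M
  lipschitz : ∀ T, ∃ L, 0 ≤ L ∧ (∀ w w', |g w - g w'| ≤ L * |w - w'|) ∧
    ∀ s ∈ Icc 0 T, ∀ w w', |G w s - G w' s| ≤ L * |w - w'|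

section Viscosity

variable {g : ℝ → ℝ} {G : ℝ → ℝ → ℝ} {M : ℝ}

theorem IsDuhamelData.neg (h : IsDuhamelData g G M) :
    IsDuhamelData (fun w => -g w) (fun w s => -G w s) M where
  cont_init := h.cont_init.neg
  bound_init w := by rw [abs_neg]; exact h.bound_init w
  cont := h.cont.neg
  bound w s := by rw [abs_neg]; exact h.bound w s
  lipschitz T := by
    obtain ⟨L, hL, h1, h2⟩ := h.lipschitz T
    refine ⟨L, hL, fun w w' => ?_, fun s hs w w' => ?_⟩
    · rw [← neg_sub', abs_neg]; exact h1 w w'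
    · rw [← neg_sub', abs_neg]; exact h2 s hs w w'

theorem duhamel_neg (g : ℝ → ℝ) (G : ℝ → ℝ → ℝ) (x y t : ℝ) :
    duhamel (fun w => -g w) (fun w s => -G w s) x y t = -duhamel g G x y t := by
  unfold duhamel poissonAvg
  simp only [mul_neg, integral_neg, intervalIntegral.integral_neg]
  ring

theorem IsDuhamelData.continuous_duhamel (h : IsDuhamelData g G M) (δ : ℝ) :
    Continuous fun p : Plane × ℝ => duhamel g G (p.1 0) (p.1 1 + δ) p.2 :=
  (FKPN.continuous_duhamel h.cont_init h.bound_init h.cont h.bound).comp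
    (by fun_prop : Continuous fun p : Plane × ℝ => (p.1 0, p.1 1 + δ, p.2))

theorem IsDuhamelData.laplacian_nonneg (h : IsDuhamelData g G M) {δ t : ℝ} (ht : 0 ≤ t)
    {X : Plane} (hX : 0 < X 1 + δ) {ψ : Plane → ℝ} (hψ : ContDiff ℝ 2 ψ)
    (hmax : IsLocalMax (fun Y => duhamel g G (Y 0) (Y 1 + δ) t - ψ Y) X) :
    0 ≤ Laplacian.laplacian ψ X := by
  refine laplacian_nonneg_of_isLocalMax (f := fun Y => duhamel g G (Y 0) (Y 1 + δ) t) hψ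
    (C := 8 / (X 1 + δ) ^ 4 * M * (1 + t)) ?_ hmax
  filter_upwards [Ioo_mem_nhdsGT (half_pos hX)] with s hs
  have h1 := abs_discrete_laplacian_duhamel_le h.cont_init h.bound_init h.cont h.bound (x := X 0)
    (ε := s) hX ht (by rw [abs_of_pos hs.1]; exact hs.2.le)
  have h2 := (abs_le.1 h1).1
  have e1 : X 1 + s + δ = X 1 + δ + s := by ring
  have e2 : X 1 + -s + δ = X 1 + δ - s := by ring
  have e3 : X 0 + -s = X 0 - s := by ring
  have e4 : 8 / (X 1 + δ) ^ 4 * M * (1 + t) * s ^ 4 = 8 * s ^ 4 / (X 1 + δ) ^ 4 * M * (1 + t) := by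
    ring
  simp [e1, e2, e3]
  rw [e4]
  linarith

theorem isLocalMax_slice_of_isLocalMaxOn {f : Plane × ℝ → ℝ} {X : Plane} {t : ℝ} (hX : 0 < X 1)
    (ht : 0 < t) (h : IsLocalMaxOn f (OmegaBar ×ˢ Ioi 0) (X, t)) :
    IsLocalMax (fun Y => f (Y, t)) X := by
  have hnhds : OmegaBar ×ˢ Ioi (0 : ℝ) ∈ 𝓝 (X, t) := by
    refine prod_mem_nhds ?_ (Ioi_mem_nhds ht)
    have : Continuous fun Y : Plane => Y 1 := by fun_prop
    filter_upwards [this.continuousAt.eventually (lt_mem_nhds hX)] with Y hY using hY.le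
  have h1 : IsLocalMax f (X, t) := h.isLocalMax hnhds
  have h2 : Tendsto (fun Y : Plane => (Y, t)) (𝓝 X) (𝓝 (X, t)) :=
    (by fun_prop : Continuous fun Y : Plane => (Y, t)).tendsto X
  exact h2.eventually h1

theorem IsDuhamelData.interior_test (h : IsDuhamelData g G M) {X : Plane} (hX : 0 < X 1) {t : ℝ}
    (ht : 0 < t) {φ : Plane → ℝ → ℝ} (hφ : ContDiff ℝ 2 fun p : Plane × ℝ => φ p.1 p.2)
    (hmax : IsLocalMaxOn (fun p : Plane × ℝ => duhamel g G (p.1 0) (p.1 1) p.2 - φ p.1 p.2)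
      (OmegaBar ×ˢ Ioi 0) (X, t)) : 0 ≤ spaceLaplacian φ X t := by
  refine h.laplacian_nonneg (δ := 0) ht.le (by linarith) (contDiff_space_slice hφ t) ?_
  simpa using isLocalMax_slice_of_isLocalMaxOn hX ht hmax

theorem deriv_nonpos_of_eventually_le {f : ℝ → ℝ} {d : ℝ} (hf : HasDerivAt f d 0)
    (hmax : ∀ᶠ s in 𝓝[>] (0 : ℝ), f s ≤ f 0) : d ≤ 0 := by
  have h1 := (hasDerivWithinAt_iff_tendsto_slope' (s := Ioi 0) (by simp)).1
    hf.hasDerivWithinAt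
  refine le_of_tendsto h1 ?_
  filter_upwards [hmax, self_mem_nhdsWithin] with s hs hs0
  have hs0' : 0 < s := hs0
  rw [slope_def_field, sub_zero]
  exact div_nonpos_of_nonpos_of_nonneg (by linarith) hs0'.le

/-- Stability under the shift by `δ`. If both inequalities failed strictly at `(X₀, t₀)`, they would
fail in a neighbourhood, and the shifted function, for which the equations hold classically up to
the boundary, would have a nearby maximum against the perturbed test function that contradicts one
of them. -/
theorem IsDuhamelData.boundary_test (h : IsDuhamelData g G M) {X₀ : Plane} (hX₀ : X₀ 1 = 0)
    {t₀ : ℝ} (ht₀ : 0 < t₀) {φ : Plane → ℝ → ℝ}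
    (hφ : ContDiff ℝ 2 fun p : Plane × ℝ => φ p.1 p.2)
    (hmax : IsLocalMaxOn (fun p : Plane × ℝ => duhamel g G (p.1 0) (p.1 1) p.2 - φ p.1 p.2)
      (OmegaBar ×ˢ Ioi 0) (X₀, t₀)) :
    0 ≤ spaceLaplacian φ X₀ t₀ ∨ deriv (fun s => φ X₀ s) t₀ - G (X₀ 0) t₀ -
      lineDeriv ℝ (fun Y => φ Y t₀) X₀ (EuclideanSpace.single 1 1) ≤ 0 := by
  by_contra! hcon
  obtain ⟨hlap, hres⟩ := hcon
  set Φ : Plane × ℝ → ℝ := fun p => φ p.1 p.2 with hΦ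
  -- The perturbation makes the maximum strict and leaves the relevant first and second derivatives
  -- at `(X₀, t₀)` unchanged.
  set φ' : Plane → ℝ → ℝ := fun X t => φ X t + quartic X₀ t₀ X t with hφ'
  set Φ' : Plane × ℝ → ℝ := fun p => φ' p.1 p.2 with hΦ'
  have hq := contDiff_quartic X₀ t₀
  have hφ'c : ContDiff ℝ 2 Φ' := hφ.add hq
  set lap : Plane × ℝ → ℝ := fun p => iteratedFDeriv ℝ 2 Φ' p ![(unitX, 0), (unitX, 0)] +
    iteratedFDeriv ℝ 2 Φ' p ![(unitY, 0), (unitY, 0)] with hlapdef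
  set res : Plane × ℝ → ℝ := fun p => fderiv ℝ Φ' p (0, 1) - G (p.1 0) p.2 -
    fderiv ℝ Φ' p (unitY, 0) with hresdef
  have hlapc : Continuous lap := by
    have h1 := hφ'c.continuous_iteratedFDeriv (m := 2) le_rfl
    have h2 : ∀ v : Fin 2 → Plane × ℝ, Continuous fun p => iteratedFDeriv ℝ 2 Φ' p v := fun v =>
      (ContinuousMultilinearMap.apply ℝ (fun _ : Fin 2 => Plane × ℝ) ℝ v).continuous.comp h1
    exact (h2 _).add (h2 _)
  have hresc : Continuous res := by
    have h1 := hφ'c.continuous_fderiv two_ne_zero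
    have h2 : Continuous fun p : Plane × ℝ => G (p.1 0) p.2 :=
      h.cont.comp (by fun_prop : Continuous fun p : Plane × ℝ => (p.1 0, p.2))
    exact ((h1.clm_apply continuous_const).sub h2).sub (h1.clm_apply continuous_const)
  have hlap0 : lap (X₀, t₀) < 0 := by
    have h1 : ∀ v : Plane × ℝ, iteratedFDeriv ℝ 2 Φ' (X₀, t₀) ![v, v] =
        iteratedFDeriv ℝ 2 Φ (X₀, t₀) ![v, v] := by
      intro v
      have h2 : Φ' = Φ + fun p : Plane × ℝ => quartic X₀ t₀ p.1 p.2 := rfl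
      rw [h2, iteratedFDeriv_add_apply (i := 2) hφ.contDiffAt hq.contDiffAt]
      rw [add_apply, iteratedFDeriv_quartic, add_zero]
    simp only [hlapdef, h1]
    rw [← spaceLaplacian_eq hφ]
    exact hlap
  have hres0 : 0 < res (X₀, t₀) := by
    have h2 : Φ' = Φ + fun p : Plane × ℝ => quartic X₀ t₀ p.1 p.2 := rfl
    have h1 : fderiv ℝ Φ' (X₀, t₀) = fderiv ℝ Φ (X₀, t₀) := by
      rw [h2, fderiv_add (hφ.differentiable two_ne_zero _) (hq.differentiable two_ne_zero _),
        fderiv_quartic, add_zero]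
    simp only [hresdef, h1]
    rw [← (hasDerivAt_time hφ X₀ t₀).deriv, ← lineDeriv_eq hφ]
    exact hres
  set c : ℝ := res (X₀, t₀) / 2 with hc
  have hc0 : 0 < c := by positivity
  have hev : ∀ᶠ p in 𝓝 (X₀, t₀), lap p < 0 ∧ c < res p ∧ (p ∈ OmegaBar ×ˢ Ioi (0 : ℝ) →
      duhamel g G (p.1 0) (p.1 1) p.2 - φ p.1 p.2 ≤
        duhamel g G (X₀ 0) (X₀ 1) t₀ - φ X₀ t₀) := by
    refine (hlapc.continuousAt.eventually (gt_mem_nhds hlap0)).and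
      ((hresc.continuousAt.eventually (lt_mem_nhds (by rw [hc]; linarith))).and ?_)
    exact eventually_nhdsWithin_iff.1 hmax
  obtain ⟨r₁, hr₁, hball⟩ := Metric.eventually_nhds_iff_ball.1 hev
  set r : ℝ := min (r₁ / 2) (t₀ / 2) with hr
  have hr0 : 0 < r := by positivity
  have hrt : r < t₀ := (min_le_right _ _).trans_lt (by linarith)
  have hrr : r < r₁ := (min_le_left _ _).trans_lt (by linarith)
  set K : Set (Plane × ℝ) := (Metric.closedBall X₀ r ∩ OmegaBar) ×ˢ Metric.closedBall t₀ r with hK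
  have hOc : IsClosed OmegaBar := by
    have : Continuous fun Y : Plane => Y 1 := by fun_prop
    exact isClosed_le continuous_const this
  have hKc : IsCompact K :=
    ((isCompact_closedBall X₀ r).inter_right hOc).prod (isCompact_closedBall t₀ r)
  have hKt : ∀ p ∈ K, 0 < p.2 ∧ p.2 ≤ t₀ + r := by
    intro p hp
    have h1 := hp.2
    rw [Metric.mem_closedBall, Real.dist_eq, abs_le] at h1
    constructor <;> linarith
  have hKb : ∀ p ∈ K, lap p < 0 ∧ c < res p ∧ duhamel g G (p.1 0) (p.1 1) p.2 - φ p.1 p.2 ≤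
      duhamel g G (X₀ 0) (X₀ 1) t₀ - φ X₀ t₀ := by
    intro p hp
    have h1 : p ∈ Metric.ball (X₀, t₀) r₁ := by
      rw [Metric.mem_ball, Prod.dist_eq, max_lt_iff]
      exact ⟨(Metric.mem_closedBall.1 hp.1.1).trans_lt hrr,
        (Metric.mem_closedBall.1 hp.2).trans_lt hrr⟩
    obtain ⟨h2, h3, h4⟩ := hball p h1
    exact ⟨h2, h3, h4 ⟨hp.1.2, (hKt p hp).1⟩⟩
  have hp₀ : (X₀, t₀) ∈ K :=
    ⟨⟨Metric.mem_closedBall_self hr0.le, hX₀.ge⟩, Metric.mem_closedBall_self hr0.le⟩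
  obtain ⟨L, hL0, hgL, hGL⟩ := h.lipschitz (t₀ + r)
  have hM0 : 0 ≤ M := (abs_nonneg _).trans (h.bound_init 0)
  have hmod : Tendsto (poissonModulus M L) (𝓝[>] 0) (𝓝 0) := by
    have := (continuous_poissonModulus hM0 hL0).tendsto 0
    rw [poissonModulus_zero hM0] at this
    exact this.mono_left nhdsWithin_le_nhds
  have hsmall : 0 < min c (r ^ 4 / (8 * (1 + (t₀ + r)))) := by positivity
  -- One bound keeps the error of replacing `G` by its average at height `δ` below the margin `c`;
  -- the other keeps the shift below `r ^ 4 / 8` on `K`.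
  obtain ⟨δ, hδlt, hδ⟩ := ((hmod.eventually (gt_mem_nhds hsmall)).and self_mem_nhdsWithin).exists
  have hδ0 : 0 < δ := hδ
  have hm1 : poissonModulus M L δ < c := hδlt.trans_le (min_le_left _ _)
  have hm2 : poissonModulus M L δ * (1 + (t₀ + r)) ≤ r ^ 4 / 8 := by
    have h1 := hδlt.le.trans (min_le_right _ _)
    calc poissonModulus M L δ * (1 + (t₀ + r)) ≤ r ^ 4 / (8 * (1 + (t₀ + r))) * (1 + (t₀ + r)) := by
          gcongr
      _ = r ^ 4 / 8 := by field_simp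
  have hshift : ∀ p ∈ K, |duhamel g G (p.1 0) (p.1 1 + δ) p.2 - duhamel g G (p.1 0) (p.1 1) p.2| ≤
      r ^ 4 / 8 := by
    intro p hp
    obtain ⟨h1, h2⟩ := hKt p hp
    refine (abs_duhamel_shift_sub_le h.cont_init h.bound_init h.cont h.bound hL0 hgL h1.le
      (fun s hs => hGL s ⟨hs.1, hs.2.trans h2⟩) _ _ _).trans (le_trans ?_ hm2)
    have := poissonModulus_nonneg hM0 hL0 δ
    gcongr
  obtain ⟨⟨X, t⟩, hp, hpmax⟩ := hKc.exists_isMaxOn ⟨_, hp₀⟩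
    ((h.continuous_duhamel δ).sub hφ'c.continuous).continuousOn
  have hpmax' : ∀ Y s, (Y, s) ∈ K → duhamel g G (Y 0) (Y 1 + δ) s - φ' Y s ≤
      duhamel g G (X 0) (X 1 + δ) t - φ' X t := fun Y s hY => hpmax hY
  obtain ⟨htpos, htle⟩ := hKt _ hp
  obtain ⟨hlapp, hresp, hmaxp⟩ := hKb _ hp
  simp only at htpos htle hmaxp
  -- Two shifts, at the maximizer and at `(X₀, t₀)`, cost at most `r ^ 4 / 4`, so the maximizer
  -- stays off the spherical parts of the boundary of `K` and off its first and last times.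
  have hqsmall : quartic X₀ t₀ X t < r ^ 4 / 2 := by
    have h1 := hpmax' X₀ t₀ hp₀
    have h2 := abs_le.1 (hshift _ hp)
    have h3 := abs_le.1 (hshift _ hp₀)
    simp only at h2 h3
    have h4 : φ' X₀ t₀ = φ X₀ t₀ := by simp [hφ', quartic_self]
    have h5 : φ' X t = φ X t + quartic X₀ t₀ X t := rfl
    have h6 : 0 < r ^ 4 := by positivity
    rw [h4, h5] at h1
    linarith [h2.2, h3.1]
  have hXball : X ∈ Metric.ball X₀ r := by
    by_contra hX
    rw [Metric.mem_ball, dist_eq_norm, not_lt] at hX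
    exact absurd (le_quartic (t := t) (t₀ := t₀) (Or.inl (by gcongr : r ^ 2 ≤ ‖X - X₀‖ ^ 2)))
      (not_le.2 hqsmall)
  have htball : t ∈ Metric.ball t₀ r := by
    by_contra hX
    rw [Metric.mem_ball, Real.dist_eq, not_lt] at hX
    have h1 : r ^ 2 ≤ (t - t₀) ^ 2 := by rw [← sq_abs (t - t₀)]; gcongr
    exact absurd (le_quartic (X := X) (X₀ := X₀) (Or.inr h1)) (not_le.2 hqsmall)
  have hXO : 0 ≤ X 1 := hp.1.2
  have hnear : ∀ᶠ Y in 𝓝 X, 0 ≤ Y 1 → (Y, t) ∈ K := by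
    filter_upwards [Metric.isOpen_ball.mem_nhds hXball] with Y hY hY1
    exact ⟨⟨Metric.ball_subset_closedBall hY, hY1⟩, hp.2⟩
  rcases hXO.eq_or_lt with hX1 | hX1
  · -- the maximum is attained on the boundary
    have hdt := hasDerivAt_duhamel_time h.cont_init h.bound_init h.cont h.bound (x := X 0) hδ0
      htpos.le
    have hdφ := hasDerivAt_time hφ'c X t
    have hloc : IsLocalMax (fun s => duhamel g G (X 0) δ s - φ' X s) t := by
      filter_upwards [Metric.isOpen_ball.mem_nhds htball] with s hs
      have := hpmax' X s ⟨hp.1, Metric.ball_subset_closedBall hs⟩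
      rwa [← hX1, zero_add] at this
    have e1 := hloc.hasDerivAt_eq_zero (hdt.sub hdφ)
    have hdy := hasDerivAt_duhamel_normal h.cont_init h.bound_init h.cont h.bound (x := X 0) hδ0
      htpos.le
    have hdy' := hasDerivAt_line hφ'c X unitY t
    -- On the flat boundary only upward directions are admissible, so maximality gives an inequality
    -- for the normal derivative, with the sign that is needed.
    have e2 := deriv_nonpos_of_eventually_le (hdy.sub hdy') (by
      have hcont : Continuous fun s : ℝ => X + s • unitY := by fun_prop
      have htend : Tendsto (fun s : ℝ => X + s • unitY) (𝓝[>] 0) (𝓝 X) := by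
        simpa using (hcont.tendsto 0).mono_left nhdsWithin_le_nhds
      filter_upwards [htend.eventually hnear, self_mem_nhdsWithin] with s hs hs0
      have hs0' : 0 < s := hs0
      have h1 := hpmax' (X + s • unitY) t (hs (by simp [← hX1, hs0'.le]))
      simp [← hX1] at h1
      simp
      rw [add_comm δ s]
      linarith)
    -- The equation for the shifted function gives `φ'_t - ∂φ'/∂y ≤ P_δ G ≤ G + poissonModulus M L δ
    -- < G + c`, against the margin for `res`.
    have h1 := abs_poissonAvg_add_sub_le (h := fun w => G w t)
      (h.cont.comp (continuous_id.prodMk (continuous_const (y := t)))) (fun w => h.bound w t) hL0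
      (hGL t ⟨htpos.le, htle⟩) 0 δ (X 0)
    rw [zero_add, poissonAvg_zero] at h1
    have h2 := (abs_le.1 h1).2
    have h3 : c < fderiv ℝ (fun p : Plane × ℝ => φ' p.1 p.2) (X, t) (0, 1) - G (X 0) t -
        fderiv ℝ (fun p : Plane × ℝ => φ' p.1 p.2) (X, t) (unitY, 0) := hresp
    linarith
  · -- the maximum is attained in the interior
    have hnn : 0 ≤ Laplacian.laplacian (fun Y => φ' Y t) X := by
      refine h.laplacian_nonneg (δ := δ) htpos.le (by linarith) (contDiff_space_slice hφ'c t) ?_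
      have hcont : Continuous fun Y : Plane => Y 1 := by fun_prop
      filter_upwards [hnear, hcont.continuousAt.eventually (lt_mem_nhds hX1)] with Y h1 h2
      exact hpmax' Y t (h1 h2.le)
    have h1 := spaceLaplacian_eq hφ'c X t
    rw [spaceLaplacian] at h1
    rw [h1] at hnn
    exact absurd hnn (not_le.2 hlapp)

/-- Duhamel's formula solves the Peierls-Nabarro system when the forcing is the nonlinearity
evaluated at the solution. -/
theorem IsDuhamelData.isPNSolution (h : IsDuhamelData g G M) {ε₂ : ℝ} {σ W : ℝ → ℝ}
    {u₀ : Plane → ℝ} (hg : ∀ X : Plane, X 1 = 0 → g (X 0) = u₀ X)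
    (hG : ∀ x t, 0 ≤ t → G x t = 2 * ε₂ * σ (ε₂ * x) - deriv W (duhamel g G x 0 t)) :
    IsPNSolution ε₂ σ W u₀ fun X t => duhamel g G (X 0) (X 1) t := by
  have hcont : Continuous fun p : Plane × ℝ => duhamel g G (p.1 0) (p.1 1) p.2 := by
    simpa using h.continuous_duhamel 0
  have hstart : ∀ X : Plane, X 1 = 0 → duhamel g G (X 0) (X 1) 0 = u₀ X := by
    intro X hX
    simp [duhamel, hX, poissonAvg_zero, hg X hX]
  have hneg : ∀ (φ : Plane → ℝ → ℝ) (X : Plane) (t : ℝ),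
      spaceLaplacian (fun Y s => -φ Y s) X t = -spaceLaplacian φ X t := fun φ X t => by
    unfold spaceLaplacian
    exact congrFun (InnerProductSpace.laplacian_neg (f := fun Y => φ Y t)) X
  -- Duhamel's formula is linear in its data, so the supersolution tests are the subsolution tests
  -- for the negated data and test function.
  have hnegmax : ∀ (φ : Plane → ℝ → ℝ) (p : Plane × ℝ),
      IsLocalMinOn (fun p : Plane × ℝ => duhamel g G (p.1 0) (p.1 1) p.2 - φ p.1 p.2)
        (OmegaBar ×ˢ Ioi 0) p →
      IsLocalMaxOn (fun p : Plane × ℝ => duhamel (fun w => -g w) (fun w s => -G w s) (p.1 0) (p.1 1)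
        p.2 - -φ p.1 p.2) (OmegaBar ×ˢ Ioi 0) p := by
    intro φ p hp
    simp only [duhamel_neg]
    filter_upwards [hp] with q hq
    linarith
  refine ⟨⟨hcont.upperSemicontinuous.upperSemicontinuousOn _, ?_, ?_, fun X hX => (hstart X hX).le⟩,
    ⟨hcont.lowerSemicontinuous.lowerSemicontinuousOn _, ?_, ?_, fun X hX => (hstart X hX).ge⟩, ?_⟩
  · intro X hX t ht φ hφ hmax
    exact neg_nonpos.2 (h.interior_test hX ht hφ hmax)
  · intro X hX t ht φ hφ hmax
    rw [min_le_iff]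
    rcases h.boundary_test hX ht hφ hmax with h1 | h1
    · exact Or.inl (neg_nonpos.2 h1)
    · right
      rw [hG _ _ ht.le] at h1
      unfold boundaryResidual
      rw [hX]
      linarith
  · intro X hX t ht φ hφ hmin
    have := h.neg.interior_test (φ := fun Y s => -φ Y s) hX ht hφ.neg (hnegmax φ _ hmin)
    rwa [hneg] at this
  · intro X hX t ht φ hφ hmin
    rw [le_max_iff]
    rcases h.neg.boundary_test (φ := fun Y s => -φ Y s) hX ht hφ.neg (hnegmax φ _ hmin) with h1 | h1
    · left
      rwa [hneg] at h1
    · right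
      have h2 : lineDeriv ℝ (fun Y => -φ Y t) X (EuclideanSpace.single 1 1) =
          -lineDeriv ℝ (fun Y => φ Y t) X (EuclideanSpace.single 1 1) := by
        simp only [lineDeriv]
        exact deriv.fun_neg
      rw [h2, deriv.fun_neg, hG _ _ ht.le] at h1
      unfold boundaryResidual
      rw [hX]
      linarith
  · intro T
    refine ⟨M + M * T, fun X _ t ht => (abs_duhamel_le h.bound_init h.bound _ _ ht.1).trans ?_⟩
    have hM0 : 0 ≤ M := (abs_nonneg _).trans (h.bound_init 0)
    have := ht.2
    gcongr

end Viscosity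

/-! ### Convergence of the lattice solutions -/

/-- Stability of the lattice system: residuals control the difference of two functions. -/
theorem lattice_stability {ε T K η M : ℝ} (hε : 0 < ε) (hη : 0 < η) (hM : 0 ≤ M)
    (hK : 0 ≤ K) {e : ℤ → ℕ → ℝ → ℝ}
    (hcont : ∀ i j, ContinuousOn (e i j) (Icc 0 T))
    (hbd : ∀ i j, ∀ t ∈ Icc 0 T, |e i j t| ≤ M)
    (hinner : ∀ i j, ∀ t ∈ Icc 0 T, |discreteLaplacian ε e i j t| ≤ η)
    (hbdy : ∀ i, ∀ t ∈ Ioc 0 T, ∃ d, HasDerivAt (e i 0) d t ∧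
      |d - boundaryOperator ε e i t| ≤ K * |e i 0 t| + η)
    (hstart : ∀ i, |e i 0 0| ≤ η) {n : ℕ} (hn : 0 < n)
    {i : ℤ} {j : ℕ} {t : ℝ} (hj : j ≤ n) (ht : t ∈ Icc 0 T) :
    |e i j t| ≤ Real.exp ((K + 1) * t) *
      ((M / (ε * n) + 2 * η * (ε * n) + 2 * η) * (1 + ε * j)) := by
  refine abs_le'.2 ⟨?_, ?_⟩
  · refine lattice_comparison_quantitative hε hη hM hK hcont
      (fun i j t ht => (abs_le.1 (hbd i j t ht)).2) (fun i j t ht => (abs_le.1 (hinner i j t ht)).1)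
      (fun i t ht hpos => ?_) (fun i => (abs_le.1 (hstart i)).2) hn hj ht
    obtain ⟨d, hd, hdle⟩ := hbdy i t ht
    rw [abs_of_pos hpos] at hdle
    exact ⟨d, hd, by linarith [(abs_le.1 hdle).2]⟩
  · refine lattice_comparison_quantitative (e := fun i j t => -e i j t) hε hη hM hK
      (fun i j => (hcont i j).neg) (fun i j t ht => by linarith [(abs_le.1 (hbd i j t ht)).1])
      (fun i j t ht => ?_) (fun i t ht hpos => ?_) (fun i => by linarith [(abs_le.1 (hstart i)).1])
      hn hj ht
    · have h1 : discreteLaplacian ε (fun i j t => -e i j t) i j t =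
          -discreteLaplacian ε e i j t := by unfold discreteLaplacian; ring
      rw [h1]
      linarith [(abs_le.1 (hinner i j t ht)).2]
    · obtain ⟨d, hd, hdle⟩ := hbdy i t ht
      have h1 : boundaryOperator ε (fun i j t => -e i j t) i t = -boundaryOperator ε e i t := by
        unfold boundaryOperator; ring
      rw [abs_of_neg (by linarith : e i 0 t < 0)] at hdle
      exact ⟨-d, hd.neg, by rw [h1]; linarith [(abs_le.1 hdle).1]⟩

/-- An a priori bound for lattice solutions. -/
theorem IsLatticeSolution.abs_le {ε ε₂ : ℝ} (hε : 0 < ε) {σ Weps : ℝ → ℝ} {u₀ : Plane → ℝ}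
    {u : ℤ → ℕ → ℝ → ℝ} (hu : IsLatticeSolution ε ε₂ σ Weps u₀ u) (hW : Continuous (deriv Weps))
    {M C : ℝ} (hM : ∀ i, |u₀ (latticePoint ε i 0)| ≤ M)
    (hC : ∀ x r, |2 * ε₂ * σ (ε₂ * x) - deriv Weps r| ≤ C) (i : ℤ) (j : ℕ) {t : ℝ} (ht : 0 ≤ t) :
    |u i j t| ≤ M + C * t := by
  obtain ⟨B, hB⟩ := hu.bounded t
  have hsub : Icc 0 t ⊆ Ici 0 := fun s hs => hs.1
  have hM0 : 0 ≤ M := (abs_nonneg _).trans (hM 0)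
  have hC0 : 0 ≤ C := (abs_nonneg _).trans (hC 0 0)
  have hlin : ∀ s : ℝ, HasDerivAt (fun s => M + C * s) C s := fun s => by
    simpa using ((hasDerivAt_id s).const_mul C).const_add M
  refine abs_le'.2 ⟨?_, ?_⟩
  -- `M + C * s` is constant in space, hence unaffected by both lattice operators, and grows at
  -- least as fast as the force; no Lipschitz term is needed, hence `K = 0`.
  · have := lattice_comparison (T := t) (K := 0) (M := B) hε le_rfl
      (e := fun i j s => u i j s - (M + C * s))
      (fun i j => ((hu.continuousOn i j).mono hsub).sub (by fun_prop))
      (fun i j s hs => by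
        have := (_root_.abs_le.1 (hB i j s hs)).2
        have := mul_nonneg hC0 hs.1
        linarith)
      (fun i j s hs => by
        have h1 : discreteLaplacian ε (fun i j s => u i j s - (M + C * s)) i j s =
            discreteLaplacian ε u i j s := by unfold discreteLaplacian; ring
        rw [h1, hu.discreteLaplacian_eq_zero i j hs.1])
      (fun i s hs _ => by
        refine ⟨_, (hu.hasDerivAt hW i hs.1).sub (hlin s), ?_⟩
        have h1 : boundaryOperator ε (fun i j s => u i j s - (M + C * s)) i s =
            boundaryOperator ε u i s := by unfold boundaryOperator; ring
        rw [h1, boundaryForce]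
        linarith [(_root_.abs_le.1 (hC (ε * i) (u i 0 s))).2])
      (fun i => by
        have := (_root_.abs_le.1 (hM i)).2
        rw [hu.initial_eq]
        linarith) (i := i) (j := j) (t := t) ⟨ht, le_rfl⟩
    linarith
  · have := lattice_comparison (T := t) (K := 0) (M := B) hε le_rfl
      (e := fun i j s => -u i j s - (M + C * s))
      (fun i j => ((hu.continuousOn i j).mono hsub).neg.sub (by fun_prop))
      (fun i j s hs => by
        have := (_root_.abs_le.1 (hB i j s hs)).1
        have := mul_nonneg hC0 hs.1
        linarith)
      (fun i j s hs => by
        have h1 : discreteLaplacian ε (fun i j s => -u i j s - (M + C * s)) i j s =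
            -discreteLaplacian ε u i j s := by unfold discreteLaplacian; ring
        rw [h1, hu.discreteLaplacian_eq_zero i j hs.1, neg_zero])
      (fun i s hs _ => by
        refine ⟨_, (hu.hasDerivAt hW i hs.1).neg.sub (hlin s), ?_⟩
        have h1 : boundaryOperator ε (fun i j s => -u i j s - (M + C * s)) i s =
            -boundaryOperator ε u i s := by unfold boundaryOperator; ring
        rw [h1, boundaryForce]
        linarith [(_root_.abs_le.1 (hC (ε * i) (u i 0 s))).1])
      (fun i => by
        have := (_root_.abs_le.1 (hM i)).1
        rw [hu.initial_eq]
        linarith) (i := i) (j := j) (t := t) ⟨ht, le_rfl⟩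
    linarith

section Convergence

variable {g : ℝ → ℝ} {G : ℝ → ℝ → ℝ} {M : ℝ}

/-- Consistency in the interior. The shift by `δ` keeps every lattice point at height at least `δ ≥
2 * ε`, so the constants do not degenerate near the boundary. -/
theorem IsDuhamelData.abs_discreteLaplacian_le (h : IsDuhamelData g G M) {ε δ t : ℝ} (hε : 0 < ε)
    (hδ : 0 < δ) (hεδ : ε ≤ δ / 2) (ht : 0 ≤ t) (i : ℤ) (j : ℕ) :
    |discreteLaplacian ε (fun i j s => duhamel g G (ε * i) (ε * j + δ) s) i j t| ≤
      8 * ε ^ 2 / δ ^ 4 * M * (1 + t) := by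
  have hM0 : 0 ≤ M := (abs_nonneg _).trans (h.bound_init 0)
  have hy : δ ≤ ε * (j + 1 : ℕ) + δ := by
    have : 0 ≤ ε * ((j + 1 : ℕ) : ℝ) := by positivity
    linarith
  have h1 := abs_discrete_laplacian_duhamel_le h.cont_init h.bound_init h.cont h.bound
    (x := ε * i) (ε := ε) (hδ.trans_le hy) ht (by rw [abs_of_pos hε]; linarith)
  have e1 : ε * ((i + 1 : ℤ) : ℝ) = ε * i + ε := by push_cast; ring
  have e2 : ε * ((i - 1 : ℤ) : ℝ) = ε * i - ε := by push_cast; ring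
  have e3 : ε * ((j + 2 : ℕ) : ℝ) + δ = ε * ((j + 1 : ℕ) : ℝ) + δ + ε := by push_cast; ring
  have e4 : ε * (j : ℝ) + δ = ε * ((j + 1 : ℕ) : ℝ) + δ - ε := by push_cast; ring
  unfold discreteLaplacian
  simp only [e1, e2, e3, e4]
  rw [abs_mul, abs_of_pos (by positivity : 0 < 1 / ε ^ 2)]
  calc _ ≤ 1 / ε ^ 2 * (8 * ε ^ 4 / (ε * (j + 1 : ℕ) + δ) ^ 4 * M * (1 + t)) := by
        gcongr
        refine le_of_eq_of_le ?_ h1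
        congr 1
        ring
    _ ≤ 1 / ε ^ 2 * (8 * ε ^ 4 / δ ^ 4 * M * (1 + t)) := by gcongr
    _ = _ := by field_simp

/-- The tangential differences carry only a factor `1 / ε` and are therefore `O(ε)`; the upward
difference converges to the normal derivative. -/
theorem IsDuhamelData.abs_boundaryOperator_sub_le (h : IsDuhamelData g G M) {ε δ t : ℝ}
    (hε : 0 < ε) (hδ : 0 < δ) (hεδ : ε ≤ δ / 2) (ht : 0 ≤ t) (i : ℤ) :
    |boundaryOperator ε (fun i j s => duhamel g G (ε * i) (ε * j + δ) s) i t -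
      duhamelDeriv g G (ε * i) δ t| ≤ 6 * ε / δ ^ 2 * M * (1 + t) := by
  have h1 := abs_second_difference_duhamel_le h.cont_init h.bound_init h.cont h.bound
    (x := ε * i) (ε := ε) hδ ht (by rw [abs_of_pos hε]; linarith)
  have h2 := abs_taylor_duhamel_le h.cont_init h.bound_init h.cont h.bound
    (x := ε * i) (ε := ε) hδ ht (by rw [abs_of_pos hε]; linarith)
  have e1 : ε * ((i + 1 : ℤ) : ℝ) = ε * i + ε := by push_cast; ring
  have e2 : ε * ((i - 1 : ℤ) : ℝ) = ε * i - ε := by push_cast; ring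
  have e3 : ε * ((1 : ℕ) : ℝ) + δ = δ + ε := by push_cast; ring
  have e4 : ε * ((0 : ℕ) : ℝ) + δ = δ := by push_cast; ring
  unfold boundaryOperator
  simp only [e1, e2, e3, e4]
  set a := duhamel g G (ε * i + ε) δ t
  set b := duhamel g G (ε * i - ε) δ t
  set c := duhamel g G (ε * i) δ t
  set d := duhamel g G (ε * i) (δ + ε) t
  set D := duhamelDeriv g G (ε * i) δ t
  have h3 : 1 / ε * (a - c + (b - c) + (d - c)) - D =
      1 / ε * ((a + b - 2 * c) + (d - c - ε * D)) := by
    field_simp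
    ring
  rw [h3, abs_mul, abs_of_pos (by positivity : 0 < 1 / ε)]
  calc 1 / ε * |(a + b - 2 * c) + (d - c - ε * D)|
      ≤ 1 / ε * (4 * ε ^ 2 / δ ^ 2 * M * (1 + t) + 2 * ε ^ 2 / δ ^ 2 * M * (1 + t)) := by
        gcongr
        exact (abs_add_le _ _).trans (add_le_add h1 h2)
    _ = _ := by field_simp; ring

theorem latticePoint_zero (ε : ℝ) (i : ℤ) (j : ℕ) : latticePoint ε i j 0 = ε * i := rfl

theorem latticePoint_one (ε : ℝ) (i : ℤ) (j : ℕ) : latticePoint ε i j 1 = ε * j := rfl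

/-- The error estimate for a fixed mesh size and a fixed shift `δ` of the limit. -/
theorem IsDuhamelData.abs_sub_le (h : IsDuhamelData g G M) {ε₂ : ℝ} {σ W : ℝ → ℝ}
    {u₀ : Plane → ℝ} (hg : ∀ X : Plane, X 1 = 0 → g (X 0) = u₀ X)
    (hG : ∀ x t, 0 ≤ t → G x t = 2 * ε₂ * σ (ε₂ * x) - deriv W (duhamel g G x 0 t))
    {K : ℝ} (hK : 0 ≤ K) (hWK : ∀ a b, |deriv W a - deriv W b| ≤ K * |a - b|)
    {ε : ℝ} (hε : 0 < ε) {Weps : ℝ → ℝ} (hWc : Continuous (deriv Weps)) {u : ℤ → ℕ → ℝ → ℝ}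
    (hu : IsLatticeSolution ε ε₂ σ Weps u₀ u) {T C L κ δ η : ℝ} (hT : 0 ≤ T)
    (hC : ∀ x r, |2 * ε₂ * σ (ε₂ * x) - deriv Weps r| ≤ C)
    (hκ : ∀ a, |deriv W a - deriv Weps a| ≤ κ) (hL : 0 ≤ L)
    (hgL : ∀ w w', |g w - g w'| ≤ L * |w - w'|)
    (hGL : ∀ s ∈ Icc 0 T, ∀ w w', |G w s - G w' s| ≤ L * |w - w'|)
    (hδ : 0 < δ) (hεδ : ε ≤ δ / 2) (hη : 0 < η)
    (hη₁ : 8 * ε ^ 2 / δ ^ 4 * M * (1 + T) ≤ η)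
    (hη₂ : 6 * ε / δ ^ 2 * M * (1 + T) + poissonModulus M L δ * (1 + K * (1 + T)) + κ ≤ η)
    {n : ℕ} (hn : 0 < n) {i : ℤ} {j : ℕ} {t : ℝ} (hj : j ≤ n) (ht : t ∈ Icc 0 T) :
    |u i j t - duhamel g G (ε * i) (ε * j + δ) t| ≤ Real.exp ((K + 1) * t) *
      (((M + C * T + (M + M * T)) / (ε * n) + 2 * η * (ε * n) + 2 * η) * (1 + ε * j)) := by
  have hM0 : 0 ≤ M := (abs_nonneg _).trans (h.bound_init 0)
  have hC0 : 0 ≤ C := (abs_nonneg _).trans (hC 0 0)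
  have hκ0 : 0 ≤ κ := (abs_nonneg _).trans (hκ 0)
  have hm0 := poissonModulus_nonneg hM0 hL δ
  have hu₀ : ∀ i, u₀ (latticePoint ε i 0) = g (ε * i) := fun i =>
    (hg (latticePoint ε i 0) (by simp [latticePoint_one])).symm
  have hshift : ∀ x y, ∀ s ∈ Icc 0 T, |duhamel g G x (y + δ) s - duhamel g G x y s| ≤
      poissonModulus M L δ * (1 + T) := by
    intro x y s hs
    refine (abs_duhamel_shift_sub_le h.cont_init h.bound_init h.cont h.bound hL hgL hs.1
      (fun r hr => hGL r ⟨hr.1, hr.2.trans hs.2⟩) _ _ _).trans ?_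
    have := hs.2
    gcongr
  have hVc : ∀ x y, Continuous fun s => duhamel g G x y s := fun x y =>
    (FKPN.continuous_duhamel h.cont_init h.bound_init h.cont h.bound).comp
      (by fun_prop : Continuous fun s : ℝ => (x, y, s))
  refine lattice_stability (T := T) (e := fun i j s => u i j s - duhamel g G (ε * i) (ε * j + δ) s)
    hε hη (by positivity) hK (fun i j => ((hu.continuousOn i j).mono fun s hs => hs.1).sub
      (hVc _ _).continuousOn) (fun i j s hs => ?_) (fun i j s hs => ?_) (fun i s hs => ?_)
    (fun i => ?_) hn hj ht
  · have h1 := hu.abs_le hε hWc (M := M) (fun i => by rw [hu₀]; exact h.bound_init _) hC i j hs.1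
    have h2 := abs_duhamel_le h.bound_init h.bound (ε * i) (ε * j + δ) hs.1
    have h3 : C * s ≤ C * T := mul_le_mul_of_nonneg_left hs.2 hC0
    have h4 : M * s ≤ M * T := mul_le_mul_of_nonneg_left hs.2 hM0
    exact (abs_sub _ _).trans (by linarith)
  · have h1 := h.abs_discreteLaplacian_le hε hδ hεδ hs.1 i j
    have h2 : discreteLaplacian ε (fun i j s => u i j s - duhamel g G (ε * i) (ε * j + δ) s) i j s =
        discreteLaplacian ε u i j s -
          discreteLaplacian ε (fun i j s => duhamel g G (ε * i) (ε * j + δ) s) i j s := by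
      unfold discreteLaplacian; ring
    rw [h2, hu.discreteLaplacian_eq_zero i j hs.1, zero_sub, abs_neg]
    refine h1.trans (le_trans ?_ hη₁)
    have := hs.2
    gcongr
  · have hs' : s ∈ Icc 0 T := ⟨hs.1.le, hs.2⟩
    have e0 : ε * ((0 : ℕ) : ℝ) + δ = δ := by push_cast; ring
    have hd := hasDerivAt_duhamel_time h.cont_init h.bound_init h.cont h.bound (x := ε * i) hδ
      hs.1.le
    simp only [e0]
    refine ⟨_, (hu.hasDerivAt hWc i hs.1).sub hd, ?_⟩
    have h1 := h.abs_boundaryOperator_sub_le hε hδ hεδ hs.1.le i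
    have h1' : 6 * ε / δ ^ 2 * M * (1 + s) ≤ 6 * ε / δ ^ 2 * M * (1 + T) := by
      have := hs.2
      gcongr
    have h2 : boundaryOperator ε (fun i j s => u i j s - duhamel g G (ε * i) (ε * j + δ) s) i s =
        boundaryOperator ε u i s -
          boundaryOperator ε (fun i j s => duhamel g G (ε * i) (ε * j + δ) s) i s := by
      unfold boundaryOperator; ring
    have h3 := abs_poissonAvg_add_sub_le (h := fun w => G w s)
      (h.cont.comp (continuous_id.prodMk (continuous_const (y := s)))) (fun w => h.bound w s) hL
      (hGL s hs') 0 δ (ε * i)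
    rw [zero_add, poissonAvg_zero, hG _ _ hs.1.le] at h3
    have h4 := hshift (ε * i) 0 s hs'
    rw [zero_add] at h4
    have h5 := hWK (duhamel g G (ε * i) 0 s) (duhamel g G (ε * i) δ s)
    rw [abs_sub_comm (duhamel g G (ε * i) 0 s)] at h5
    have h5' := h5.trans (mul_le_mul_of_nonneg_left h4 hK)
    have h6 := hWK (duhamel g G (ε * i) δ s) (u i 0 s)
    rw [abs_sub_comm (duhamel g G (ε * i) δ s)] at h6
    have h7 := hκ (u i 0 s)
    -- The residual splits into the consistency error, `G` minus its average at height `δ`, the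
    -- effect of the shift on `W'`, the difference of the two potentials, and `W'` at the two
    -- functions compared. The last is bounded by `K * |e|`, the others by `η`.
    rw [h2, boundaryForce]
    rw [_root_.abs_le] at h1 h3 h5' h6 h7 ⊢
    constructor <;> nlinarith
  · have h1 := abs_poissonAvg_add_sub_le h.cont_init h.bound_init hL hgL 0 δ (ε * i)
    have h2 : duhamel g G (ε * i) (ε * ((0 : ℕ) : ℝ) + δ) 0 = poissonAvg (0 + δ) g (ε * i) := by
      simp [duhamel]
    simp only [h2]
    rw [hu.initial_eq, hu₀, abs_sub_comm]
    rw [poissonAvg_zero] at h1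
    refine h1.trans (le_trans ?_ hη₂)
    have h3 : 0 ≤ poissonModulus M L δ * (K * (1 + T)) := by positivity
    have h4 : 0 ≤ 6 * ε / δ ^ 2 * M * (1 + T) := by positivity
    linarith

theorem IsDuhamelData.latticeTendstoLocallyUniformly (h : IsDuhamelData g G M) {ε₂ : ℝ}
    {σ W : ℝ → ℝ} {u₀ : Plane → ℝ} (hg : ∀ X : Plane, X 1 = 0 → g (X 0) = u₀ X)
    (hG : ∀ x t, 0 ≤ t → G x t = 2 * ε₂ * σ (ε₂ * x) - deriv W (duhamel g G x 0 t))
    {K C : ℝ} (hK : 0 ≤ K) (hWK : ∀ a b, |deriv W a - deriv W b| ≤ K * |a - b|)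
    (hC : ∀ x r, |2 * ε₂ * σ (ε₂ * x) - deriv W r| ≤ C)
    {Weps : ℝ → ℝ → ℝ} (hWc : ∀ᶠ ε in 𝓝[>] (0 : ℝ), Continuous (deriv (Weps ε)))
    (hW : TendstoUniformly (fun ε => deriv (Weps ε)) (deriv W) (𝓝[>] 0))
    {ueps : ℝ → ℤ → ℕ → ℝ → ℝ}
    (hu : ∀ᶠ ε in 𝓝[>] (0 : ℝ), IsLatticeSolution ε ε₂ σ (Weps ε) u₀ (ueps ε)) :
    LatticeTendstoLocallyUniformly ueps fun X t => duhamel g G (X 0) (X 1) t := by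
  intro R θ hθ
  have hM0 : 0 ≤ M := (abs_nonneg _).trans (h.bound_init 0)
  have hC0 : 0 ≤ C := (abs_nonneg _).trans (hC 0 0)
  set T : ℝ := |R| with hT
  have hT0 : 0 ≤ T := abs_nonneg R
  obtain ⟨L, hL, hgL, hGL⟩ := h.lipschitz T
  set E : ℝ := Real.exp ((K + 1) * T) * (1 + T) with hE
  have hE0 : 0 < E := by positivity
  set B : ℝ := M + (C + 1) * T + (M + M * T) with hB
  have hB0 : 0 ≤ B := by positivity
  -- The height of the strip is fixed first: it must cover the window of radius `T` and make the
  -- contribution `B / Y` of the a priori bounds small.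
  set Y : ℝ := max (max T 1) (4 * E * B / θ) with hY
  have hY1 : 1 ≤ Y := (le_max_right _ _).trans (le_max_left _ _)
  have hYT : T ≤ Y := (le_max_left _ _).trans (le_max_left _ _)
  have hYB : E * (B / Y) ≤ θ / 4 := by
    have h1 : 4 * E * B / θ ≤ Y := le_max_right _ _
    rw [div_le_iff₀ hθ] at h1
    rw [← mul_div_assoc, div_le_iff₀ (by linarith)]
    linarith
  -- The admissible residual depends on `Y`; `Y + 1` allows for rounding the height up to a multiple
  -- of `ε ≤ 1`.
  set η : ℝ := θ / (4 * E * (2 * (Y + 1) + 2)) with hη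
  have hη0 : 0 < η := by positivity
  have hηE : E * (2 * η * (Y + 1) + 2 * η) = θ / 4 := by
    rw [hη]
    field_simp
  set A : ℝ := 1 + K * (1 + T) + (1 + T) with hA
  have hA0 : 0 < A := by positivity
  have hmod : Tendsto (poissonModulus M L) (𝓝[>] 0) (𝓝 0) := by
    have := (continuous_poissonModulus hM0 hL).tendsto 0
    rw [poissonModulus_zero hM0] at this
    exact this.mono_left nhdsWithin_le_nhds
  -- The shift is chosen next, before `ε`, because the consistency errors contain negative powers of
  -- `δ`. Its modulus has to be small both as a residual and as the final error of removing the
  -- shift.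
  obtain ⟨δ, hδm, hδ⟩ := ((hmod.eventually (gt_mem_nhds
    (show 0 < min (η / 3 / A) (θ / 4 / A) by positivity))).and self_mem_nhdsWithin).exists
  have hδ0 : 0 < δ := hδ
  have hm0 := poissonModulus_nonneg hM0 hL δ
  have hm1 : poissonModulus M L δ * (1 + K * (1 + T)) ≤ η / 3 := by
    have h1 := hδm.le.trans (min_le_left _ _)
    rw [le_div_iff₀ hA0] at h1
    refine le_trans ?_ h1
    gcongr
    rw [hA]; linarith
  have hm2 : poissonModulus M L δ * (1 + T) ≤ θ / 4 := by
    have h1 := hδm.le.trans (min_le_right _ _)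
    rw [le_div_iff₀ hA0] at h1
    refine le_trans ?_ h1
    gcongr
    rw [hA]
    have : 0 ≤ K * (1 + T) := by positivity
    linarith
  have hsmall : ∀ f : ℝ → ℝ, Continuous f → f 0 = 0 → ∀ c > 0, ∀ᶠ ε in 𝓝[>] (0 : ℝ), f ε ≤ c := by
    intro f hf hf0 c hc
    have := (hf.tendsto 0).mono_left (nhdsWithin_le_nhds (s := Ioi 0))
    rw [hf0] at this
    filter_upwards [this.eventually (gt_mem_nhds hc)] with ε hε using hε.le
  have hWunif : ∀ c > 0, ∀ᶠ ε in 𝓝[>] (0 : ℝ), ∀ a, |deriv W a - deriv (Weps ε) a| ≤ c := by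
    intro c hc
    filter_upwards [Metric.tendstoUniformly_iff.1 hW c hc] with ε hε a
    exact (hε a).le
  filter_upwards [hWc, hu, hWunif 1 one_pos, hWunif (η / 3) (by positivity),
    hsmall (fun ε => 8 * ε ^ 2 / δ ^ 4 * M * (1 + T)) (by fun_prop) (by simp) η hη0,
    hsmall (fun ε => 6 * ε / δ ^ 2 * M * (1 + T)) (by fun_prop) (by simp) (η / 3) (by positivity),
    hsmall (fun ε => ε) continuous_id rfl (δ / 2) (by positivity),
    hsmall (fun ε => ε) continuous_id rfl 1 one_pos, self_mem_nhdsWithin]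
    with ε h1 h2 h3 h4 h5 h6 h7 h8 h9 i j t ht hnorm
  have hε : 0 < ε := h9
  have htT : t ∈ Icc 0 T := ⟨ht.1, ht.2.trans (le_abs_self R)⟩
  have hjR : ε * j ≤ T := by
    have e1 : |latticePoint ε i j 1| ≤ ‖latticePoint ε i j‖ :=
        PiLp.norm_apply_le (latticePoint ε i j) 1
    rw [latticePoint_one] at e1
    exact (le_abs_self _).trans (e1.trans (hnorm.trans (le_abs_self R)))
  set n : ℕ := ⌈Y / ε⌉₊ with hn
  have hn1 : Y ≤ ε * n := by
    have := Nat.le_ceil (Y / ε)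
    rw [div_le_iff₀ hε] at this
    rw [mul_comm]; exact this
  have hn2 : ε * n ≤ Y + 1 := by
    have := Nat.ceil_lt_add_one (a := Y / ε) (by positivity)
    have h' : ε * n ≤ ε * (Y / ε + 1) := mul_le_mul_of_nonneg_left this.le hε.le
    have h'' : ε * (Y / ε + 1) = Y + ε := by field_simp
    linarith
  have hn0 : 0 < n := Nat.ceil_pos.2 (by positivity)
  have hjn : j ≤ n := by
    have : (j : ℝ) ≤ n := le_of_mul_le_mul_left (hjR.trans (hYT.trans hn1)) hε
    exact_mod_cast this
  -- Uniform closeness of the derivatives bounds the force independently of `ε`, although the bound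
  -- from periodicity of `ε * Weps ε` carries `ε⁻¹`.
  have hCε : ∀ x r, |2 * ε₂ * σ (ε₂ * x) - deriv (Weps ε) r| ≤ C + 1 := by
    intro x r
    calc _ ≤ |2 * ε₂ * σ (ε₂ * x) - deriv W r| + |deriv W r - deriv (Weps ε) r| :=
          _root_.abs_sub_le _ _ _
      _ ≤ C + 1 := add_le_add (hC x r) (h3 r)
  have herr := h.abs_sub_le hg hG hK hWK hε h1 h2 hT0 hCε h4 hL hgL hGL hδ0 h7 hη0 h5
    (by linarith) hn0 (i := i) hjn htT
  have hshift := abs_duhamel_shift_sub_le h.cont_init h.bound_init h.cont h.bound hL hgL htT.1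
    (fun s hs => hGL s ⟨hs.1, hs.2.trans htT.2⟩) (ε * i) (ε * j) δ
  have hshift' : poissonModulus M L δ * (1 + t) ≤ θ / 4 := by
    refine le_trans ?_ hm2
    have := htT.2
    gcongr
  have hbig : Real.exp ((K + 1) * t) *
      ((B / (ε * n) + 2 * η * (ε * n) + 2 * η) * (1 + ε * j)) ≤ θ / 4 + θ / 4 := by
    calc _ ≤ Real.exp ((K + 1) * T) * ((B / Y + 2 * η * (Y + 1) + 2 * η) * (1 + T)) := by
          have := htT.2
          gcongr
      _ = E * (B / Y) + E * (2 * η * (Y + 1) + 2 * η) := by rw [hE]; ring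
      _ ≤ θ / 4 + θ / 4 := add_le_add hYB hηE.le
  rw [latticePoint_zero, latticePoint_one]
  calc |ueps ε i j t - duhamel g G (ε * i) (ε * j) t|
      ≤ |ueps ε i j t - duhamel g G (ε * i) (ε * j + δ) t| +
        |duhamel g G (ε * i) (ε * j + δ) t - duhamel g G (ε * i) (ε * j) t| :=
        _root_.abs_sub_le _ _ _
    _ ≤ (θ / 4 + θ / 4) + θ / 4 := add_le_add (herr.trans hbig) (hshift.trans hshift')
    _ ≤ θ := by linarith

end Convergence

/-- The limiting solution, in the form of Duhamel's formula. -/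
theorem exists_isDuhamelData {ε₂ : ℝ} {σ W : ℝ → ℝ} {g : ℝ → ℝ} {Mg Lg C L K : ℝ}
    (hg : ∀ w, |g w| ≤ Mg) (hgL0 : 0 ≤ Lg) (hgL : ∀ w w', |g w - g w'| ≤ Lg * |w - w'|)
    (hσ : Continuous σ) (hWc : Continuous (deriv W))
    (hC : ∀ x r, |2 * ε₂ * σ (ε₂ * x) - deriv W r| ≤ C) (hL0 : 0 ≤ L)
    (hL : ∀ x x', |2 * ε₂ * σ (ε₂ * x) - 2 * ε₂ * σ (ε₂ * x')| ≤ L * |x - x'|) (hK : 0 ≤ K)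
    (hWK : ∀ a b, |deriv W a - deriv W b| ≤ K * |a - b|) :
    ∃ G M, IsDuhamelData g G M ∧
      ∀ x t, 0 ≤ t → G x t = 2 * ε₂ * σ (ε₂ * x) - deriv W (duhamel g G x 0 t) := by
  have hgc : Continuous g := by
    refine (LipschitzWith.of_dist_le_mul (K := Lg.toNNReal) fun x y => ?_).continuous
    rw [Real.coe_toNNReal _ hgL0]
    exact hgL x y
  set F : ℝ → ℝ → ℝ := fun x r => 2 * ε₂ * σ (ε₂ * x) - deriv W r with hF
  have hFc : Continuous fun p : ℝ × ℝ => F p.1 p.2 := by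
    simp only [hF]
    exact (continuous_const.mul (hσ.comp (by fun_prop))).sub (hWc.comp continuous_snd)
  have hFK : ∀ w r r', |F w r - F w r'| ≤ K * |r - r'| := by
    intro w r r'
    simp only [hF]
    rw [sub_sub_sub_cancel_left, abs_sub_comm r]
    exact hWK r' r
  have hFL : ∀ w w' r, |F w r - F w' r| ≤ L * |w - w'| := by
    intro w w' r
    simp only [hF]
    rw [sub_sub_sub_cancel_right]
    exact hL w w'
  obtain ⟨b, hbc, hb, l, D, hl, hD, hbL⟩ := exists_mild_solution (M := max Mg C) (L := max Lg L) hK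
    hgc (fun w => (hg w).trans (le_max_left _ _))
    (fun w w' => (hgL w w').trans (by gcongr; exact le_max_left _ _)) hFc
    (fun w r => (hC w r).trans (le_max_right _ _)) hFK
    (fun w w' r => (hFL w w' r).trans (by gcongr; exact le_max_right _ _))
  refine ⟨fun w s => F w (b w s), max Mg C, ⟨hgc, fun w => (hg w).trans (le_max_left _ _),
    hFc.comp (continuous_fst.prodMk hbc), fun w r => (hC w _).trans (le_max_right _ _), ?_⟩, ?_⟩
  · intro T
    -- The forcing is Lipschitz in space directly through the stress and indirectly through the
    -- boundary values, whose Lipschitz constant grows exponentially in time.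
    refine ⟨Lg + (L + K * (D * Real.exp (l * T))), by positivity, fun w w' => ?_,
      fun s hs w w' => ?_⟩
    · refine (hgL w w').trans ?_
      gcongr
      have : 0 ≤ L + K * (D * Real.exp (l * T)) := by positivity
      linarith
    · have hle : D * Real.exp (l * s) * |w - w'| ≤ D * Real.exp (l * T) * |w - w'| := by
        have := hs.2
        gcongr
      calc |F w (b w s) - F w' (b w' s)|
          ≤ |F w (b w s) - F w' (b w s)| + |F w' (b w s) - F w' (b w' s)| := abs_sub_le _ _ _
        _ ≤ L * |w - w'| + K * (D * Real.exp (l * T) * |w - w'|) := by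
            refine add_le_add (hFL _ _ _) ((hFK _ _ _).trans ?_)
            gcongr
            exact (hbL w w' s).trans hle
        _ = (L + K * (D * Real.exp (l * T))) * |w - w'| := by ring
        _ ≤ _ := mul_le_mul_of_nonneg_right (by linarith) (abs_nonneg _)
  · intro x t ht
    rw [← hb x t ht]

/-! ### The trace of the initial datum on the boundary -/

lemma isOpen_omega : IsOpen Omega :=
  isOpen_lt continuous_const (by fun_prop)

/-- A violation of the bound would occupy a nonempty open set, which has positive measure. -/
lemma le_of_ae_le_of_continuousOn {U : Set Plane} (hU : IsOpen U) {f : Plane → ℝ} {C : ℝ}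
    (hf : ContinuousOn f U) (h : ∀ᵐ X ∂volume.restrict U, |f X| ≤ C) {X : Plane} (hX : X ∈ U) :
    |f X| ≤ C := by
  have hV : IsOpen (U ∩ (fun Y => |f Y|) ⁻¹' Ioi C) := hf.abs.isOpen_inter_preimage hU isOpen_Ioi
  have h0 : volume (U ∩ (fun Y => |f Y|) ⁻¹' Ioi C) = 0 := by
    rw [ae_restrict_iff' hU.measurableSet, ae_iff] at h
    refine measure_mono_null ?_ h
    rintro Y ⟨hY, hY'⟩
    exact fun hle => (hle hY).not_gt hY'
  rw [hV.measure_eq_zero_iff volume] at h0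
  by_contra hlt
  exact (h0 ▸ (⟨hX, not_le.1 hlt⟩ : X ∈ U ∩ (fun Y => |f Y|) ⁻¹' Ioi C) : X ∈ (∅ : Set Plane))

lemma MemLinf.exists_ae_bound {f : Plane → ℝ} (hf : MemLinf f) :
    ∃ C, 0 ≤ C ∧ ∀ᵐ X ∂volume.restrict Omega, |f X| ≤ C := by
  refine ⟨(eLpNorm f ⊤ (volume.restrict Omega)).toReal, ENNReal.toReal_nonneg, ?_⟩
  have h := ae_le_eLpNormEssSup (f := f) (μ := volume.restrict Omega)
  filter_upwards [h] with X hX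
  rw [← Real.norm_eq_abs, ← toReal_enorm, eLpNorm_exponent_top]
  refine ENNReal.toReal_mono ?_ hX
  rw [← eLpNorm_exponent_top]
  exact hf.2.ne

lemma continuous_mul_of_tsupport_subset {U : Set Plane} (hU : IsOpen U) {f φ : Plane → ℝ}
    (hf : ContinuousOn f U) (hφ : Continuous φ) (hs : tsupport φ ⊆ U) :
    Continuous fun X => f X * φ X := by
  rw [continuous_iff_continuousAt]
  intro X
  by_cases hX : X ∈ tsupport φ
  · exact (hf.continuousAt (hU.mem_nhds (hs hX))).mul hφ.continuousAt
  · have h0 : (fun X => f X * φ X) =ᶠ[𝓝 X] fun _ => 0 := by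
      filter_upwards [notMem_tsupport_iff_eventuallyEq.1 hX] with Y hY
      simp [hY]
    exact h0.continuousAt

lemma integrable_mul_of_tsupport_subset {U : Set Plane} (hU : IsOpen U) {f φ : Plane → ℝ}
    (hf : ContinuousOn f U) (hφ : Continuous φ) (hc : HasCompactSupport φ) (hs : tsupport φ ⊆ U) :
    Integrable fun X => f X * φ X :=
  (continuous_mul_of_tsupport_subset hU hf hφ hs).integrable_of_hasCompactSupport hc.mul_left

lemma setIntegral_mul_of_tsupport_subset {U : Set Plane} (f : Plane → ℝ) {φ : Plane → ℝ}
    (hs : tsupport φ ⊆ U) : ∫ X in U, f X * φ X = ∫ X, f X * φ X := by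
  refine setIntegral_eq_integral_of_forall_compl_eq_zero fun X hX => ?_
  rw [image_eq_zero_of_notMem_tsupport fun h => hX (hs h), mul_zero]

/-- A classical derivative agrees almost everywhere with the weak one. -/
lemma IsWeakDeriv.ae_eq_fderiv {k : Fin 2} {f g : Plane → ℝ} (h : IsWeakDeriv k f g)
    (hg : MemLinf g) (hf : ContDiffOn ℝ 1 f Omega) :
    ∀ᵐ X ∂volume.restrict Omega, g X = fderiv ℝ f X (EuclideanSpace.single k 1) := by
  set v : Plane := EuclideanSpace.single k 1
  have hD : ContinuousOn (fun X => fderiv ℝ f X v) Omega :=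
    (hf.continuousOn_fderiv_of_isOpen isOpen_omega le_rfl).clm_apply continuousOn_const
  have hgl : LocallyIntegrableOn g Omega := by
    intro X hX
    obtain ⟨r, hr, hball⟩ := Metric.isOpen_iff.1 isOpen_omega X hX
    refine ⟨Metric.ball X r, mem_nhdsWithin_of_mem_nhds (Metric.ball_mem_nhds X hr), ?_⟩
    have hgr : MemLp g ⊤ (volume.restrict (Metric.ball X r)) :=
      hg.mono_measure (Measure.restrict_mono_set _ hball)
    have : IsFiniteMeasure (volume.restrict (Metric.ball X r)) :=
      isFiniteMeasure_restrict.2 (measure_ball_lt_top (μ := volume)).ne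
    exact hgr.integrable le_top
  have hDl : LocallyIntegrableOn (fun X => fderiv ℝ f X v) Omega :=
    hD.locallyIntegrableOn isOpen_omega.measurableSet
  -- Fundamental lemma of the calculus of variations for the difference of the weak and the
  -- classical derivative; integration by parts shows that it annihilates every test function.
  have key := isOpen_omega.ae_eq_zero_of_integral_contDiff_smul_eq_zero (μ := volume)
    (hgl.sub hDl) ?_
  · rw [ae_restrict_iff' isOpen_omega.measurableSet]
    filter_upwards [key] with X hX hXO
    exact sub_eq_zero.1 (hX hXO)
  intro φ hφ hc hs
  have hφd : Differentiable ℝ φ := hφ.differentiable (by simp)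
  have hφ' : Continuous fun X => fderiv ℝ φ X v :=
    (hφ.continuous_fderiv (by simp)).clm_apply continuous_const
  have hc' : HasCompactSupport fun X => fderiv ℝ φ X v := hc.fderiv_apply ℝ v
  have hs' : tsupport (fun X => fderiv ℝ φ X v) ⊆ Omega :=
    (tsupport_fderiv_apply_subset ℝ v).trans hs
  have hgφ : Integrable fun X => g X * φ X := by
    refine (integrableOn_iff_integrable_of_support_subset (s := Omega) fun X hX => ?_).1 ?_
    · exact hs (subset_tsupport φ (right_ne_zero_of_mul hX))
    · have hφ1 : MemLp φ 1 (volume.restrict Omega) :=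
        memLp_one_iff_integrable.2
          (hφ.continuous.integrable_of_hasCompactSupport hc).integrableOn
      exact MemLp.integrable_mul (p := ⊤) (q := 1) hg hφ1
  have hDφ : Integrable fun X => fderiv ℝ f X v * φ X :=
    integrable_mul_of_tsupport_subset isOpen_omega hD hφ.continuous hc hs
  have hparts : ∫ X, f X * fderiv ℝ φ X v = -∫ X, fderiv ℝ f X v * φ X := by
    refine integral_mul_fderiv_eq_neg_fderiv_mul_of_integrable hDφ
      (integrable_mul_of_tsupport_subset isOpen_omega hf.continuousOn hφ' hc' hs')
      (integrable_mul_of_tsupport_subset isOpen_omega hf.continuousOn hφ.continuous hc hs)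
      (fun X hX => ?_) fun X _ => hφd X
    exact (hf.differentiableOn one_ne_zero).differentiableAt (isOpen_omega.mem_nhds (hs hX))
  have hweak := h φ hφ hc hs
  have hl : ∀ X, lineDeriv ℝ φ X (EuclideanSpace.single k 1) = fderiv ℝ φ X v := fun X =>
    (hφd X).lineDeriv_eq_fderiv
  simp only [hl] at hweak
  rw [setIntegral_mul_of_tsupport_subset f hs', setIntegral_mul_of_tsupport_subset g hs] at hweak
  have : ∀ X, φ X • (g - fun X => fderiv ℝ f X v) X = g X * φ X - fderiv ℝ f X v * φ X := by
    intro X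
    simp only [Pi.sub_apply, smul_eq_mul]
    ring
  simp only [this]
  rw [integral_sub hgφ hDφ]
  linarith

lemma tendsto_add_smul_unitY (X : Plane) (hX : X ∈ OmegaBar) :
    Tendsto (fun s : ℝ => X + s • unitY) (𝓝[>] 0) (𝓝[OmegaBar] X) := by
  refine tendsto_nhdsWithin_iff.2 ⟨?_, ?_⟩
  · have : Continuous fun s : ℝ => X + s • unitY := by fun_prop
    have h := this.tendsto 0
    simp only [zero_smul, add_zero] at h
    exact h.mono_left nhdsWithin_le_nhds
  · filter_upwards [self_mem_nhdsWithin] with s hs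
    have h0 : 0 ≤ X 1 := hX
    have h1 : 0 < s := hs
    simp [OmegaBar, unitY]
    linarith

lemma add_smul_unitY_mem {X : Plane} (hX : X ∈ OmegaBar) {s : ℝ} (hs : 0 < s) :
    X + s • unitY ∈ Omega := by
  have h0 : 0 ≤ X 1 := hX
  simp [Omega, unitY]
  linarith

/-- A function of class `W^{2,∞}` that is of class `C¹` in the half-plane is bounded and Lipschitz
continuous in the tangential direction, up to the boundary. -/
lemma MemW2inf.exists_bound {u₀ : Plane → ℝ} (hu₀ : MemW2inf u₀) (hd : ContDiffOn ℝ 1 u₀ Omega) :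
    ∃ M L, 0 ≤ L ∧ (∀ x, |u₀ !₂[x, 0]| ≤ M) ∧
      ∀ x x', |u₀ !₂[x, 0] - u₀ !₂[x', 0]| ≤ L * |x - x'| := by
  obtain ⟨hc, hb, hw⟩ := hu₀
  obtain ⟨g, hg, hwg⟩ := hw 0
  obtain ⟨M, -, hM⟩ := hb.exists_ae_bound
  obtain ⟨L, hL0, hL⟩ := hg.1.exists_ae_bound
  have hbound : ∀ X ∈ Omega, |u₀ X| ≤ M := fun X hX =>
    le_of_ae_le_of_continuousOn isOpen_omega hd.continuousOn hM hX
  have hD : ContinuousOn (fun X => fderiv ℝ u₀ X unitX) Omega :=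
    (hd.continuousOn_fderiv_of_isOpen isOpen_omega le_rfl).clm_apply continuousOn_const
  have hDb : ∀ X ∈ Omega, |fderiv ℝ u₀ X unitX| ≤ L := fun X hX => by
    refine le_of_ae_le_of_continuousOn isOpen_omega hD ?_ hX
    filter_upwards [hL, hwg.ae_eq_fderiv hg.1 hd] with Y h1 h2
    rwa [← h2]
  have hmem : ∀ x : ℝ, (!₂[x, 0] : Plane) ∈ OmegaBar := fun x => by simp [OmegaBar]
  -- The bounds are proved on the lines at height `s > 0`, where the function is differentiable, and
  -- carried to the boundary by continuity as `s → 0`.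
  have hlim : ∀ x : ℝ, Tendsto (fun s : ℝ => u₀ (!₂[x, 0] + s • unitY)) (𝓝[>] 0)
      (𝓝 (u₀ !₂[x, 0])) := fun x =>
    (hc _ (hmem x)).tendsto.comp (tendsto_add_smul_unitY _ (hmem x))
  refine ⟨M, L, hL0, fun x => ?_, fun x x' => ?_⟩
  · refine le_of_tendsto (hlim x).abs ?_
    filter_upwards [self_mem_nhdsWithin] with s hs
    exact hbound _ (add_smul_unitY_mem (hmem x) hs)
  · refine le_of_tendsto ((hlim x).sub (hlim x')).abs ?_
    filter_upwards [self_mem_nhdsWithin] with s hs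
    have hder : ∀ y : ℝ, HasDerivAt (fun y : ℝ => u₀ (!₂[y, 0] + s • unitY))
        (fderiv ℝ u₀ (!₂[y, 0] + s • unitY) unitX) y := by
      intro y
      have hO := add_smul_unitY_mem (hmem y) hs
      have h1 : HasDerivAt (fun y : ℝ => (!₂[y, 0] : Plane) + s • unitY) unitX y := by
        have h2 : (fun y : ℝ => (!₂[y, 0] : Plane) + s • unitY) =
            fun y : ℝ => y • unitX + s • unitY := by
          funext y
          congr 1
          ext i
          fin_cases i <;> simp [unitX]
        rw [h2]
        simpa using ((hasDerivAt_id y).smul_const unitX).add_const (s • unitY)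
      exact (((hd.differentiableOn one_ne_zero).differentiableAt
        (isOpen_omega.mem_nhds hO)).hasFDerivAt).comp_hasDerivAt y h1
    have := Convex.norm_image_sub_le_of_norm_hasDerivWithin_le (s := univ) (C := L)
      (fun y _ => (hder y).hasDerivWithinAt)
      (fun y _ => hDb _ (add_smul_unitY_mem (hmem y) hs)) convex_univ (mem_univ x') (mem_univ x)
    simpa only [Real.norm_eq_abs] using this

end FKPN

/-! ### The theorem -/

theorem theorem1 (σ : ℝ → ℝ) (hσ : FKPN.AdmissibleStress σ) (ε₂ : ℝ) (hε₂ : 0 < ε₂)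
    (u₀ : FKPN.Plane → ℝ) (hu₀ : FKPN.MemW2inf u₀)
    (hu₀_harm : InnerProductSpace.HarmonicOnNhd u₀ FKPN.Omega) :
    (∀ ε > 0, ∀ Weps : ℝ → ℝ, FKPN.LocallyHarmonicPotential (fun a => ε * Weps a) →
      ∃ u : ℤ → ℕ → ℝ → ℝ, FKPN.IsLatticeSolution ε ε₂ σ Weps u₀ u ∧
        ∀ v : ℤ → ℕ → ℝ → ℝ, FKPN.IsLatticeSolution ε ε₂ σ Weps u₀ v →
          ∀ i j, ∀ t ≥ 0, v i j t = u i j t) ∧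
    (∀ (Weps : ℝ → ℝ → ℝ) (W : ℝ → ℝ),
      (∀ᶠ ε in 𝓝[>] (0 : ℝ), FKPN.LocallyHarmonicPotential (fun a => ε * Weps ε a)) →
      FKPN.NondegeneratePotential W → FKPN.TendstoC1 Weps W →
      ∀ ueps : ℝ → ℤ → ℕ → ℝ → ℝ,
        (∀ᶠ ε in 𝓝[>] (0 : ℝ), FKPN.IsLatticeSolution ε ε₂ σ (Weps ε) u₀ (ueps ε)) →
        ∃ u : FKPN.Plane → ℝ → ℝ, FKPN.IsPNSolution ε₂ σ W u₀ u ∧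
          FKPN.LatticeTendstoLocallyUniformly ueps u) := by
  -- A harmonic function is `C²`, hence `C¹`, in the open half-plane, so its weak derivatives are
  -- classical and the boundary trace is bounded and Lipschitz.
  obtain ⟨Mg, Lg, hLg, hgM, hgL⟩ := hu₀.exists_bound
    (hu₀_harm.contDiffOn.of_le one_le_two)
  obtain ⟨Cσ, hCσ, hσb, hσL⟩ := hσ.exists_bound
  refine ⟨fun ε hε Weps hW => ?_, fun Weps W hWeps hW hlim ueps hu => ?_⟩
  · obtain ⟨u, hu⟩ := FKPN.exists_isLatticeSolution (ε₂ := ε₂) (u₀ := u₀) hε ⟨Cσ, hσb⟩ hW.1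
      ⟨Mg, fun i => by simpa [FKPN.latticePoint] using hgM (ε * i)⟩
    exact ⟨u, hu, fun v hv i j t ht =>
      le_antisymm (hv.le hε hW.1 hu i j ht) (hu.le hε hW.1 hv i j ht)⟩
  · obtain ⟨K, hK, hWK⟩ := hW.1.exists_lipschitz
    obtain ⟨CW, hCW, hWb⟩ := hW.1.exists_bound
    have hC : ∀ x r, |2 * ε₂ * σ (ε₂ * x) - deriv W r| ≤ 2 * ε₂ * Cσ + CW := fun x r => by
      refine (abs_sub _ _).trans (add_le_add ?_ (hWb r))
      rw [abs_mul, abs_of_pos (by positivity : 0 < 2 * ε₂)]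
      exact mul_le_mul_of_nonneg_left (hσb _) (by positivity)
    have hL : ∀ x x', |2 * ε₂ * σ (ε₂ * x) - 2 * ε₂ * σ (ε₂ * x')| ≤
        2 * ε₂ * (Cσ * ε₂) * |x - x'| := fun x x' => by
      rw [← mul_sub, abs_mul, abs_of_pos (by positivity : 0 < 2 * ε₂), mul_assoc (2 * ε₂)]
      refine mul_le_mul_of_nonneg_left ((hσL _ _).trans_eq ?_) (by positivity)
      rw [← mul_sub, abs_mul, abs_of_pos hε₂, mul_assoc]
    obtain ⟨G, M, hGM, hG⟩ := FKPN.exists_isDuhamelData hgM hLg hgL hσ.1.continuous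
      hW.1.contDiff_deriv.continuous hC (by positivity) hL hK hWK
    have hg : ∀ X : FKPN.Plane, X 1 = 0 → u₀ !₂[X 0, 0] = u₀ X := fun X hX => by
      congr 1
      ext i
      fin_cases i <;> simp [hX]
    refine ⟨_, hGM.isPNSolution hg hG,
      hGM.latticeTendstoLocallyUniformly hg hG hK hWK hC ?_ hlim.2 hu⟩
    filter_upwards [hWeps, self_mem_nhdsWithin] with ε h hε
    exact FKPN.continuous_deriv_of_scaled hε h.1
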